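/- **Setting.** Let $d\ge 1$, $m,\gamma>0$, and let $V,\Phi\in C^1(\mathbb R^d;\mathbb R)$ with $\Phi(-q)=\Phi(q)$. Points of $\mathbb R^{2d}$ are written $(q,p)$, and $(\Phi*\rho)(q)=\int\Phi(q-q')\,\rho(q',p')\,dq'dp'$, $(\nabla\Phi*\rho)(q)=\int\nabla\Phi(q-q')\,\rho(q',p')\,dq'dp'$. For probability densities $\rho$ on $\mathbb R^{2d}$ consider the evolution $$\partial_t\rho=F(\rho)=-\operatorname{div}_q\!\big(\rho\tfrac pm\big)+\operatorname{div}_p\!\big(\rho\nabla V+\rho(\nabla\Phi*\rho)\big)+\mathcal G^*\rho ,$$ understood in the sense of distributions, where $\mathcal G^*$ is the adjoint of one of the operators - (Andersen thermostat) $\mathcal Gf(q,p)=\gamma\int[f(q,p')-f(q,p)]\,(2\pi m)^{-d/2}e^{-|p'|^2/2m}\,dp'$; - (Vlasov–Fokker–Planck) $\mathcal Gf=-\gamma\,\tfrac pm\cdot\nabla_pf+\gamma\Delta_pf$. Put $$E(\rho)=\int\Big(\tfrac{|p|^2}{2m}+V(q)+\tfrac12(\Phi*\rho)(q)\Big)\rho\,dq\,dp,\qquad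 S(\rho)=\int\rho\log\rho\,dq\,dp+E(\rho),$$ $$L(\rho)\xi=\operatorname{div}(\rho J\nabla\xi),\quad J=\begin{pmatrix}0&-\mathbb 1_d\\ \mathbb 1_d&0\end{pmatrix},\qquad W(\rho)=L(\rho)\,dE(\rho).$$ *Regular states.* A probability density $\rho$ is regular if $\rho\in C^1$, $\rho>0$; the functions $|p|^2\rho$, $V\rho$, $\Phi(q-q')\rho(q,p)\rho(q',p')$, $\rho\log\rho$, $|\nabla V+\nabla\Phi*\rho|^2\rho$ and $|\nabla\rho|^2/\rho$ are integrable; and for every $R$ there is $g$ with $g(q)\rho(q,p)$ integrable and $|\nabla\Phi(q-q')|\le g(q')$ whenever $|q|\le R$. *Tangent and cotangent spaces.* $T^*_\rho$ is the space of $\xi\in C^1(\mathbb R^{2d})$ with $\nabla\xi\in L^2(\rho)$, and $T_\rho=H^{-1}(\rho)$ is the space of linear functionals on $T^*_\rho$ bounded by a multiple of $\|\nabla\xi\|_{L^2(\rho)}$. A distribution belongs to $T_\rho$ if on $C_c^\infty(\mathbb R^{2d})$ it coincides with an element of $T_\rho$. A functional $A$ of densities has functional derivative $\zeta$ at $\rho$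 if $\frac{d}{dt}A(\rho+t\sigma)\big|_{t=0}=\int\zeta\sigma$ for all $\sigma\in C_c^\infty$ with $\int\sigma=0$. *Pre-GENERIC.* Functionals $\Psi:T_\rho\to[0,\infty]$ and $\Psi^*:T^*_\rho\to[0,\infty]$ are called symmetric dissipation potentials if they are Legendre transforms of each other, convex, even, zero at zero, continuously differentiable along every line in the interior of the interval where they are finite, and strictly convex on their domains up to null directions: if $f\in\{\Psi,\Psi^*\}$, $f(x),f(y)<\infty$ and $f(x-y)\ne0$, then $f(ax+by)<af(x)+bf(y)$ for all $a,b>0$ with $a+b=1$. The evolution $\partial_t\rho=F(\rho)$ is pre-GENERIC on a set $Z$ of densities, with respect to $S$, $(\Psi,\Psi^*)$ and $W$, if for every $\rho\in Z$: $F(\rho),W(\rho)\in T_\rho$; $S$ has a functional derivative $dS(\rho)\in T^*_\rho$; $\Psi(\rho,\cdot)$ and $\Psi^*(\rho,\cdot)$ are symmetric dissipation potentials; $\langle W(\rho),dS(\rho)\rangle=0$; and $$\Psi\big(\rho,F(\rho)-W(\rho)\big)+\Psi^*\big(\rho,-\tfrac12dS(\rho)\big)+\tfrac12\langle F(\rho),dS(\rho)\rangle=0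 .$$ **Theorem.** At every regular $\rho$, $E$ and $S$ have the functional derivatives $$dE(\rho)=\tfrac{|p|^2}{2m}+V+\Phi*\rho,\qquad dS(\rho)=\log\rho+1+dE(\rho),$$ and both lie in $T^*_\rho$. Moreover, with entropy $S$, vector field $W(\rho)=L(\rho)\,dE(\rho)$ and $\Psi(\rho,\cdot)$ the Legendre transform of $\Psi^*(\rho,\cdot)$: 1. the Andersen thermostat is pre-GENERIC on the set of regular $\rho$ with $F(\rho)\in T_\rho$, with $$\Psi^*(\rho,\xi)=\gamma\iiint\big[\cosh(\xi(q,p')-\xi(q,p))-1\big]\,(2\pi m)^{-d/2}e^{-\frac{|p|^2+|p'|^2}{4m}}\sqrt{\rho(q,p')\rho(q,p)}\,dp'\,dp\,dq;$$ 2. the Vlasov–Fokker–Planck equation is pre-GENERIC on the set of all regular $\rho$, with $$\Psi^*(\rho,\xi)=\gamma\int|\nabla_p\xi|^2\rho\,dq\,dp .$$ -/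

import Mathlib

open MeasureTheory
open scoped NNReal ENNReal ContDiff RealInnerProductSpace

noncomputable section

namespace PreGeneric

section Abstract

variable {X : Type*} [AddCommGroup X] [Module ℝ X]

/-- Strict convexity of an extended-valued functional on its effective domain, up to the directions
on which the functional vanishes. -/
def StrictlyConvexModNull (f : X → ℝ≥0∞) : Prop :=
  ∀ x y : X, f x ≠ ⊤ → f y ≠ ⊤ → f (x - y) ≠ 0 →
    ∀ a b : ℝ≥0, 0 < a → 0 < b → a + b = 1 → f (a • x + b • y) < a • f x + b • f y

/-- Along every line, `f` is continuously differentiable in the interior of the interval on which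
it is finite. -/
def LineC1 (f : X → ℝ≥0∞) : Prop :=
  ∀ x y : X, ContDiffOn ℝ 1 (fun t : ℝ => (f (x + t • y)).toReal)
    (interior {t : ℝ | f (x + t • y) ≠ ⊤})

/-- The Legendre transform of `Ψs`, on a space `T` of linear functionals on `X`.
(For `Ψs 0 = 0` the supremum is nonnegative, so that nothing is lost by `toENNReal`.) -/
def legendre (T : Submodule ℝ (Module.Dual ℝ X)) (Ψs : X → ℝ≥0∞) (v : T) : ℝ≥0∞ :=
  (⨆ ξ : X, (((v : Module.Dual ℝ X) ξ : ℝ) : EReal) - (Ψs ξ : EReal)).toENNReal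

/-- `(Ψ, Ψs)` is a pair of symmetric dissipation potentials: `X` is the cotangent space, `T` the
tangent space, and the two potentials are Legendre transforms of each other. -/
structure IsSymmDissipationPair (T : Submodule ℝ (Module.Dual ℝ X))
    (Ψ : T → ℝ≥0∞) (Ψs : X → ℝ≥0∞) : Prop where
  dual : ∀ v : T, (Ψ v : EReal) =
    ⨆ ξ : X, (((v : Module.Dual ℝ X) ξ : ℝ) : EReal) - (Ψs ξ : EReal)
  bidual : ∀ ξ : X, (Ψs ξ : EReal) =
    ⨆ v : T, (((v : Module.Dual ℝ X) ξ : ℝ) : EReal) - (Ψ v : EReal)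
  convex : ConvexOn ℝ≥0 Set.univ Ψ
  convex_star : ConvexOn ℝ≥0 Set.univ Ψs
  strict : StrictlyConvexModNull Ψ
  strict_star : StrictlyConvexModNull Ψs
  c1 : LineC1 Ψ
  c1_star : LineC1 Ψs
  zero : Ψ 0 = 0
  zero_star : Ψs 0 = 0
  symm : ∀ v, Ψ (-v) = Ψ v
  symm_star : ∀ ξ, Ψs (-ξ) = Ψs ξ

/-- The pre-GENERIC relations at one state. Here `dS` is the differential of the entropy, `W` the
value of the conservative vector field and `F` the velocity prescribed by the evolution. -/
structure IsPreGenericAt (T : Submodule ℝ (Module.Dual ℝ X)) (Ψ : T → ℝ≥0∞) (Ψs : X → ℝ≥0∞)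
    (dS : X) (W F : T) : Prop where
  potentials : IsSymmDissipationPair T Ψ Ψs
  orthogonal : (W : Module.Dual ℝ X) dS = 0
  balance : (Ψ (F - W) : EReal) + (Ψs (-((1 / 2 : ℝ) • dS)) : EReal)
    + (((1 / 2 : ℝ) * (F : Module.Dual ℝ X) dS : ℝ) : EReal) = 0

end Abstract

section PhaseSpace

variable {d : ℕ}

/-- Positions, respectively momenta. -/
abbrev Vec (d : ℕ) := EuclideanSpace ℝ (Fin d)

/-- Phase space: pairs `(q, p)`. -/
abbrev Phase (d : ℕ) := Vec d × Vec d

/-- The gradient in the position variable. -/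
def gradQ (f : Phase d → ℝ) (x : Phase d) : Vec d := gradient (fun q => f (q, x.2)) x.1

/-- The gradient in the momentum variable. -/
def gradP (f : Phase d → ℝ) (x : Phase d) : Vec d := gradient (fun p => f (x.1, p)) x.2

/-- The Laplacian in the momentum variable. -/
def lapP (f : Phase d → ℝ) (x : Phase d) : ℝ :=
  Laplacian.laplacian (fun p => f (x.1, p)) x.2

/-- The measure `ρ(dq, dp) = ρ(q, p) dq dp`. -/
def law (ρ : Phase d → ℝ) : Measure (Phase d) :=
  volume.withDensity fun x => ENNReal.ofReal (ρ x)

/-- Smooth compactly supported functions. -/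
def IsTest (φ : Phase d → ℝ) : Prop := ContDiff ℝ ∞ φ ∧ HasCompactSupport φ

lemma gradQ_add {f g : Phase d → ℝ} (hf : ContDiff ℝ 1 f) (hg : ContDiff ℝ 1 g) :
    gradQ (f + g) = gradQ f + gradQ g := by
  funext x
  have h1 : DifferentiableAt ℝ (fun q => f (q, x.2)) x.1 :=
    (hf.differentiable one_ne_zero).differentiableAt.comp x.1 (by fun_prop)
  have h2 : DifferentiableAt ℝ (fun q => g (q, x.2)) x.1 :=
    (hg.differentiable one_ne_zero).differentiableAt.comp x.1 (by fun_prop)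
  have h := fderiv_add h1 h2
  simp only [gradQ, gradient, Pi.add_apply] at h ⊢
  rw [← map_add, ← h]
  rfl

lemma gradP_add {f g : Phase d → ℝ} (hf : ContDiff ℝ 1 f) (hg : ContDiff ℝ 1 g) :
    gradP (f + g) = gradP f + gradP g := by
  funext x
  have h1 : DifferentiableAt ℝ (fun p => f (x.1, p)) x.2 :=
    (hf.differentiable one_ne_zero).differentiableAt.comp x.2 (by fun_prop)
  have h2 : DifferentiableAt ℝ (fun p => g (x.1, p)) x.2 :=
    (hg.differentiable one_ne_zero).differentiableAt.comp x.2 (by fun_prop)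
  have h := fderiv_add h1 h2
  simp only [gradP, gradient, Pi.add_apply] at h ⊢
  rw [← map_add, ← h]
  rfl

lemma gradQ_smul {f : Phase d → ℝ} (hf : ContDiff ℝ 1 f) (c : ℝ) :
    gradQ (c • f) = c • gradQ f := by
  funext x
  have h1 : DifferentiableAt ℝ (fun q => f (q, x.2)) x.1 :=
    (hf.differentiable one_ne_zero).differentiableAt.comp x.1 (by fun_prop)
  have h := fderiv_const_smul h1 c
  simp only [gradQ, gradient, Pi.smul_apply] at h ⊢
  rw [← map_smul, ← h]
  rfl

lemma gradP_smul {f : Phase d → ℝ} (hf : ContDiff ℝ 1 f) (c : ℝ) :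
    gradP (c • f) = c • gradP f := by
  funext x
  have h1 : DifferentiableAt ℝ (fun p => f (x.1, p)) x.2 :=
    (hf.differentiable one_ne_zero).differentiableAt.comp x.2 (by fun_prop)
  have h := fderiv_const_smul h1 c
  simp only [gradP, gradient, Pi.smul_apply] at h ⊢
  rw [← map_smul, ← h]
  rfl

/-- The cotangent space at `ρ`: functions `ξ` of class `C¹` with `∇ξ ∈ L²(ρ)`. -/
def cotangent (ρ : Phase d → ℝ) : Submodule ℝ (Phase d → ℝ) where
  carrier := {ξ | ContDiff ℝ 1 ξ ∧ MemLp (gradQ ξ) 2 (law ρ) ∧ MemLp (gradP ξ) 2 (law ρ)}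
  zero_mem' := by
    have hQ : gradQ (0 : Phase d → ℝ) = 0 := by
      funext x; simp [gradQ, gradient]
    have hP : gradP (0 : Phase d → ℝ) = 0 := by
      funext x; simp [gradP, gradient]
    refine ⟨contDiff_const, ?_, ?_⟩
    · rw [hQ]; exact MemLp.zero
    · rw [hP]; exact MemLp.zero
  add_mem' := by
    rintro f g ⟨hf, hfQ, hfP⟩ ⟨hg, hgQ, hgP⟩
    refine ⟨hf.add hg, ?_, ?_⟩
    · rw [gradQ_add hf hg]; exact hfQ.add hgQ
    · rw [gradP_add hf hg]; exact hfP.add hgP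
  smul_mem' := by
    rintro c f ⟨hf, hfQ, hfP⟩
    refine ⟨contDiff_const.smul hf, ?_, ?_⟩
    · rw [gradQ_smul hf]; exact hfQ.const_smul c
    · rw [gradP_smul hf]; exact hfP.const_smul c

/-- The seminorm `‖∇ξ‖` in `L²(ρ)`. -/
def h1Norm (ρ ξ : Phase d → ℝ) : ℝ :=
  Real.sqrt (∫ x, (‖gradQ ξ x‖ ^ 2 + ‖gradP ξ x‖ ^ 2) ∂(law ρ))

/-- The tangent space at `ρ`, the negative Sobolev space `H⁻¹(ρ)`: linear functionals on the
cotangent space that are bounded with respect to `ξ ↦ ‖∇ξ‖` in `L²(ρ)`. -/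
def tangent (ρ : Phase d → ℝ) : Submodule ℝ (Module.Dual ℝ (cotangent ρ)) where
  carrier := {v | ∃ C : ℝ, ∀ ξ : cotangent ρ, |v ξ| ≤ C * h1Norm ρ ξ}
  zero_mem' := ⟨0, fun ξ => by simp⟩
  add_mem' := by
    rintro v w ⟨C, hC⟩ ⟨D, hD⟩
    refine ⟨C + D, fun ξ => ?_⟩
    rw [LinearMap.add_apply, add_mul]
    exact (abs_add_le _ _).trans (add_le_add (hC ξ) (hD ξ))
  smul_mem' := by
    rintro c v ⟨C, hC⟩
    refine ⟨|c| * C, fun ξ => ?_⟩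
    rw [LinearMap.smul_apply, smul_eq_mul, abs_mul, mul_assoc]
    exact mul_le_mul_of_nonneg_left (hC ξ) (abs_nonneg c)

/-- A (signed) distribution on phase space, through its values on test functions. -/
abbrev Distrib (d : ℕ) := (Phase d → ℝ) → ℝ

/-- The tangent vector `v` is the (unique) element of `H⁻¹(ρ)` given by the distribution `D`. -/
def Represents {ρ : Phase d → ℝ} (v : tangent ρ) (D : Distrib d) : Prop :=
  ∀ φ : cotangent ρ, IsTest (φ : Phase d → ℝ) → (v : Module.Dual ℝ (cotangent ρ)) φ = D φ

/-- `ζ` is the functional derivative of `A` at the density `ρ`. -/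
def IsFunctionalDeriv (A : (Phase d → ℝ) → ℝ) (ρ ζ : Phase d → ℝ) : Prop :=
  ∀ σ : Phase d → ℝ, IsTest σ → ∫ x, σ x = 0 →
    HasDerivAt (fun t : ℝ => A (fun x => ρ x + t * σ x)) (∫ x, ζ x * σ x) 0

/-- The evolution `∂ₜρ = F(ρ)`, on the set `Z` of densities, is pre-GENERIC with respect to
the entropy `S`, the dissipation potentials `(Ψ, Ψs)` and the vector field `W`. -/
def IsPreGeneric (Z : Set (Phase d → ℝ)) (S : (Phase d → ℝ) → ℝ)
    (Ψ : ∀ ρ : Phase d → ℝ, tangent ρ → ℝ≥0∞) (Ψs : ∀ ρ : Phase d → ℝ, cotangent ρ → ℝ≥0∞)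
    (W F : (Phase d → ℝ) → Distrib d) : Prop :=
  ∀ ρ ∈ Z, ∃ (dS : cotangent ρ) (w f : tangent ρ),
    IsFunctionalDeriv S ρ dS ∧ Represents w (W ρ) ∧ Represents f (F ρ) ∧
      IsPreGenericAt (tangent ρ) (Ψ ρ) (Ψs ρ) dS w f

/-- The distribution `div_q Y` of a vector field `Y`. -/
def divQ (Y : Phase d → Vec d) : Distrib d := fun φ => -∫ x, ⟪Y x, gradQ φ x⟫

/-- The distribution `div_p Y` of a vector field `Y`. -/
def divP (Y : Phase d → Vec d) : Distrib d := fun φ => -∫ x, ⟪Y x, gradP φ x⟫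

/-- The symplectic matrix `J = [0, -1; 1, 0]`, acting on pairs. -/
def sympl (w : Phase d) : Phase d := (-w.2, w.1)

/-- `L(ρ) ξ = div (ρ J ∇ξ)`. -/
def poisson (ρ ξ : Phase d → ℝ) : Distrib d :=
  divQ (fun x => ρ x • (sympl (gradQ ξ x, gradP ξ x)).1) +
    divP (fun x => ρ x • (sympl (gradQ ξ x, gradP ξ x)).2)

/-- `(Φ ∗ ρ)(q) = ∫ Φ(q - q') ρ(dq', dp')`. -/
def conv (Φ : Vec d → ℝ) (ρ : Phase d → ℝ) (q : Vec d) : ℝ := ∫ y, ρ y * Φ (q - y.1)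

/-- `(∇Φ ∗ ρ)(q) = ∫ ∇Φ(q - q') ρ(dq', dp')`. -/
def gradConv (Φ : Vec d → ℝ) (ρ : Phase d → ℝ) (q : Vec d) : Vec d :=
  ∫ y, ρ y • gradient Φ (q - y.1)

/-- `E(ρ) = ∫ (|p|²/2m + V(q) + ½ (Φ ∗ ρ)(q)) ρ(dq, dp)`. -/
def energy (m : ℝ) (V Φ : Vec d → ℝ) (ρ : Phase d → ℝ) : ℝ :=
  ∫ x, (‖x.2‖ ^ 2 / (2 * m) + V x.1 + 1 / 2 * conv Φ ρ x.1) * ρ x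

/-- `S(ρ) = ∫ ρ log ρ + E(ρ)`. -/
def entropy (m : ℝ) (V Φ : Vec d → ℝ) (ρ : Phase d → ℝ) : ℝ :=
  (∫ x, Real.log (ρ x) * ρ x) + energy m V Φ ρ

/-- `dE(ρ)(q, p) = |p|²/2m + V(q) + (Φ ∗ ρ)(q)`. -/
def dEnergy (m : ℝ) (V Φ : Vec d → ℝ) (ρ : Phase d → ℝ) (x : Phase d) : ℝ :=
  ‖x.2‖ ^ 2 / (2 * m) + V x.1 + conv Φ ρ x.1

/-- `dS(ρ) = log ρ + 1 + dE(ρ)`. -/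
def dEntropy (m : ℝ) (V Φ : Vec d → ℝ) (ρ : Phase d → ℝ) (x : Phase d) : ℝ :=
  Real.log (ρ x) + 1 + dEnergy m V Φ ρ x

/-- The conservative vector field `W(ρ) = L(ρ) dE(ρ)`. -/
def hamField (m : ℝ) (V Φ : Vec d → ℝ) (ρ : Phase d → ℝ) : Distrib d :=
  poisson ρ (dEnergy m V Φ ρ)

/-- The density of the centred Gaussian on momenta with covariance `m · Id`. -/
def maxwell (m : ℝ) (p : Vec d) : ℝ :=
  (2 * Real.pi * m) ^ (-(d : ℝ) / 2) * Real.exp (-‖p‖ ^ 2 / (2 * m))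

/-- The generator of the Andersen thermostat. -/
def genAT (m γ : ℝ) (f : Phase d → ℝ) (x : Phase d) : ℝ :=
  γ * ∫ p' : Vec d, (f (x.1, p') - f x) * maxwell m p'

/-- The generator of the Vlasov-Fokker-Planck momentum noise. -/
def genVFP (m γ : ℝ) (f : Phase d → ℝ) (x : Phase d) : ℝ :=
  -(γ * ⟪(1 / m) • x.2, gradP f x⟫) + γ * lapP f x

/-- The adjoint of an operator `G` on functions, `⟨φ, G*ρ⟩ = ∫ Gφ dρ`. -/
def adjointGen (G : (Phase d → ℝ) → Phase d → ℝ) (ρ : Phase d → ℝ) : Distrib d :=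
  fun φ => ∫ x, G φ x * ρ x

/-- `F(ρ) = - div_q (ρ p/m) + div_p (ρ ∇V + ρ (∇Φ ∗ ρ)) + G*ρ`. -/
def dynamics (m : ℝ) (V Φ : Vec d → ℝ) (G : (Phase d → ℝ) → Phase d → ℝ)
    (ρ : Phase d → ℝ) : Distrib d :=
  -divQ (fun x => ρ x • (1 / m) • x.2) +
    divP (fun x => ρ x • gradient V x.1 + ρ x • gradConv Φ ρ x.1) + adjointGen G ρ

/-- The cosh-type potential of the Andersen thermostat. -/
def psiStarAT (m γ : ℝ) (ρ : Phase d → ℝ) (ξ : cotangent ρ) : ℝ≥0∞ :=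
  ∫⁻ q : Vec d, ∫⁻ p : Vec d, ∫⁻ p' : Vec d, ENNReal.ofReal
    (γ * (Real.cosh ((ξ : Phase d → ℝ) (q, p') - (ξ : Phase d → ℝ) (q, p)) - 1) *
      ((2 * Real.pi * m) ^ (-(d : ℝ) / 2) * Real.exp (-(‖p‖ ^ 2 + ‖p'‖ ^ 2) / (4 * m))) *
      Real.sqrt (ρ (q, p') * ρ (q, p)))

/-- The quadratic potential of the Vlasov-Fokker-Planck equation. -/
def psiStarVFP (γ : ℝ) (ρ : Phase d → ℝ) (ξ : cotangent ρ) : ℝ≥0∞ :=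
  ∫⁻ x, ENNReal.ofReal (γ * ‖gradP (ξ : Phase d → ℝ) x‖ ^ 2) ∂(law ρ)

/-- The probability densities at which the entropy, the energy and their differentials make sense:
`ρ` is positive and `C¹`, energy and entropy are finite, the forces are square integrable, the
Fisher information is finite, and `Φ ∗ ρ` may be differentiated under the integral. -/
structure IsRegularState (V Φ : Vec d → ℝ) (ρ : Phase d → ℝ) : Prop where
  contDiff : ContDiff ℝ 1 ρ
  pos : ∀ x, 0 < ρ x
  integrable : Integrable ρ
  integral_eq_one : ∫ x, ρ x = 1
  kinetic : Integrable fun x => ‖x.2‖ ^ 2 * ρ x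
  potential : Integrable fun x => V x.1 * ρ x
  interaction : Integrable fun z : Phase d × Phase d => Φ (z.1.1 - z.2.1) * ρ z.1 * ρ z.2
  entropic : Integrable fun x => Real.log (ρ x) * ρ x
  dominated : ∀ R : ℝ, ∃ g : Vec d → ℝ, (Integrable fun y : Phase d => g y.1 * ρ y) ∧
    ∀ q q' : Vec d, ‖q‖ ≤ R → ‖gradient Φ (q - q')‖ ≤ g q'
  force : Integrable fun x => ‖gradient V x.1 + gradConv Φ ρ x.1‖ ^ 2 * ρ x
  fisherQ : Integrable fun x => ‖gradQ ρ x‖ ^ 2 / ρ x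
  fisherP : Integrable fun x => ‖gradP ρ x‖ ^ 2 / ρ x

/-- The regular states at which the velocity `F(ρ)` is a tangent vector, that is, lies in
`H⁻¹(ρ)`. -/
def tangentialStates (V Φ : Vec d → ℝ) (F : (Phase d → ℝ) → Distrib d) : Set (Phase d → ℝ) :=
  {ρ | IsRegularState V Φ ρ ∧ ∃ f : tangent ρ, Represents f (F ρ)}

end PhaseSpace

end PreGeneric

end

open PreGeneric

/-!
# The Andersen thermostat and the Vlasov-Fokker-Planck equation are pre-GENERIC

For both equations the velocity splits as `F = W + v`, where `W` is the Hamiltonian vector field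
and `v` the thermostat, and `v` is the derivative of the potential `Ψ*` at `η = -dS / 2`. Equality
in the Young inequality `Ψ(v) + Ψ*(η) ≥ ⟨v, η⟩` is then the balance law, because `⟨W, dS⟩ = 0`. The
latter holds since `W` is antisymmetric in `dE` and divergence free, so that it annihilates both
`dE` and `log ρ` (`hamTangent_entropyCovector`); the integrations by parts are justified by the
finiteness of the kinetic energy, of the mean square force and of the Fisher information.

For the Vlasov-Fokker-Planck equation, `v` is the field `2γ ∇ₚη`, and all is a matter of quadratic
forms. For the Andersen thermostat let `a = γ √(M M' ρ ρ')` be the symmetrised jump rate, where `M`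
is the Maxwellian and a prime stands for the evaluation at `(q, p')`. The increments `δη = η' - η`
satisfy `a exp δη = γ ρ M'` (`collisionRate_mul_exp`). So `a sinh δη` is half the net flux, and `v`
is given by the flux `a sinh δη` on test functions. This representation has to be extended to `η`,
which is neither bounded nor compactly supported. Since `v` is continuous for the norm of `∇ξ` in
`L²(ρ)`, it extends to bounded functions by cut-off and mollification (`exists_test_approx`).
Truncations `ηₙ` of `η` by bounded increasing functions then satisfy `sinh δη · δηₙ ≥ 0`, with
integrals converging to `⟨v, η⟩`, so that Fatou's lemma and dominated convergence give `⟨v, η⟩ = ∫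
a sinh δη · δη` (`integrable_sinh_mul_force`, `apply_eq_integral`).

It remains to see that `Ψ*` and its Legendre transform `Ψ` are symmetric dissipation potentials.
The nontrivial points are that `Ψ` is strictly convex and `C¹` along lines, and that `Ψ*` is the
transform of `Ψ`. Both potentials satisfy `2 Ψ*(x) + 2 Ψ*(y) ≤ Ψ*(x + y) + Ψ*(x - y)`, so that
almost-maximizers in the definition of `Ψ(v)` are close to each other in the sense of `Ψ*`. A
gliding hump argument (`continuous_of_ne_top`) shows that tangent vectors `y` with `Ψ(y) < ∞` are
continuous in this sense. Hence the values of `y` along almost-maximizers converge, to the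
derivative of `Ψ` in the direction `y` (`contDiff_legendre_line`). Strict convexity of `Ψ` follows
from the smoothness of `Ψ*` at almost-maximizers (`strictlyConvexModNull_legendre`). These
arguments are carried out for the abstract class `IsUniformModular`, of which `∫ (cosh A x - 1) dμ`
and `γ ‖B x‖²` are instances. Smoothness of the first one along lines is the analyticity of moment
generating functions (`lineC1_coshModular`). Finally, `Ψ*` is the transform of `Ψ` because the flux
`a sinh δξ`, restricted to a large ball, defines a tangent vector (`exists_tangent_of_flux`), for
which `ξ` almost attains the supremum.
-/

open MeasureTheory
open scoped NNReal ENNReal ContDiff RealInnerProductSpace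

noncomputable section

namespace PreGeneric

/-! ### Legendre transforms of uniformly convex modulars -/

section Legendre

variable {X : Type*} [AddCommGroup X] [Module ℝ X]
  {T : Submodule ℝ (Module.Dual ℝ X)} {f : X → ℝ≥0∞} {C : Submodule ℝ X}

lemma coe_legendre (h0 : f 0 = 0) (v : T) :
    (legendre T f v : EReal) = ⨆ ξ : X, ((v.1 ξ : ℝ) : EReal) - (f ξ : EReal) := by
  refine EReal.coe_toENNReal (le_iSup_of_le 0 ?_)
  simp [h0]

/-- A real number `c ≥ 0` bounds the Legendre transform from above if and only if the Young
inequality holds with `c`. -/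
lemma legendre_le_ofReal_iff (h0 : f 0 = 0) (v : T) {c : ℝ} (hc : 0 ≤ c) :
    legendre T f v ≤ ENNReal.ofReal c ↔ ∀ x, f x ≠ ⊤ → v.1 x ≤ (f x).toReal + c := by
  rw [← EReal.coe_ennreal_le_coe_ennreal_iff, coe_legendre h0, iSup_le_iff,
    EReal.coe_ennreal_ofReal, max_eq_left hc]
  refine forall_congr' fun x => ?_
  by_cases hx : f x = ⊤
  · simp [hx]
  · simp only [ne_eq, hx, not_false_eq_true, forall_const]
    rw [← ENNReal.ofReal_toReal hx, EReal.coe_ennreal_ofReal,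
      max_eq_left ENNReal.toReal_nonneg, ← EReal.coe_sub, EReal.coe_le_coe_iff,
      ENNReal.toReal_ofReal ENNReal.toReal_nonneg, sub_le_iff_le_add']

lemma le_add_legendre (h0 : f 0 = 0) {v : T} (hv : legendre T f v ≠ ⊤) {x : X} (hx : f x ≠ ⊤) :
    v.1 x ≤ (f x).toReal + (legendre T f v).toReal :=
  (legendre_le_ofReal_iff h0 v ENNReal.toReal_nonneg).1 (ENNReal.ofReal_toReal hv).ge x hx

/-- Dissipation potentials `f` whose Legendre transform is again strictly convex and smooth.
The models are quadratic forms and `∫ (cosh A x - 1) dμ`. The field `clarkson` is a one-sided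
parallelogram law. It makes `f` uniformly convex, which gives the smoothness of the transform. The
remaining fields concern a subspace `C`, the core: by `approx` it is large enough to compute the
Legendre transform; by `cont`, `f` is continuous at each point of the core for convergence in the
sense `f z → 0`; and by `secondDiff` the second differences of `f` are of second order, which gives
the strict convexity of the transform. -/
structure IsUniformModular (T : Submodule ℝ (Module.Dual ℝ X)) (f : X → ℝ≥0∞)
    (C : Submodule ℝ X) : Prop where
  zero : f 0 = 0
  neg : ∀ x, f (-x) = f x
  convex : ConvexOn ℝ≥0 Set.univ f
  clarkson : ∀ x y, 2 * f x + 2 * f y ≤ f (x + y) + f (x - y)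
  null : ∀ x, f x = 0 → f ((2 : ℝ) • x) = 0
  ne_top : ∀ x ∈ C, f x ≠ ⊤
  approx : ∀ (v : T) (x : X), f x ≠ ⊤ → ∀ ε > 0,
    ∃ y ∈ C, |v.1 y - v.1 x| ≤ ε ∧ (f y).toReal ≤ (f x).toReal + ε
  cont : ∀ x ∈ C, ∀ ε > 0, ∃ δ > 0, ∀ z ∈ C, (f z).toReal ≤ δ →
    (f (x + z)).toReal ≤ (f x).toReal + ε
  secondDiff : ∀ z ∈ C, ∃ K : ℝ, 0 ≤ K ∧ ∀ x ∈ C, ∀ s : ℝ, |s| ≤ 1 →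
    (f (x + s • z)).toReal + (f (x - s • z)).toReal - 2 * (f x).toReal ≤
      K * s ^ 2 * (1 + (f x).toReal)

namespace IsUniformModular

variable (h : IsUniformModular T f C)
include h

lemma legendre_le {v : T} {c : ℝ} (hv : ∀ x ∈ C, v.1 x ≤ (f x).toReal + c) :
    legendre T f v ≤ ENNReal.ofReal c := by
  have hc : 0 ≤ c := by simpa [h.zero] using hv 0 C.zero_mem
  refine (legendre_le_ofReal_iff h.zero v hc).2 fun x hx => ?_
  refine le_of_forall_pos_le_add fun ε hε => ?_
  obtain ⟨y, hy, h1, h2⟩ := h.approx v x hx (ε / 2) (half_pos hε)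
  have := hv y hy
  have := abs_le.1 h1
  linarith

lemma legendre_ne_top {v : T} {c : ℝ} (hv : ∀ x ∈ C, v.1 x ≤ (f x).toReal + c) :
    legendre T f v ≠ ⊤ :=
  ((h.legendre_le hv).trans_lt ENNReal.ofReal_lt_top).ne

lemma toReal_legendre_le {v : T} {c : ℝ} (hv : ∀ x ∈ C, v.1 x ≤ (f x).toReal + c) :
    (legendre T f v).toReal ≤ c := by
  have hc : 0 ≤ c := by simpa [h.zero] using hv 0 C.zero_mem
  exact ENNReal.toReal_le_of_le_ofReal hc (h.legendre_le hv)

lemma le_core {v : T} (hv : legendre T f v ≠ ⊤) {x : X} (hx : x ∈ C) :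
    v.1 x ≤ (f x).toReal + (legendre T f v).toReal :=
  le_add_legendre h.zero hv (h.ne_top x hx)

lemma abs_le_core {v : T} (hv : legendre T f v ≠ ⊤) {x : X} (hx : x ∈ C) :
    |v.1 x| ≤ (f x).toReal + (legendre T f v).toReal := by
  have := h.le_core hv (C.neg_mem hx)
  rw [h.neg, map_neg] at this
  exact abs_le.2 ⟨by linarith, h.le_core hv hx⟩

lemma legendre_zero : legendre T f 0 = 0 := by
  have := h.legendre_le (v := 0) (c := 0) (fun x _ => by simp)
  simpa using this

lemma legendre_neg (v : T) : legendre T f (-v) = legendre T f v := by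
  have key : ∀ v : T, legendre T f (-v) ≤ legendre T f v := by
    intro v
    by_cases hv : legendre T f v = ⊤
    · simp [hv]
    · rw [← ENNReal.ofReal_toReal hv]
      exact h.legendre_le fun x hx => by
        have := (abs_le.1 (h.abs_le_core hv hx)).1
        change -(v.1 x) ≤ _
        linarith
  refine le_antisymm (key v) ?_
  have := key (-v)
  rwa [show -(-v) = v from neg_neg v] at this

/-- Almost-maximizers, up to `ε`, in the definition of the Legendre transform, within the core. The
supremum need not be attained, as the space of covectors is not complete. -/
def IsMax (_ : IsUniformModular T f C) (v : T) (ε : ℝ) (x : X) : Prop :=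
  x ∈ C ∧ (legendre T f v).toReal - ε ≤ v.1 x - (f x).toReal

lemma exists_isMax (v : T) {ε : ℝ} (hε : 0 < ε) : ∃ x, h.IsMax v ε x := by
  by_contra! hcon
  have := h.toReal_legendre_le (v := v) (c := (legendre T f v).toReal - ε) fun x hx => by
    have := hcon x
    simp only [IsMax, hx, true_and, not_le] at this
    linarith
  linarith

lemma four_mul_half {x : X} (hx : x ∈ C) :
    4 * (f ((1 / 2 : ℝ) • x)).toReal ≤ (f x).toReal := by
  have h1 := h.clarkson ((1 / 2 : ℝ) • x) ((1 / 2 : ℝ) • x)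
  rw [← add_smul, sub_self, h.zero, add_zero] at h1
  norm_num at h1
  have h2 := ENNReal.toReal_mono (h.ne_top x hx) h1
  have hf := h.ne_top _ (C.smul_mem (1 / 2 : ℝ) hx)
  norm_num at hf h2
  rw [ENNReal.toReal_add (ENNReal.mul_ne_top (by norm_num) hf)
    (ENNReal.mul_ne_top (by norm_num) hf)] at h2
  norm_num at h2 ⊢
  linarith

lemma clarkson_toReal {x y : X} (hx : x ∈ C) (hy : y ∈ C) :
    2 * (f ((1 / 2 : ℝ) • (x + y))).toReal + 2 * (f ((1 / 2 : ℝ) • (x - y))).toReal ≤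
      (f x).toReal + (f y).toReal := by
  have h1 := h.clarkson ((1 / 2 : ℝ) • (x + y)) ((1 / 2 : ℝ) • (x - y))
  rw [show (1 / 2 : ℝ) • (x + y) + (1 / 2 : ℝ) • (x - y) = x by module,
    show (1 / 2 : ℝ) • (x + y) - (1 / 2 : ℝ) • (x - y) = y by module] at h1
  have h2 := ENNReal.toReal_mono (ENNReal.add_ne_top.2 ⟨h.ne_top x hx, h.ne_top y hy⟩) h1
  rw [ENNReal.toReal_add (ENNReal.mul_ne_top (by norm_num) (h.ne_top _ (C.smul_mem _
      (C.add_mem hx hy)))) (ENNReal.mul_ne_top (by norm_num) (h.ne_top _ (C.smul_mem _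
      (C.sub_mem hx hy)))), ENNReal.toReal_add (h.ne_top x hx) (h.ne_top y hy)] at h2
  simpa using h2

/-- The domain of the Legendre transform is stable under dilations: the inequality
`4 f (x / 2) ≤ f x` gives `Ψ (2 v) ≤ 4 Ψ v`. -/
lemma legendre_smul_ne_top {v : T} (hv : legendre T f v ≠ ⊤) (c : ℝ) :
    legendre T f (c • v) ≠ ⊤ := by
  have two : ∀ w : T, legendre T f w ≠ ⊤ → legendre T f ((2 : ℝ) • w) ≠ ⊤ := by
    intro w hw
    refine h.legendre_ne_top (c := 4 * (legendre T f w).toReal) fun x hx => ?_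
    have h1 := h.le_core hw (C.smul_mem (1 / 2 : ℝ) hx)
    have h2 := h.four_mul_half hx
    rw [map_smul, smul_eq_mul] at h1
    change (2 : ℝ) * w.1 x ≤ _
    linarith
  have pow : ∀ n : ℕ, legendre T f ((2 : ℝ) ^ n • v) ≠ ⊤ := by
    intro n
    induction n with
    | zero => simpa using hv
    | succ n ih => rw [pow_succ', mul_smul]; exact two _ ih
  obtain ⟨n, hn⟩ := pow_unbounded_of_one_lt |c| (one_lt_two (α := ℝ))
  refine h.legendre_ne_top (c := (legendre T f ((2 : ℝ) ^ n • v)).toReal) fun x hx => ?_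
  have h1 := h.abs_le_core (pow n) hx
  change |(2 : ℝ) ^ n * v.1 x| ≤ _ at h1
  change c * v.1 x ≤ _
  refine le_trans ?_ h1
  rw [abs_mul, abs_of_pos (by positivity : (0 : ℝ) < 2 ^ n)]
  exact (le_abs_self _).trans (by rw [abs_mul]; gcongr)

lemma legendre_add_ne_top {v w : T} (hv : legendre T f v ≠ ⊤) (hw : legendre T f w ≠ ⊤) :
    legendre T f (v + w) ≠ ⊤ := by
  refine h.legendre_ne_top (c := ((legendre T f ((2 : ℝ) • v)).toReal +
    (legendre T f ((2 : ℝ) • w)).toReal) / 2) fun x hx => ?_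
  have h1 := h.le_core (h.legendre_smul_ne_top hv 2) hx
  have h2 := h.le_core (h.legendre_smul_ne_top hw 2) hx
  change (2 : ℝ) * v.1 x ≤ _ at h1
  change (2 : ℝ) * w.1 x ≤ _ at h2
  change v.1 x + w.1 x ≤ _
  linarith

/-- Tangent vectors in the domain of `Ψ` are continuous for the modular `f` on the core. If not,
there are `zₖ` with `f zₖ → 0` and `y zₖ > ε`, and a gliding hump gives sums of such `zₖ` on which
`f` stays bounded while `y` does not. -/
lemma continuous_of_ne_top {y : T} (hy : legendre T f y ≠ ⊤) {ε : ℝ} (hε : 0 < ε) :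
    ∃ δ > 0, ∀ x ∈ C, (f x).toReal ≤ δ → |y.1 x| ≤ ε := by
  by_contra! hcon
  have hump : ∀ δ > 0, ∃ z ∈ C, (f z).toReal ≤ δ ∧ ε ≤ y.1 z := by
    intro δ hδ
    obtain ⟨x, hx, h1, h2⟩ := hcon δ hδ
    rcases le_total 0 (y.1 x) with h0 | h0
    · exact ⟨x, hx, h1, by rw [abs_of_nonneg h0] at h2; exact h2.le⟩
    · exact ⟨-x, C.neg_mem hx, by rwa [h.neg], by
        rw [abs_of_nonpos h0] at h2; rw [map_neg]; exact h2.le⟩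
  have sums : ∀ n : ℕ, ∃ x ∈ C, (f x).toReal < 1 ∧ n * ε ≤ y.1 x := by
    intro n
    induction n with
    | zero => exact ⟨0, C.zero_mem, by simp [h.zero], by simp⟩
    | succ n ih =>
      obtain ⟨x, hx, h1, h2⟩ := ih
      obtain ⟨δ, hδ, h3⟩ := h.cont x hx ((1 - (f x).toReal) / 2) (by linarith)
      obtain ⟨z, hz, h4, h5⟩ := hump δ hδ
      refine ⟨x + z, C.add_mem hx hz, ?_, ?_⟩
      · have := h3 z hz h4
        linarith
      · rw [map_add]; push_cast; linarith
  obtain ⟨n, hn⟩ := exists_nat_gt ((1 + (legendre T f y).toReal) / ε)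
  obtain ⟨x, hx, h1, h2⟩ := sums n
  have h3 := h.le_core hy hx
  rw [div_lt_iff₀ hε] at hn
  linarith

/-- By uniform convexity, almost-maximizers for the same tangent vector are close. -/
lemma IsMax.half_sub {v : T} (hv : legendre T f v ≠ ⊤) {ε : ℝ} {x x' : X}
    (hx : h.IsMax v ε x) (hx' : h.IsMax v ε x') : (f ((1 / 2 : ℝ) • (x - x'))).toReal ≤ ε := by
  have h1 := h.clarkson_toReal hx.1 hx'.1
  have h2 := h.le_core hv (C.smul_mem (1 / 2 : ℝ) (C.add_mem hx.1 hx'.1))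
  have h3 := hx.2
  have h4 := hx'.2
  rw [map_smul, map_add, smul_eq_mul] at h2
  linarith

lemma isMax_mono {v : T} {ε ε' : ℝ} (hε : ε ≤ ε') {x : X} (hx : h.IsMax v ε x) :
    h.IsMax v ε' x := ⟨hx.1, by linarith [hx.2]⟩

/-- Along almost-maximizers for `v`, the values of a tangent vector `y` converge. The limit is the
derivative of `Ψ` at `v` in the direction `y`. -/
lemma exists_slope {v y : T} (hv : legendre T f v ≠ ⊤) (hy : legendre T f y ≠ ⊤) :
    ∃ l : ℝ, ∀ ε > 0, ∃ κ > 0, ∀ x, h.IsMax v κ x → |y.1 x - l| ≤ ε := by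
  have cauchy : ∀ ε > 0, ∃ κ > 0, ∀ x x', h.IsMax v κ x → h.IsMax v κ x' →
      |y.1 x - y.1 x'| ≤ ε := by
    intro ε hε
    obtain ⟨δ, hδ, h1⟩ := h.continuous_of_ne_top hy (half_pos hε)
    refine ⟨δ, hδ, fun x x' hx hx' => ?_⟩
    have h2 := h1 _ (C.smul_mem (1 / 2 : ℝ) (C.sub_mem hx.1 hx'.1)) (hx.half_sub h hv hx')
    rw [map_smul, map_sub, smul_eq_mul, abs_mul] at h2
    norm_num at h2
    linarith
  choose x hx using fun n : ℕ => h.exists_isMax v (ε := 1 / ((n : ℝ) + 1)) (by positivity)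
  have hmono : ∀ κ > 0, ∃ N : ℕ, ∀ n ≥ N, h.IsMax v κ (x n) := by
    intro κ hκ
    obtain ⟨N, hN⟩ := exists_nat_one_div_lt hκ
    refine ⟨N, fun n hn => h.isMax_mono ?_ (hx n)⟩
    refine le_trans ?_ hN.le
    gcongr
  have hc : CauchySeq fun n => y.1 (x n) := by
    rw [Metric.cauchySeq_iff']
    intro ε hε
    obtain ⟨κ, hκ, h1⟩ := cauchy (ε / 2) (half_pos hε)
    obtain ⟨N, hN⟩ := hmono κ hκ
    exact ⟨N, fun n hn => (h1 _ _ (hN n hn) (hN N le_rfl)).trans_lt (half_lt_self hε)⟩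
  obtain ⟨l, hl⟩ := cauchySeq_tendsto_of_complete hc
  refine ⟨l, fun ε hε => ?_⟩
  obtain ⟨κ, hκ, h1⟩ := cauchy ε hε
  refine ⟨κ, hκ, fun z hz => ?_⟩
  obtain ⟨N, hN⟩ := hmono κ hκ
  exact le_of_tendsto ((tendsto_const_nhds.sub hl).abs)
    (Filter.eventually_atTop.2 ⟨N, fun n hn => h1 z _ hz (hN n hn)⟩)

end IsUniformModular

/-- A function on the line with a continuous selection of subgradients is of class `C¹`. -/
lemma contDiff_one_of_subgradient {g l : ℝ → ℝ} (hg : ∀ s t, g t + (s - t) * l t ≤ g s)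
    (hl : Continuous l) : ContDiff ℝ 1 g := by
  have hd : ∀ t, HasDerivAt g (l t) t := by
    intro t
    rw [hasDerivAt_iff_isLittleO, Asymptotics.isLittleO_iff]
    intro c hc
    obtain ⟨δ, hδ, h1⟩ := Metric.continuousAt_iff.1 hl.continuousAt c hc
    refine Metric.eventually_nhds_iff.2 ⟨δ, hδ, fun s hs => ?_⟩
    have h2 := hg s t
    have h3 := hg t s
    have h4 := (h1 hs).le
    rw [Real.dist_eq] at h4
    rw [smul_eq_mul, Real.norm_eq_abs, Real.norm_eq_abs, abs_of_nonneg (by linarith)]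
    calc g s - g t - (s - t) * l t ≤ (s - t) * (l s - l t) := by linarith
      _ ≤ |(s - t) * (l s - l t)| := le_abs_self _
      _ = |l s - l t| * |s - t| := by rw [abs_mul, mul_comm]
      _ ≤ c * |s - t| := by gcongr
  rw [contDiff_one_iff_deriv]
  refine ⟨fun t => (hd t).differentiableAt, ?_⟩
  rwa [show deriv g = l from funext fun t => (hd t).deriv]

namespace IsUniformModular

variable (h : IsUniformModular T f C)
include h

/-- On a line in its domain the Legendre transform has the slopes of `exists_slope` as subgradients.
These depend continuously on the parameter, since almost-maximizers for nearby parameters are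
almost-maximizers for the given one. -/
lemma contDiff_legendre_line {v y : T} (hv : legendre T f v ≠ ⊤) (hy : legendre T f y ≠ ⊤) :
    ContDiff ℝ 1 fun t : ℝ => (legendre T f (v + t • y)).toReal := by
  have hfin : ∀ t : ℝ, legendre T f (v + t • y) ≠ ⊤ := fun t =>
    h.legendre_add_ne_top hv (h.legendre_smul_ne_top hy t)
  choose l hl using fun t : ℝ => h.exists_slope (hfin t) hy
  have happ : ∀ (t : ℝ) (x : X), (v + t • y).1 x = v.1 x + t * y.1 x := fun t x => rfl
  have hsub : ∀ s t : ℝ, (legendre T f (v + t • y)).toReal + (s - t) * l t ≤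
      (legendre T f (v + s • y)).toReal := by
    intro s t
    refine le_of_forall_pos_le_add fun ε hε => ?_
    set ε' := ε / (1 + |s - t|) with hε'
    have hp : 0 < 1 + |s - t| := by positivity
    have hε'0 : 0 < ε' := by positivity
    obtain ⟨κ, hκ, h1⟩ := hl t ε' hε'0
    obtain ⟨x, hx⟩ := h.exists_isMax (v + t • y) (lt_min hκ hε'0)
    have h2 := h1 x (h.isMax_mono (min_le_left _ _) hx)
    have h3 := (h.isMax_mono (min_le_right _ _) hx).2
    have h4 := h.le_core (hfin s) hx.1
    rw [happ] at h3 h4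
    have h5 : (s - t) * (l t - y.1 x) ≤ |s - t| * ε' := by
      refine (le_abs_self _).trans ?_
      rw [abs_mul, abs_sub_comm (l t)]
      gcongr
    have h6 : ε' * (1 + |s - t|) = ε := div_mul_cancel₀ _ hp.ne'
    linarith
  refine contDiff_one_of_subgradient hsub ?_
  have hmono : Monotone l := by
    intro s t hst
    rcases hst.eq_or_lt with rfl | hst
    · rfl
    · have h1 := hsub s t
      have h2 := hsub t s
      have : (t - s) * (l s - l t) ≤ 0 := by linarith
      nlinarith
  rw [continuous_iff_continuousAt]
  intro t
  rw [Metric.continuousAt_iff]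
  intro ε hε
  obtain ⟨κ, hκ, h1⟩ := hl t (ε / 3) (by positivity)
  -- a bound for `|y x - l t|` along almost-maximizers `x` for parameters within distance `1` of `t`
  set B := 1 + 2 * (|l (t - 1)| + |l (t + 1)|) + |l t| with hB
  have hB0 : 0 < B := by positivity
  refine ⟨min 1 (κ / (2 * B)), by positivity, fun s hs => ?_⟩
  rw [Real.dist_eq] at hs ⊢
  have hs1 : |s - t| < 1 := hs.trans_le (min_le_left _ _)
  have hs2 : |s - t| * B ≤ κ / 2 := by
    have := (hs.trans_le (min_le_right _ _)).le
    calc |s - t| * B ≤ κ / (2 * B) * B := by gcongr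
      _ = κ / 2 := by field_simp
  obtain ⟨κ', hκ', h2⟩ := hl s (min 1 (ε / 3)) (by positivity)
  obtain ⟨x, hx⟩ := h.exists_isMax (v + s • y) (lt_min hκ' (half_pos hκ))
  have h3 := h2 x (h.isMax_mono (min_le_left _ _) hx)
  have h4 := (h.isMax_mono (min_le_right _ _) hx).2
  have h5 := hsub s t
  have hls : |l s| ≤ |l (t - 1)| + |l (t + 1)| := by
    have a1 := hmono (show t - 1 ≤ s by linarith [(abs_lt.1 hs1).1])
    have a2 := hmono (show s ≤ t + 1 by linarith [(abs_lt.1 hs1).2])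
    refine abs_le.2 ⟨?_, ?_⟩
    · linarith [neg_abs_le (l (t - 1)), abs_nonneg (l (t + 1))]
    · linarith [le_abs_self (l (t + 1)), abs_nonneg (l (t - 1))]
  have h6 : |y.1 x - l t| ≤ B := by
    have b1 := abs_sub_le (y.1 x) (l s) (l t)
    have b2 := abs_sub (l s) (l t)
    have b3 := h3.trans (min_le_left _ _)
    have := abs_nonneg (l s)
    linarith
  have h7 : (s - t) * (y.1 x - l t) ≤ κ / 2 := by
    refine (le_abs_self _).trans (le_trans ?_ hs2)
    rw [abs_mul]
    gcongr
  -- the almost-maximizer `x` for the parameter `s` is one for `t` as well, with error at most `κ`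
  have h8 := h1 x ⟨hx.1, by rw [happ] at h4 ⊢; linarith⟩
  have h9 := abs_sub_le (l s) (y.1 x) (l t)
  rw [abs_sub_comm (l s) (y.1 x)] at h9
  have := h3.trans (min_le_right _ _)
  linarith

/-- A line meets the domain of the Legendre transform in at most a point, or is contained in it. -/
lemma lineC1_legendre : LineC1 (legendre T f) := by
  intro v y
  by_cases hsub : {t : ℝ | legendre T f (v + t • y) ≠ ⊤}.Subsingleton
  · have : interior {t : ℝ | legendre T f (v + t • y) ≠ ⊤} = ∅ := by
      rcases hsub.eq_empty_or_singleton with h1 | ⟨t, h1⟩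
      · rw [h1, interior_empty]
      · rw [h1, interior_singleton]
    rw [this]
    exact contDiffOn_empty
  · rw [Set.not_subsingleton_iff] at hsub
    obtain ⟨s, hs, t, ht, hst⟩ := hsub
    have hy : legendre T f y ≠ ⊤ := by
      have := h.legendre_smul_ne_top (h.legendre_add_ne_top hs
        (h.legendre_smul_ne_top ht (-1))) (1 / (s - t))
      rwa [show (1 / (s - t)) • (v + s • y + (-1 : ℝ) • (v + t • y)) = y by
        rw [show v + s • y + (-1 : ℝ) • (v + t • y) = (s - t) • y by module, smul_smul,
          one_div_mul_cancel (sub_ne_zero.2 hst), one_smul]] at this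
    have hv : legendre T f v ≠ ⊤ := by
      have := h.legendre_add_ne_top hs (h.legendre_smul_ne_top hy (-s))
      rwa [show v + s • y + (-s) • y = v by module] at this
    exact (h.contDiff_legendre_line hv hy).contDiffOn

lemma legendre_convex_comb {v w : T} (hv : legendre T f v ≠ ⊤) (hw : legendre T f w ≠ ⊤)
    {a b : ℝ} (ha : 0 ≤ a) (hb : 0 ≤ b) (hab : a + b = 1) :
    legendre T f (a • v + b • w) ≤
      ENNReal.ofReal (a * (legendre T f v).toReal + b * (legendre T f w).toReal) := by
  refine h.legendre_le fun x hx => ?_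
  have h1 := mul_le_mul_of_nonneg_left (h.le_core hv hx) ha
  have h2 := mul_le_mul_of_nonneg_left (h.le_core hw hx) hb
  change a * v.1 x + b * w.1 x ≤ _
  have : (f x).toReal = a * (f x).toReal + b * (f x).toReal := by rw [← add_mul, hab, one_mul]
  linarith

lemma convexOn_legendre : ConvexOn ℝ≥0 Set.univ (legendre T f) := by
  refine ⟨convex_univ, fun v _ w _ a b ha hb hab => ?_⟩
  rcases eq_or_ne a 0 with rfl | ha'
  · rw [zero_add] at hab; subst hab; simp
  rcases eq_or_ne b 0 with rfl | hb'
  · rw [add_zero] at hab; subst hab; simp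
  by_cases hv : legendre T f v = ⊤
  · rw [hv, ENNReal.smul_top]; simp [ha']
  by_cases hw : legendre T f w = ⊤
  · rw [hw, ENNReal.smul_top b]; simp [hb']
  have := h.legendre_convex_comb hv hw (a := a) (b := b) a.2 b.2
    (by exact_mod_cast congrArg NNReal.toReal hab)
  rw [ENNReal.ofReal_add (by positivity) (by positivity), ENNReal.ofReal_mul a.coe_nonneg,
    ENNReal.ofReal_mul b.coe_nonneg, ENNReal.ofReal_toReal hv, ENNReal.ofReal_toReal hw] at this
  simpa [ENNReal.smul_def, NNReal.smul_def] using this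

/-- Almost-maximizers have bounded modular. -/
lemma IsMax.toReal_le {v : T} (hv : legendre T f v ≠ ⊤) {x : X} (hx : h.IsMax v 1 x) :
    (f x).toReal ≤ (legendre T f ((2 : ℝ) • v)).toReal + 2 := by
  have h1 := h.le_core (h.legendre_smul_ne_top hv 2) hx.1
  change 2 * v.1 x ≤ _ at h1
  have h2 := hx.2
  have : 0 ≤ (legendre T f v).toReal := ENNReal.toReal_nonneg
  linarith

/-- If `Ψ` is affine on the segment between `v` and `w`, then almost-maximizers for a point inside
are almost-maximizers for `v` and for `w`. As the second differences of `f` are of second order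
there, `v` and `w` agree on the core. -/
lemma strictlyConvexModNull_legendre : StrictlyConvexModNull (legendre T f) := by
  intro v w hv hw hvw a b ha hb hab
  by_contra hcon
  rw [not_lt] at hcon
  have hab' : (a : ℝ) + b = 1 := by exact_mod_cast congrArg NNReal.toReal hab
  have ha' : (0 : ℝ) < a := by exact_mod_cast ha
  have hb' : (0 : ℝ) < b := by exact_mod_cast hb
  set u : T := (a : ℝ) • v + (b : ℝ) • w with hu
  have hufin : legendre T f u ≠ ⊤ :=
    h.legendre_add_ne_top (h.legendre_smul_ne_top hv _) (h.legendre_smul_ne_top hw _)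
  have hge : a * (legendre T f v).toReal + b * (legendre T f w).toReal ≤
      (legendre T f u).toReal := by
    have := ENNReal.toReal_mono hufin hcon
    rw [ENNReal.toReal_add (by simp [ENNReal.smul_def, ENNReal.mul_eq_top, hv])
      (by simp [ENNReal.smul_def, ENNReal.mul_eq_top, hw])] at this
    simpa [ENNReal.smul_def] using this
  have hmax : ∀ ε > 0, ∃ x, h.IsMax u 1 x ∧ h.IsMax v ε x ∧ h.IsMax w ε x := by
    intro ε hε
    have hκ : 0 < min 1 (min (ε * a) (ε * b)) := by positivity
    obtain ⟨x, hx⟩ := h.exists_isMax u hκ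
    have h1 := h.le_core hv hx.1
    have h2 := h.le_core hw hx.1
    have h3 := (h.isMax_mono ((min_le_right _ _).trans (min_le_left _ _)) hx).2
    have h4 := (h.isMax_mono ((min_le_right _ _).trans (min_le_right _ _)) hx).2
    have hux : u.1 x = a * v.1 x + b * w.1 x := rfl
    have hfx : (f x).toReal = a * (f x).toReal + b * (f x).toReal := by
      rw [← add_mul, hab', one_mul]
    rw [hux, hfx] at h3 h4
    have h1' := mul_le_mul_of_nonneg_left h1 ha'.le
    have h2' := mul_le_mul_of_nonneg_left h2 hb'.le
    refine ⟨x, h.isMax_mono (min_le_left _ _) hx, ⟨hx.1, ?_⟩, ⟨hx.1, ?_⟩⟩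
    · refine le_of_mul_le_mul_left ?_ ha'
      linarith
    · refine le_of_mul_le_mul_left ?_ hb'
      linarith
  have heq : ∀ z ∈ C, v.1 z - w.1 z ≤ 0 := by
    intro z hz
    obtain ⟨K, hK, h1⟩ := h.secondDiff z hz
    set M := K * (1 + ((legendre T f ((2 : ℝ) • u)).toReal + 2)) with hM
    have hM0 : 0 ≤ M := by positivity
    have key : ∀ s : ℝ, 0 < s → s ≤ 1 → v.1 z - w.1 z ≤ s * (M + 2) := by
      intro s hs hs1
      obtain ⟨x, hxu, hxv, hxw⟩ := hmax (s ^ 2) (by positivity)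
      have h2 := h1 x hxu.1 s (by rwa [abs_of_pos hs])
      have h3 := h.le_core hv (C.add_mem hxu.1 (C.smul_mem s hz))
      have h4 := h.le_core hw (C.sub_mem hxu.1 (C.smul_mem s hz))
      rw [map_add, map_smul, smul_eq_mul] at h3
      rw [map_sub, map_smul, smul_eq_mul] at h4
      have h5 := hxv.2
      have h6 := hxw.2
      have h7 := hxu.toReal_le h hufin
      have h8 : K * s ^ 2 * (1 + (f x).toReal) ≤ s ^ 2 * M := by
        rw [hM, mul_comm K, mul_assoc]
        gcongr
      refine le_of_mul_le_mul_left ?_ hs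
      nlinarith
    refine le_of_forall_pos_le_add fun ε hε => ?_
    have hs : 0 < min 1 (ε / (M + 2)) := by positivity
    refine (key _ hs (min_le_left _ _)).trans ?_
    rw [zero_add]
    calc _ ≤ ε / (M + 2) * (M + 2) := by gcongr; exact min_le_right _ _
      _ = ε := by field_simp
  refine hvw (le_antisymm ?_ zero_le)
  have := h.legendre_le (v := v - w) (c := 0) fun x hx => by
    change v.1 x - w.1 x ≤ _
    have := heq x hx
    have : 0 ≤ (f x).toReal := ENNReal.toReal_nonneg
    linarith
  simpa using this

lemma convex_comb {x y : X} (hx : f x ≠ ⊤) (hy : f y ≠ ⊤) {a b : ℝ≥0} (hab : a + b = 1) :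
    f (a • x + b • y) ≠ ⊤ ∧ (f (a • x + b • y)).toReal ≤ a * (f x).toReal + b * (f y).toReal := by
  have h1 := h.convex.2 (Set.mem_univ x) (Set.mem_univ y) a.2 b.2 hab
  have hxa : a • f x ≠ ⊤ := by simp [ENNReal.smul_def, ENNReal.mul_eq_top, hx]
  have hyb : b • f y ≠ ⊤ := by simp [ENNReal.smul_def, ENNReal.mul_eq_top, hy]
  have h2 : a • f x + b • f y ≠ ⊤ := ENNReal.add_ne_top.2 ⟨hxa, hyb⟩
  refine ⟨(h1.trans_lt h2.lt_top).ne, ?_⟩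
  have := ENNReal.toReal_mono h2 h1
  rw [ENNReal.toReal_add hxa hyb] at this
  simpa [ENNReal.smul_def] using this

/-- The law `clarkson` gives strict convexity at midpoints, and convexity extends it to all convex
combinations. -/
lemma strictlyConvexModNull : StrictlyConvexModNull f := by
  have key : ∀ x y : X, f x ≠ ⊤ → f y ≠ ⊤ → f (x - y) ≠ 0 →
      ∀ a b : ℝ≥0, 0 < a → a ≤ 1 / 2 → a + b = 1 → f (a • x + b • y) < a • f x + b • f y := by
    intro x y hx hy hxy a b ha ha2 hab
    have hab' : (a : ℝ) + b = 1 := by exact_mod_cast congrArg NNReal.toReal hab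
    have ha' : (0 : ℝ) < a := by exact_mod_cast ha
    have ha2' : (a : ℝ) ≤ 1 / 2 := by exact_mod_cast ha2
    set u : X := (1 / 2 : ℝ≥0) • x + (1 / 2 : ℝ≥0) • y with hu
    set w : X := (1 / 2 : ℝ) • (x - y) with hw
    have hu' : u = (1 / 2 : ℝ) • x + (1 / 2 : ℝ) • y := by
      simp [hu, NNReal.smul_def]
    have hw0 : f w ≠ 0 := fun h0 => hxy (by
      have := h.null w h0
      rwa [hw, smul_smul, mul_one_div_cancel two_ne_zero, one_smul] at this)
    have hmid := h.clarkson u w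
    rw [show u + w = x by rw [hu', hw]; module, show u - w = y by rw [hu', hw]; module] at hmid
    have hxyfin : f x + f y ≠ ⊤ := ENNReal.add_ne_top.2 ⟨hx, hy⟩
    have hufin := (h.convex_comb hx hy (a := 1 / 2) (b := 1 / 2) (add_halves 1)).1
    have hwfin : f w ≠ ⊤ := by
      intro h0
      rw [h0, ENNReal.mul_top (by norm_num), add_top, top_le_iff] at hmid
      exact hxyfin hmid
    have hmid' := ENNReal.toReal_mono hxyfin hmid
    rw [ENNReal.toReal_add (ENNReal.mul_ne_top (by norm_num) hufin)
      (ENNReal.mul_ne_top (by norm_num) hwfin), ENNReal.toReal_add hx hy,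
      ENNReal.toReal_mul, ENNReal.toReal_mul] at hmid'
    norm_num at hmid'
    have hw1 : 0 < (f w).toReal := ENNReal.toReal_pos hw0 hwfin
    obtain ⟨e, he⟩ : ∃ e : ℝ≥0, (e : ℝ) = 1 - 2 * a := ⟨⟨1 - 2 * a, by linarith⟩, rfl⟩
    have h2a : 2 * a + e = 1 := by
      apply NNReal.coe_injective
      push_cast
      rw [he]; ring
    have h1 := h.convex_comb hufin hy h2a
    have hcomb : (2 * a) • u + e • y = a • x + b • y := by
      rw [hu']
      simp only [NNReal.smul_def, NNReal.coe_mul, he, NNReal.coe_ofNat]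
      rw [show (b : ℝ) = 1 - a by linarith]
      match_scalars <;> ring
    rw [hcomb] at h1
    have h2 : (f (a • x + b • y)).toReal < (a • f x + b • f y).toReal := by
      rw [ENNReal.toReal_add (by simp [ENNReal.smul_def, ENNReal.mul_eq_top, hx])
        (by simp [ENNReal.smul_def, ENNReal.mul_eq_top, hy])]
      simp only [ENNReal.smul_def, smul_eq_mul, ENNReal.toReal_mul, ENNReal.coe_toReal]
      refine h1.2.trans_lt ?_
      simp only [he, NNReal.coe_mul, NNReal.coe_ofNat]
      rw [show (b : ℝ) = 1 - a by linarith]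
      nlinarith
    exact (ENNReal.toReal_lt_toReal h1.1 (by
      simp [ENNReal.smul_def, ENNReal.mul_eq_top, hx, hy])).1 h2
  intro x y hx hy hxy a b ha hb hab
  rcases le_total a (1 / 2) with ha2 | ha2
  · exact key x y hx hy hxy a b ha ha2 hab
  · rw [add_comm (a • x), add_comm (a • f x)]
    refine key y x hy hx (by rwa [← neg_sub, h.neg]) b a hb ?_ (by rwa [add_comm])
    have hab' : (a : ℝ) + b = 1 := by exact_mod_cast congrArg NNReal.toReal hab
    have ha2' : (1 / 2 : ℝ) ≤ a := by exact_mod_cast ha2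
    rw [← NNReal.coe_le_coe]
    push_cast
    linarith

/-- A uniform modular and its Legendre transform are symmetric dissipation potentials, as soon as
the modular is smooth along lines and, by `hdual`, is the supremum of the affine functionals `v - e`
below it. -/
theorem isSymmDissipationPair (hC1 : LineC1 f)
    (hdual : ∀ (ξ : X) (r : ℝ≥0), (r : ℝ≥0∞) < f ξ → ∃ (v : T) (e : ℝ),
      (∀ x, f x ≠ ⊤ → v.1 x ≤ (f x).toReal + e) ∧ r ≤ v.1 ξ - e) :
    IsSymmDissipationPair T (legendre T f) f where
  dual := coe_legendre h.zero
  bidual := by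
    intro ξ
    refine le_antisymm ?_ (iSup_le fun v => ?_)
    · refine EReal.ge_of_forall_gt_iff_ge.1 fun r hr => ?_
      rcases lt_or_ge r 0 with hr0 | hr0
      · refine le_iSup_of_le 0 ?_
        rw [h.legendre_zero]
        simpa using hr0.le
      · lift r to ℝ≥0 using hr0
        have hr' : (r : ℝ≥0∞) < f ξ := by
          rw [← EReal.coe_ennreal_lt_coe_ennreal_iff]
          exact hr
        obtain ⟨v, e, h1, h2⟩ := hdual ξ r hr'
        have he : 0 ≤ e := by simpa [h.zero] using h1 0 (by simp [h.zero])
        refine le_iSup_of_le v ?_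
        have h3 := (legendre_le_ofReal_iff h.zero v he).2 h1
        rw [← EReal.coe_ennreal_le_coe_ennreal_iff, EReal.coe_ennreal_ofReal, max_eq_left he] at h3
        calc ((r : ℝ) : EReal) ≤ ((v.1 ξ - e : ℝ) : EReal) := by exact_mod_cast h2
          _ = (v.1 ξ : EReal) - (e : EReal) := EReal.coe_sub _ _
          _ ≤ _ := EReal.sub_le_sub le_rfl h3
    · by_cases hξ : f ξ = ⊤
      · simp [hξ]
      by_cases hv : legendre T f v = ⊤
      · simp [hv]
      have h1 := le_add_legendre h.zero hv hξ
      rw [← ENNReal.ofReal_toReal hξ, ← ENNReal.ofReal_toReal hv, EReal.coe_ennreal_ofReal,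
        EReal.coe_ennreal_ofReal, max_eq_left ENNReal.toReal_nonneg,
        max_eq_left ENNReal.toReal_nonneg, ← EReal.coe_sub, EReal.coe_le_coe_iff]
      linarith
  convex := h.convexOn_legendre
  convex_star := h.convex
  strict := h.strictlyConvexModNull_legendre
  strict_star := h.strictlyConvexModNull
  c1 := h.lineC1_legendre
  c1_star := hC1
  zero := h.legendre_zero
  zero_star := h.zero
  symm := h.legendre_neg
  symm_star := h.neg

/-- The balance law holds when the dissipative velocity `F - W` is the derivative of `f` at
`-dS / 2`, expressed through equality in the Young inequality. -/
theorem isPreGenericAt (hpair : IsSymmDissipationPair T (legendre T f) f) {dS η : X} {W F : T}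
    (hη : η = -((1 / 2 : ℝ) • dS)) (hW : W.1 dS = 0) (hfin : f η ≠ ⊤)
    (hmax : ∀ x ∈ C, (F - W).1 x - (f x).toReal ≤ (F - W).1 η - (f η).toReal) :
    IsPreGenericAt T (legendre T f) f dS W F where
  potentials := hpair
  orthogonal := hW
  balance := by
    set c := (F - W).1 η - (f η).toReal with hc
    have hle : ∀ x ∈ C, (F - W).1 x ≤ (f x).toReal + c := fun x hx => by linarith [hmax x hx]
    have hfin' := h.legendre_ne_top hle
    have h1 : (legendre T f (F - W)).toReal = c :=
      le_antisymm (h.toReal_legendre_le hle) (by linarith [le_add_legendre h.zero hfin' hfin])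
    rw [← hη, ← ENNReal.ofReal_toReal hfin', ← ENNReal.ofReal_toReal hfin,
      EReal.coe_ennreal_ofReal, EReal.coe_ennreal_ofReal, max_eq_left ENNReal.toReal_nonneg,
      max_eq_left ENNReal.toReal_nonneg, h1, hc, ← EReal.coe_add, ← EReal.coe_add,
      ← EReal.coe_zero, EReal.coe_eq_coe_iff]
    have h2 : (F - W).1 η = F.1 η - W.1 η := rfl
    have h3 : W.1 η = 0 := by rw [hη, map_neg, map_smul, hW, smul_zero, neg_zero]
    have h4 : F.1 η = -(1 / 2 * F.1 dS) := by rw [hη, map_neg, map_smul, smul_eq_mul]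
    rw [h2, h3, h4]
    ring

end IsUniformModular

end Legendre

/-! ### The two model modulars: integrals of `cosh - 1`, and quadratic forms -/

section Cosh

lemma cosh_convex_comb (u v : ℝ) {a b : ℝ} (ha : 0 ≤ a) (hb : 0 ≤ b) (hab : a + b = 1) :
    Real.cosh (a * u + b * v) ≤ a * Real.cosh u + b * Real.cosh v := by
  have h1 := convexOn_exp.2 (Set.mem_univ u) (Set.mem_univ v) ha hb hab
  have h2 := convexOn_exp.2 (Set.mem_univ (-u)) (Set.mem_univ (-v)) ha hb hab
  simp only [smul_eq_mul] at h1 h2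
  rw [show a * -u + b * -v = -(a * u + b * v) by ring] at h2
  rw [Real.cosh_eq, Real.cosh_eq, Real.cosh_eq]
  linarith

lemma cosh_sub_one_le (y : ℝ) : Real.cosh y - 1 ≤ y ^ 2 / 2 * Real.exp (y ^ 2 / 2) := by
  have h1 := Real.cosh_le_exp_half_sq y
  have h2 := Real.add_one_le_exp (-(y ^ 2 / 2))
  have h3 : Real.exp (-(y ^ 2 / 2)) * Real.exp (y ^ 2 / 2) = 1 := by
    rw [← Real.exp_add]; simp
  have h4 := mul_le_mul_of_nonneg_right h2 (Real.exp_pos (y ^ 2 / 2)).le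
  linarith

/-- Near `0` the function `sinh` is controlled by `cosh - 1` only up to a small constant. -/
lemma abs_sinh_le (b : ℝ) {θ : ℝ} (hθ : 0 < θ) :
    |Real.sinh b| ≤ θ + (1 + 1 / θ) * (Real.cosh b - 1) := by
  have hc := Real.one_le_cosh b
  refine abs_le_of_sq_le_sq ?_ (by have : 0 ≤ Real.cosh b - 1 := by linarith
                                   positivity)
  have h1 := Real.cosh_sq b
  set e := Real.cosh b - 1 with he
  have he0 : 0 ≤ e := by linarith
  have hs : Real.sinh b ^ 2 = e ^ 2 + 2 * e := by
    have : Real.cosh b = e + 1 := by linarith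
    rw [this] at h1
    linarith
  have h2 : (θ + (1 + 1 / θ) * e) ^ 2 =
      θ ^ 2 + 2 * (θ + 1) * e + (1 + 2 * (1 / θ) + (1 / θ) ^ 2) * e ^ 2 := by
    field_simp
    ring
  have h3 : 0 ≤ 1 / θ := by positivity
  rw [hs, h2]
  nlinarith [mul_nonneg hθ.le he0, mul_nonneg h3 (sq_nonneg e), sq_nonneg ((1 / θ) * e),
    sq_nonneg θ]

variable {X Ω : Type*} [AddCommGroup X] [Module ℝ X] [MeasurableSpace Ω]
  (μ : Measure Ω) (A : X →ₗ[ℝ] (Ω → ℝ))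

/-- The functional `x ↦ ∫ (cosh (A x) - 1) dμ`. -/
def coshModular (x : X) : ℝ≥0∞ := ∫⁻ o, ENNReal.ofReal (Real.cosh (A x o) - 1) ∂μ

/-- The elements with bounded image under `A`. -/
def boundedCore : Submodule ℝ X where
  carrier := {x | ∃ K, ∀ o, |A x o| ≤ K}
  zero_mem' := ⟨0, fun o => by simp⟩
  add_mem' := by
    rintro x y ⟨K, hK⟩ ⟨M, hM⟩
    refine ⟨K + M, fun o => ?_⟩
    rw [map_add]
    exact (abs_add_le _ _).trans (add_le_add (hK o) (hM o))
  smul_mem' := by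
    rintro c x ⟨K, hK⟩
    refine ⟨|c| * K, fun o => ?_⟩
    rw [map_smul, Pi.smul_apply, smul_eq_mul, abs_mul]
    exact mul_le_mul_of_nonneg_left (hK o) (abs_nonneg c)

variable {μ A} (hA : ∀ x, Measurable (A x))

include hA in
lemma measurable_cosh_sub_one (x : X) : Measurable fun o => Real.cosh (A x o) - 1 :=
  (Real.measurable_cosh.comp (hA x)).sub_const 1

include hA in
lemma coshModular_ne_top_iff (x : X) :
    coshModular μ A x ≠ ⊤ ↔ Integrable (fun o => Real.cosh (A x o) - 1) μ :=
  lintegral_ofReal_ne_top_iff_integrable (measurable_cosh_sub_one hA x).aestronglyMeasurable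
    (Filter.Eventually.of_forall fun _ => sub_nonneg.2 (Real.one_le_cosh _))

include hA in
lemma toReal_coshModular (x : X) :
    (coshModular μ A x).toReal = ∫ o, (Real.cosh (A x o) - 1) ∂μ :=
  (integral_eq_lintegral_of_nonneg_ae
    (Filter.Eventually.of_forall fun _ => sub_nonneg.2 (Real.one_le_cosh _))
    (measurable_cosh_sub_one hA x).aestronglyMeasurable).symm

include hA in
lemma integrable_cosh_of_mem_boundedCore [IsFiniteMeasure μ] {x : X} (hx : x ∈ boundedCore A) :
    Integrable (fun o => Real.cosh (A x o) - 1) μ := by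
  obtain ⟨K, hK⟩ := hx
  refine Integrable.of_bound (measurable_cosh_sub_one hA x).aestronglyMeasurable (Real.cosh K - 1)
    (Filter.Eventually.of_forall fun o => ?_)
  rw [Real.norm_eq_abs, abs_of_nonneg (sub_nonneg.2 (Real.one_le_cosh _))]
  gcongr
  exact Real.cosh_le_cosh.2 ((hK o).trans (le_abs_self K))

include hA in
/-- The hypothesis `happrox` is the field `approx`: it depends on the tangent vectors, unlike the
other fields. -/
lemma isUniformModular_coshModular [IsFiniteMeasure μ] {T : Submodule ℝ (Module.Dual ℝ X)}
    (happrox : ∀ (v : T) (x : X), coshModular μ A x ≠ ⊤ → ∀ ε > 0, ∃ y ∈ boundedCore A,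
      |v.1 y - v.1 x| ≤ ε ∧ (coshModular μ A y).toReal ≤ (coshModular μ A x).toReal + ε) :
    IsUniformModular T (coshModular μ A) (boundedCore A) where
  zero := by simp [coshModular]
  neg x := by simp [coshModular]
  convex := by
    refine ⟨convex_univ, fun x _ y _ a b _ _ hab => ?_⟩
    have hab' : (a : ℝ) + b = 1 := by exact_mod_cast congrArg NNReal.toReal hab
    have hm := fun x => (measurable_cosh_sub_one hA x).ennreal_ofReal
    simp only [coshModular, ENNReal.smul_def, smul_eq_mul]
    rw [← lintegral_const_mul _ (hm x), ← lintegral_const_mul _ (hm y),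
      ← lintegral_add_left ((hm x).const_mul _)]
    refine lintegral_mono fun o => ?_
    rw [← ENNReal.ofReal_coe_nnreal, ← ENNReal.ofReal_coe_nnreal, ← ENNReal.ofReal_mul a.coe_nonneg,
      ← ENNReal.ofReal_mul b.coe_nonneg, ← ENNReal.ofReal_add
      (mul_nonneg a.coe_nonneg (sub_nonneg.2 (Real.one_le_cosh _)))
      (mul_nonneg b.coe_nonneg (sub_nonneg.2 (Real.one_le_cosh _)))]
    refine ENNReal.ofReal_le_ofReal ?_
    have := cosh_convex_comb (A x o) (A y o) a.coe_nonneg b.coe_nonneg hab'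
    simp only [NNReal.smul_def, map_add, map_smul, Pi.add_apply, Pi.smul_apply, smul_eq_mul]
    linarith
  -- pointwise, `cosh (u + w) + cosh (u - w) = 2 cosh u cosh w ≥ 2 cosh u + 2 cosh w - 2`
  clarkson x y := by
    have hm := fun x => (measurable_cosh_sub_one hA x).ennreal_ofReal
    simp only [coshModular]
    rw [← lintegral_const_mul _ (hm x), ← lintegral_const_mul _ (hm y),
      ← lintegral_add_left ((hm x).const_mul _), ← lintegral_add_left (hm _)]
    refine lintegral_mono fun o => ?_
    have hx := sub_nonneg.2 (Real.one_le_cosh (A x o))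
    have hy := sub_nonneg.2 (Real.one_le_cosh (A y o))
    rw [← ENNReal.ofReal_ofNat, ← ENNReal.ofReal_mul (by norm_num),
      ← ENNReal.ofReal_mul (by norm_num), ← ENNReal.ofReal_add (by positivity) (by positivity),
      ← ENNReal.ofReal_add (sub_nonneg.2 (Real.one_le_cosh _)) (sub_nonneg.2 (Real.one_le_cosh _))]
    refine ENNReal.ofReal_le_ofReal ?_
    rw [map_add, map_sub, Pi.add_apply, Pi.sub_apply, Real.cosh_add, Real.cosh_sub]
    nlinarith
  null x hx := by
    have hm := fun x => (measurable_cosh_sub_one hA x).ennreal_ofReal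
    rw [coshModular, lintegral_eq_zero_iff (hm x)] at hx
    rw [coshModular, lintegral_eq_zero_iff (hm _)]
    filter_upwards [hx] with o ho
    simp only [Pi.zero_apply, ENNReal.ofReal_eq_zero, sub_nonpos] at ho ⊢
    have h0 : A x o = 0 := by
      by_contra hne
      exact absurd ho (not_le.2 (Real.one_lt_cosh.2 hne))
    simp [h0]
  ne_top x hx := (coshModular_ne_top_iff hA x).2 (integrable_cosh_of_mem_boundedCore hA hx)
  approx := happrox
  cont := by
    intro x hx ε hε
    have hxi := integrable_cosh_of_mem_boundedCore (μ := μ) hA hx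
    obtain ⟨K, hK⟩ := id hx
    set c := Real.cosh K with hc
    have hc1 : 1 ≤ c := Real.one_le_cosh K
    -- `θ` makes the constant of `abs_sinh_le`, integrated against `c`, at most `ε / 2`
    set θ := ε / (2 * c * (μ.real Set.univ + 1)) with hθdef
    have hθ : 0 < θ := by positivity
    refine ⟨ε / (2 * c * (2 + 1 / θ)), by positivity, fun z hz hzδ => ?_⟩
    have hzi := integrable_cosh_of_mem_boundedCore (μ := μ) hA hz
    rw [toReal_coshModular hA] at hzδ ⊢
    rw [toReal_coshModular hA]
    have hpt : ∀ o, Real.cosh (A (x + z) o) - 1 ≤ (Real.cosh (A x o) - 1) +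
        (c * (2 + 1 / θ) * (Real.cosh (A z o) - 1) + c * θ) := by
      intro o
      have h1 := abs_sinh_le (A z o) hθ
      have h2 : Real.cosh (A x o) ≤ c := Real.cosh_le_cosh.2 ((hK o).trans (le_abs_self K))
      have h3 : |Real.sinh (A x o)| ≤ Real.cosh (A x o) := by
        refine abs_le_of_sq_le_sq ?_ (Real.cosh_pos _).le
        rw [Real.cosh_sq]; linarith
      have hz0 := sub_nonneg.2 (Real.one_le_cosh (A z o))
      have h4 : Real.sinh (A x o) * Real.sinh (A z o) ≤
          c * (θ + (1 + 1 / θ) * (Real.cosh (A z o) - 1)) := by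
        refine (le_abs_self _).trans ?_
        rw [abs_mul]
        exact mul_le_mul (h3.trans h2) h1 (abs_nonneg _) (by positivity)
      have h5 : Real.cosh (A x o) * (Real.cosh (A z o) - 1) ≤ c * (Real.cosh (A z o) - 1) := by
        gcongr
      rw [map_add, Pi.add_apply, Real.cosh_add]
      linarith
    have hzi' : Integrable (fun o => c * (2 + 1 / θ) * (Real.cosh (A z o) - 1) + c * θ) μ :=
      (hzi.const_mul _).add (integrable_const _)
    calc ∫ o, (Real.cosh (A (x + z) o) - 1) ∂μ
        ≤ ∫ o, ((Real.cosh (A x o) - 1) +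
            (c * (2 + 1 / θ) * (Real.cosh (A z o) - 1) + c * θ)) ∂μ := by
          refine integral_mono
            (integrable_cosh_of_mem_boundedCore hA ((boundedCore A).add_mem hx hz)) ?_ hpt
          exact hxi.add hzi'
      _ = (∫ o, (Real.cosh (A x o) - 1) ∂μ) +
            (c * (2 + 1 / θ) * (∫ o, (Real.cosh (A z o) - 1) ∂μ) +
              μ.real Set.univ * (c * θ)) := by
          rw [integral_add hxi hzi',
            integral_add (hzi.const_mul _) (integrable_const _), integral_const_mul,
            integral_const, smul_eq_mul]
      _ ≤ _ := by
          have h6 : c * (2 + 1 / θ) * (∫ o, (Real.cosh (A z o) - 1) ∂μ) ≤ ε / 2 := by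
            calc _ ≤ c * (2 + 1 / θ) * (ε / (2 * c * (2 + 1 / θ))) := by gcongr
              _ = ε / 2 := by field_simp
          have h7 : μ.real Set.univ * (c * θ) ≤ ε / 2 := by
            have hμ : 0 ≤ μ.real Set.univ := measureReal_nonneg
            calc _ ≤ (μ.real Set.univ + 1) * (c * θ) := by gcongr; linarith
              _ = ε / 2 := by rw [hθdef]; field_simp
          linarith
  secondDiff := by
    intro z hz
    obtain ⟨K, hK⟩ := id hz
    set L := K ^ 2 * Real.exp (K ^ 2 / 2) with hL
    have hL0 : 0 ≤ L := by positivity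
    refine ⟨L * (1 + μ.real Set.univ), by positivity, fun x hx s hs => ?_⟩
    have hxi := integrable_cosh_of_mem_boundedCore (μ := μ) hA hx
    have h1 := integrable_cosh_of_mem_boundedCore (μ := μ) hA
      ((boundedCore A).add_mem hx ((boundedCore A).smul_mem s hz))
    have h2 := integrable_cosh_of_mem_boundedCore (μ := μ) hA
      ((boundedCore A).sub_mem hx ((boundedCore A).smul_mem s hz))
    have hs2 : s ^ 2 ≤ 1 := by rw [← sq_abs]; exact pow_le_one₀ (abs_nonneg s) hs
    -- `cosh (u + w) + cosh (u - w) - 2 cosh u = 2 cosh u (cosh w - 1)` with `w = O(s)` on the core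
    have hpt : ∀ o, Real.cosh (A (x + s • z) o) - 1 + (Real.cosh (A (x - s • z) o) - 1) -
        2 * (Real.cosh (A x o) - 1) ≤ L * s ^ 2 * ((Real.cosh (A x o) - 1) + 1) := by
      intro o
      have hz2 : (A z o) ^ 2 ≤ K ^ 2 := sq_le_sq.2 ((hK o).trans (le_abs_self K))
      have h3 : Real.cosh (s * A z o) - 1 ≤ s ^ 2 * (K ^ 2 / 2) * Real.exp (K ^ 2 / 2) := by
        have h5 : (s * A z o) ^ 2 ≤ K ^ 2 := by
          rw [mul_pow]
          calc s ^ 2 * (A z o) ^ 2 ≤ 1 * K ^ 2 := by gcongr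
            _ = K ^ 2 := one_mul _
        refine (cosh_sub_one_le _).trans ?_
        gcongr
        rw [mul_pow]
        nlinarith [sq_nonneg s]
      rw [map_add, map_sub, map_smul, Pi.add_apply, Pi.sub_apply, Pi.smul_apply, smul_eq_mul,
        Real.cosh_add, Real.cosh_sub]
      have h4 := mul_le_mul_of_nonneg_left h3 (Real.cosh_pos (A x o)).le
      rw [hL]
      linarith
    have h12 : Integrable (fun o => Real.cosh (A (x + s • z) o) - 1 +
        (Real.cosh (A (x - s • z) o) - 1)) μ := h1.add h2
    have h3 : Integrable (fun o => Real.cosh (A (x + s • z) o) - 1 +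
        (Real.cosh (A (x - s • z) o) - 1) - 2 * (Real.cosh (A x o) - 1)) μ :=
      h12.sub (hxi.const_mul 2)
    have hint := integral_mono h3
      ((hxi.add (integrable_const 1)).const_mul (L * s ^ 2)) hpt
    simp only [Pi.add_apply] at hint
    rw [integral_sub h12 (hxi.const_mul 2), integral_add h1 h2, integral_const_mul,
      integral_const_mul, integral_add hxi (integrable_const 1), integral_const, smul_eq_mul,
      mul_one] at hint
    rw [toReal_coshModular hA, toReal_coshModular hA, toReal_coshModular hA]
    refine hint.trans ?_
    have hx0 : 0 ≤ ∫ o, (Real.cosh (A x o) - 1) ∂μ :=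
      integral_nonneg fun o => sub_nonneg.2 (Real.one_le_cosh _)
    have hμ : 0 ≤ μ.real Set.univ := measureReal_nonneg
    have : (∫ o, (Real.cosh (A x o) - 1) ∂μ) + μ.real Set.univ ≤
        (1 + μ.real Set.univ) * (1 + ∫ o, (Real.cosh (A x o) - 1) ∂μ) := by nlinarith
    calc _ ≤ L * s ^ 2 * ((1 + μ.real Set.univ) * (1 + ∫ o, (Real.cosh (A x o) - 1) ∂μ)) := by
          gcongr
      _ = _ := by ring

lemma integrable_exp_of_integrable_cosh [IsFiniteMeasure μ] {u : Ω → ℝ} (hu : Measurable u)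
    (h : Integrable (fun o => Real.cosh (u o) - 1) μ) :
    Integrable (fun o => Real.exp (u o)) μ := by
  have h1 : Integrable (fun o => 2 * (Real.cosh (u o) - 1 + 1)) μ :=
    (h.add (integrable_const 1)).const_mul 2
  refine h1.mono' (Real.measurable_exp.comp hu).aestronglyMeasurable
    (Filter.Eventually.of_forall fun o => ?_)
  rw [Real.norm_eq_abs, abs_of_pos (Real.exp_pos _), Real.cosh_eq]
  linarith [Real.exp_pos (-u o)]

/-- `t ↦ ∫ exp (u + t w) dμ` is smooth in the interior of any set of `t` on which it is finite:
it is the moment generating function of `w` under the measure with density `exp u`. -/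
lemma contDiffOn_integral_exp {u w : Ω → ℝ} (hu : Measurable u)
    {s : Set ℝ} (h : ∀ t ∈ s, Integrable (fun o => Real.exp (u o + t * w o)) μ) :
    ContDiffOn ℝ 1 (fun t => ∫ o, Real.exp (u o + t * w o) ∂μ) (interior s) := by
  set ν := μ.withDensity fun o => ENNReal.ofReal (Real.exp (u o)) with hν
  have hm : Measurable fun o => ENNReal.ofReal (Real.exp (u o)) :=
    (Real.measurable_exp.comp hu).ennreal_ofReal
  have hlt : ∀ᵐ o ∂μ, ENNReal.ofReal (Real.exp (u o)) < ⊤ :=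
    Filter.Eventually.of_forall fun o => ENNReal.ofReal_lt_top
  have hmgf : (fun t => ∫ o, Real.exp (u o + t * w o) ∂μ) = ProbabilityTheory.mgf w ν := by
    funext t
    rw [ProbabilityTheory.mgf, hν, integral_withDensity_eq_integral_toReal_smul hm hlt]
    refine integral_congr_ae (Filter.Eventually.of_forall fun o => ?_)
    simp only [ENNReal.toReal_ofReal (Real.exp_pos _).le, smul_eq_mul]
    rw [Real.exp_add]
  have hsub : s ⊆ ProbabilityTheory.integrableExpSet w ν := by
    intro t ht
    rw [ProbabilityTheory.integrableExpSet, Set.mem_ofPred_eq, hν,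
      integrable_withDensity_iff_integrable_smul' hm hlt]
    refine (h t ht).congr (Filter.Eventually.of_forall fun o => ?_)
    simp only [ENNReal.toReal_ofReal (Real.exp_pos _).le, smul_eq_mul]
    rw [Real.exp_add]
  rw [hmgf]
  intro t ht
  exact ((ProbabilityTheory.analyticAt_mgf (interior_mono hsub ht)).contDiffAt).contDiffWithinAt

include hA in
lemma lineC1_coshModular [IsFiniteMeasure μ] : LineC1 (coshModular μ A) := by
  intro x y
  set s := {t : ℝ | coshModular μ A (x + t • y) ≠ ⊤} with hs
  have hint : ∀ t ∈ s, Integrable (fun o => Real.cosh (A x o + t * A y o) - 1) μ := by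
    intro t ht
    have := (coshModular_ne_top_iff hA _).1 ht
    simpa only [map_add, map_smul, Pi.add_apply, Pi.smul_apply, smul_eq_mul] using this
  have hm : ∀ t : ℝ, Measurable fun o => A x o + t * A y o := fun t =>
    (hA x).add ((hA y).const_mul t)
  have h1 : ∀ t ∈ s, Integrable (fun o => Real.exp (A x o + t * A y o)) μ := fun t ht =>
    integrable_exp_of_integrable_cosh (hm t) (hint t ht)
  have h2 : ∀ t ∈ s, Integrable (fun o => Real.exp (-A x o + t * -A y o)) μ := by
    intro t ht
    have := integrable_exp_of_integrable_cosh (μ := μ) (hm t).neg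
      (by simpa only [Pi.neg_apply, Real.cosh_neg] using hint t ht)
    refine this.congr (Filter.Eventually.of_forall fun o => ?_)
    simp only [Pi.neg_apply]
    ring_nf
  have hc := (((contDiffOn_integral_exp (hA x) h1).add
    (contDiffOn_integral_exp (hA x).neg h2)).div_const 2).sub
    (contDiffOn_const (c := μ.real Set.univ))
  refine hc.congr fun t ht => ?_
  have ht' := interior_subset ht
  have e : ∀ o, Real.cosh (A (x + t • y) o) - 1 =
      (Real.exp (A x o + t * A y o) + Real.exp (-A x o + t * -A y o)) / 2 - 1 := by
    intro o
    rw [map_add, map_smul, Pi.add_apply, Pi.smul_apply, smul_eq_mul, Real.cosh_eq]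
    ring_nf
  have h12 : Integrable (fun o => (Real.exp (A x o + t * A y o) +
      Real.exp (-A x o + t * -A y o)) / 2) μ := ((h1 t ht').add (h2 t ht')).div_const 2
  rw [toReal_coshModular hA, integral_congr_ae (Filter.Eventually.of_forall e),
    integral_sub h12 (integrable_const 1),
    integral_div, integral_add (h1 t ht') (h2 t ht'), integral_const, smul_eq_mul, mul_one]
  rfl

end Cosh

section Quadratic

variable {X H : Type*} [AddCommGroup X] [Module ℝ X] [NormedAddCommGroup H]
  [InnerProductSpace ℝ H] {T : Submodule ℝ (Module.Dual ℝ X)} (B : X →ₗ[ℝ] H)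

/-- The quadratic functional `x ↦ γ ‖B x‖²`. -/
def quadModular (γ : ℝ) (x : X) : ℝ≥0∞ := ENNReal.ofReal (γ * ‖B x‖ ^ 2)

variable {γ : ℝ} (hγ : 0 < γ) {B}
include hγ

lemma toReal_quadModular (x : X) : (quadModular B γ x).toReal = γ * ‖B x‖ ^ 2 :=
  ENNReal.toReal_ofReal (by positivity)

lemma isUniformModular_quadModular : IsUniformModular T (quadModular B γ) ⊤ where
  zero := by simp [quadModular]
  neg x := by simp [quadModular]
  convex := by
    refine ⟨convex_univ, fun x _ y _ a b _ _ hab => ?_⟩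
    have hab' : (a : ℝ) + b = 1 := by exact_mod_cast congrArg NNReal.toReal hab
    simp only [quadModular, ENNReal.smul_def, smul_eq_mul]
    rw [← ENNReal.ofReal_coe_nnreal, ← ENNReal.ofReal_coe_nnreal,
      ← ENNReal.ofReal_mul a.coe_nonneg, ← ENNReal.ofReal_mul b.coe_nonneg,
      ← ENNReal.ofReal_add (by positivity) (by positivity)]
    refine ENNReal.ofReal_le_ofReal ?_
    simp only [NNReal.smul_def, map_add, map_smul]
    have h1 : ‖(a : ℝ) • B x + (b : ℝ) • B y‖ ≤ a * ‖B x‖ + b * ‖B y‖ :=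
      (norm_add_le _ _).trans (by simp [norm_smul])
    have h2 : ‖(a : ℝ) • B x + (b : ℝ) • B y‖ ^ 2 ≤ (a * ‖B x‖ + b * ‖B y‖) ^ 2 := by gcongr
    have h3 : (a * ‖B x‖ + b * ‖B y‖) ^ 2 ≤ a * ‖B x‖ ^ 2 + b * ‖B y‖ ^ 2 := by
      have hb : (b : ℝ) = 1 - a := by linarith
      have ha0 : (0 : ℝ) ≤ a := a.coe_nonneg
      have hb0 : (0 : ℝ) ≤ 1 - a := by rw [← hb]; exact b.coe_nonneg
      rw [hb]
      nlinarith [mul_nonneg (mul_nonneg ha0 hb0) (sq_nonneg (‖B x‖ - ‖B y‖))]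
    have := mul_le_mul_of_nonneg_left (h2.trans h3) hγ.le
    linarith
  clarkson x y := by
    simp only [quadModular]
    rw [← ENNReal.ofReal_ofNat, ← ENNReal.ofReal_mul (by norm_num),
      ← ENNReal.ofReal_mul (by norm_num), ← ENNReal.ofReal_add (by positivity) (by positivity),
      ← ENNReal.ofReal_add (by positivity) (by positivity)]
    refine ENNReal.ofReal_le_ofReal (le_of_eq ?_)
    have := parallelogram_law_with_norm ℝ (B x) (B y)
    rw [map_add, map_sub]
    linear_combination -γ * this
  null x hx := by
    have h0 : B x = 0 := by
      rw [quadModular, ENNReal.ofReal_eq_zero] at hx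
      by_contra hne
      have : 0 < ‖B x‖ := norm_pos_iff.2 hne
      have : 0 < γ * ‖B x‖ ^ 2 := by positivity
      linarith
    simp [quadModular, h0]
  ne_top x _ := ENNReal.ofReal_ne_top
  approx v x _ ε hε := ⟨x, Submodule.mem_top, by simpa using hε.le, by linarith⟩
  cont := by
    intro x _ ε hε
    set M := γ * ‖B x‖ ^ 2 with hM
    have hM0 : 0 ≤ M := by positivity
    refine ⟨ε ^ 2 / (ε + 1 + 4 * M) / 4, by positivity, fun z _ hz => ?_⟩
    rw [toReal_quadModular hγ] at hz ⊢
    rw [toReal_quadModular hγ, ← hM, map_add]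
    set N := γ * ‖B z‖ ^ 2 with hN
    have hN0 : 0 ≤ N := by positivity
    -- the mixed term is controlled by `2 B(x, z) ≤ ε / 2 + 2 M N / ε`
    have h1 : ‖B x + B z‖ ^ 2 ≤ (‖B x‖ + ‖B z‖) ^ 2 := by gcongr; exact norm_add_le _ _
    have h2 : γ * (2 * (‖B x‖ * ‖B z‖)) ≤ ε / 2 + 2 * (M * N) / ε := by
      have h3 : (γ * (‖B x‖ * ‖B z‖)) ^ 2 = M * N := by rw [hM, hN]; ring
      set q := γ * (‖B x‖ * ‖B z‖) with hq
      have h4 : 0 ≤ (ε / 2 - q) ^ 2 := sq_nonneg _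
      rw [← h3, show γ * (2 * (‖B x‖ * ‖B z‖)) = 2 * q by rw [hq]; ring,
        show ε / 2 + 2 * q ^ 2 / ε = (ε ^ 2 / 2 + 2 * q ^ 2) / ε by field_simp,
        le_div_iff₀ hε]
      nlinarith
    have h5 : N * (ε + 4 * M) ≤ ε ^ 2 / 4 := by
      have h6 : N * (ε + 1 + 4 * M) ≤ ε ^ 2 / 4 := by
        calc _ ≤ ε ^ 2 / (ε + 1 + 4 * M) / 4 * (ε + 1 + 4 * M) := by gcongr
          _ = ε ^ 2 / 4 := by field_simp
      nlinarith
    have h7 : 2 * (M * N) / ε + N ≤ ε / 2 := by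
      rw [div_add' _ _ _ hε.ne', div_le_iff₀ hε]
      nlinarith
    have h8 : γ * ‖B x + B z‖ ^ 2 ≤ γ * (‖B x‖ + ‖B z‖) ^ 2 := by gcongr
    have h9 : γ * (‖B x‖ + ‖B z‖) ^ 2 = M + γ * (2 * (‖B x‖ * ‖B z‖)) + N := by
      rw [hM, hN]; ring
    linarith
  secondDiff := by
    intro z _
    refine ⟨2 * (γ * ‖B z‖ ^ 2), by positivity, fun x _ s _ => ?_⟩
    rw [toReal_quadModular hγ, toReal_quadModular hγ, toReal_quadModular hγ]
    have := parallelogram_law_with_norm ℝ (B x) (s • B z)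
    rw [map_add, map_sub, map_smul]
    rw [norm_smul, Real.norm_eq_abs] at this
    have h2 : (|s| * ‖B z‖) ^ 2 = s ^ 2 * ‖B z‖ ^ 2 := by
      rw [mul_pow, sq_abs]
    rw [h2] at this
    have h3 : 0 ≤ 2 * (γ * ‖B z‖ ^ 2) * s ^ 2 * (γ * ‖B x‖ ^ 2) := by positivity
    have h4 : γ * ‖B x + s • B z‖ ^ 2 + γ * ‖B x - s • B z‖ ^ 2 - 2 * (γ * ‖B x‖ ^ 2) =
      2 * (γ * ‖B z‖ ^ 2) * s ^ 2 := by linear_combination γ * this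
    linarith

lemma lineC1_quadModular : LineC1 (quadModular B γ) := by
  intro x y
  simp only [toReal_quadModular hγ, map_add, map_smul]
  refine ContDiff.contDiffOn ?_
  exact contDiff_const.mul ((contDiff_const.add (contDiff_id.smul contDiff_const)).norm_sq ℝ)

/-- The Young inequality for a quadratic form. -/
lemma two_mul_inner_le (ξ x : X) :
    2 * γ * ⟪B ξ, B x⟫ ≤ (quadModular B γ x).toReal + γ * ‖B ξ‖ ^ 2 := by
  rw [toReal_quadModular hγ]
  have h1 := norm_sub_sq_real (B ξ) (B x)
  have h2 : 0 ≤ ‖B ξ - B x‖ ^ 2 := sq_nonneg _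
  have := mul_nonneg hγ.le h2
  rw [h1] at this
  linarith

theorem isSymmDissipationPair_quadModular
    (hT : ∀ ξ, ∃ v : T, ∀ x, v.1 x = ⟪B ξ, B x⟫) :
    IsSymmDissipationPair T (legendre T (quadModular B γ)) (quadModular B γ) := by
  refine (isUniformModular_quadModular hγ).isSymmDissipationPair (lineC1_quadModular hγ) ?_
  intro ξ r hr
  obtain ⟨v, hv⟩ := hT ξ
  have hv' : ∀ x, ((2 * γ) • v).1 x = 2 * γ * ⟪B ξ, B x⟫ := fun x => by
    rw [← hv]; rfl
  refine ⟨(2 * γ) • v, γ * ‖B ξ‖ ^ 2, fun x _ => ?_, ?_⟩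
  · rw [hv']
    exact two_mul_inner_le hγ ξ x
  · rw [hv', real_inner_self_eq_norm_sq]
    have := (ENNReal.toReal_lt_toReal ENNReal.coe_ne_top ENNReal.ofReal_ne_top).2 hr
    rw [← quadModular, toReal_quadModular hγ, ENNReal.coe_toReal] at this
    linarith

end Quadratic

/-! ### Gradients, weighted integrals and tangent vectors given by square integrable fields -/

section Calculus

variable {d : ℕ}

/-- The position part of a covector on phase space, as a vector. -/
def covecQ (d : ℕ) : (Phase d →L[ℝ] ℝ) →L[ℝ] Vec d :=
  LinearMap.toContinuousLinearMap
    { toFun := fun l => (InnerProductSpace.toDual ℝ (Vec d)).symm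
        (l.comp (ContinuousLinearMap.inl ℝ (Vec d) (Vec d)))
      map_add' := fun l l' => by rw [ContinuousLinearMap.add_comp, map_add]
      map_smul' := fun c l => by
        rw [ContinuousLinearMap.smul_comp, map_smulₛₗ, RCLike.conj_to_real, RingHom.id_apply] }

/-- The momentum part of a covector on phase space, as a vector. -/
def covecP (d : ℕ) : (Phase d →L[ℝ] ℝ) →L[ℝ] Vec d :=
  LinearMap.toContinuousLinearMap
    { toFun := fun l => (InnerProductSpace.toDual ℝ (Vec d)).symm
        (l.comp (ContinuousLinearMap.inr ℝ (Vec d) (Vec d)))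
      map_add' := fun l l' => by rw [ContinuousLinearMap.add_comp, map_add]
      map_smul' := fun c l => by
        rw [ContinuousLinearMap.smul_comp, map_smulₛₗ, RCLike.conj_to_real, RingHom.id_apply] }

lemma inner_covecQ (l : Phase d →L[ℝ] ℝ) (u : Vec d) : ⟪covecQ d l, u⟫ = l (u, 0) :=
  InnerProductSpace.toDual_symm_apply

lemma inner_covecP (l : Phase d →L[ℝ] ℝ) (u : Vec d) : ⟪covecP d l, u⟫ = l (0, u) :=
  InnerProductSpace.toDual_symm_apply

lemma norm_le_of_inner_le {v : Vec d} {c : ℝ} (hc : 0 ≤ c) (h : ∀ u, ⟪v, u⟫ ≤ c * ‖u‖) :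
    ‖v‖ ≤ c := by
  rcases (norm_nonneg v).eq_or_lt with h0 | h0
  · rwa [← h0]
  · have := h v
    rw [real_inner_self_eq_norm_sq, sq] at this
    exact le_of_mul_le_mul_right this h0

lemma norm_covecQ_le (l : Phase d →L[ℝ] ℝ) : ‖covecQ d l‖ ≤ ‖l‖ := by
  refine norm_le_of_inner_le (norm_nonneg l) fun u => ?_
  rw [inner_covecQ]
  refine (le_abs_self _).trans ((l.le_opNorm _).trans_eq ?_)
  simp [Prod.norm_def]

lemma norm_covecP_le (l : Phase d →L[ℝ] ℝ) : ‖covecP d l‖ ≤ ‖l‖ := by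
  refine norm_le_of_inner_le (norm_nonneg l) fun u => ?_
  rw [inner_covecP]
  refine (le_abs_self _).trans ((l.le_opNorm _).trans_eq ?_)
  simp [Prod.norm_def]

lemma gradQ_eq {f : Phase d → ℝ} {x : Phase d} (hf : DifferentiableAt ℝ f x) :
    gradQ f x = covecQ d (fderiv ℝ f x) := by
  have h1 : HasFDerivAt (fun q : Vec d => (q, x.2)) (ContinuousLinearMap.inl ℝ (Vec d) (Vec d))
      x.1 := hasFDerivAt_prodMk_left x.1 x.2
  have h2 : HasFDerivAt (fun q => f (q, x.2)) _ x.1 :=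
    HasFDerivAt.comp (g := f) x.1 hf.hasFDerivAt h1
  rw [gradQ, gradient, h2.fderiv]
  rfl

lemma gradP_eq {f : Phase d → ℝ} {x : Phase d} (hf : DifferentiableAt ℝ f x) :
    gradP f x = covecP d (fderiv ℝ f x) := by
  have h1 : HasFDerivAt (fun p : Vec d => (x.1, p)) (ContinuousLinearMap.inr ℝ (Vec d) (Vec d))
      x.2 := hasFDerivAt_prodMk_right x.1 x.2
  have h2 : HasFDerivAt (fun p => f (x.1, p)) _ x.2 :=
    HasFDerivAt.comp (g := f) x.2 hf.hasFDerivAt h1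
  rw [gradP, gradient, h2.fderiv]
  rfl

lemma gradQ_of_hasFDerivAt {f : Phase d → ℝ} {x : Phase d} {l : Phase d →L[ℝ] ℝ}
    (hf : HasFDerivAt f l x) : gradQ f x = covecQ d l := by
  rw [gradQ_eq hf.differentiableAt, hf.fderiv]

lemma gradP_of_hasFDerivAt {f : Phase d → ℝ} {x : Phase d} {l : Phase d →L[ℝ] ℝ}
    (hf : HasFDerivAt f l x) : gradP f x = covecP d l := by
  rw [gradP_eq hf.differentiableAt, hf.fderiv]

lemma inner_gradQ {f : Phase d → ℝ} {x : Phase d} (hf : DifferentiableAt ℝ f x) (u : Vec d) :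
    ⟪gradQ f x, u⟫ = fderiv ℝ f x (u, 0) := by rw [gradQ_eq hf, inner_covecQ]

lemma inner_gradP {f : Phase d → ℝ} {x : Phase d} (hf : DifferentiableAt ℝ f x) (u : Vec d) :
    ⟪gradP f x, u⟫ = fderiv ℝ f x (0, u) := by rw [gradP_eq hf, inner_covecP]

lemma continuous_gradQ {f : Phase d → ℝ} (hf : ContDiff ℝ 1 f) : Continuous (gradQ f) := by
  have : gradQ f = fun x => covecQ d (fderiv ℝ f x) :=
    funext fun x => gradQ_eq (hf.differentiable one_ne_zero x)
  rw [this]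
  exact (covecQ d).continuous.comp (hf.continuous_fderiv one_ne_zero)

lemma continuous_gradP {f : Phase d → ℝ} (hf : ContDiff ℝ 1 f) : Continuous (gradP f) := by
  have : gradP f = fun x => covecP d (fderiv ℝ f x) :=
    funext fun x => gradP_eq (hf.differentiable one_ne_zero x)
  rw [this]
  exact (covecP d).continuous.comp (hf.continuous_fderiv one_ne_zero)

end Calculus

section Law

variable {d : ℕ} {ρ : Phase d → ℝ}

lemma isFiniteMeasure_law (h : Integrable ρ) : IsFiniteMeasure (law ρ) :=
  isFiniteMeasure_withDensity_ofReal h.2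

lemma integrable_law_iff (hc : Continuous ρ) (hpos : ∀ x, 0 < ρ x) {E : Type*}
    [NormedAddCommGroup E] [NormedSpace ℝ E] {g : Phase d → E} :
    Integrable g (law ρ) ↔ Integrable fun x => ρ x • g x := by
  rw [law, integrable_withDensity_iff_integrable_smul₀' hc.measurable.ennreal_ofReal.aemeasurable
    (Filter.Eventually.of_forall fun _ => ENNReal.ofReal_lt_top)]
  simp only [ENNReal.toReal_ofReal (hpos _).le]

lemma integral_law (hc : Continuous ρ) (hpos : ∀ x, 0 < ρ x) {E : Type*}
    [NormedAddCommGroup E] [NormedSpace ℝ E] (g : Phase d → E) :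
    ∫ x, g x ∂(law ρ) = ∫ x, ρ x • g x := by
  rw [law, integral_withDensity_eq_integral_toReal_smul hc.measurable.ennreal_ofReal
    (Filter.Eventually.of_forall fun _ => ENNReal.ofReal_lt_top)]
  simp only [ENNReal.toReal_ofReal (hpos _).le]

lemma memLp_two_law_iff (hc : Continuous ρ) (hpos : ∀ x, 0 < ρ x) {g : Phase d → Vec d}
    (hg : Continuous g) : MemLp g 2 (law ρ) ↔ Integrable fun x => ‖g x‖ ^ 2 * ρ x := by
  rw [memLp_two_iff_integrable_sq_norm hg.aestronglyMeasurable, integrable_law_iff hc hpos]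
  simp only [smul_eq_mul, mul_comm]

/-- The gradient in the position variable, as an element of `L²(ρ)`. -/
def gradQL2 (ρ : Phase d → ℝ) : cotangent ρ →ₗ[ℝ] Lp (Vec d) 2 (law ρ) where
  toFun ξ := ξ.2.2.1.toLp (gradQ ξ)
  map_add' ξ ζ := by
    rw [← MemLp.toLp_add]
    exact MemLp.toLp_congr _ _ (by
      rw [Submodule.coe_add, gradQ_add ξ.2.1 ζ.2.1])
  map_smul' c ξ := by
    rw [RingHom.id_apply, ← MemLp.toLp_const_smul]
    exact MemLp.toLp_congr _ _ (by
      rw [Submodule.coe_smul, gradQ_smul ξ.2.1])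

/-- The gradient in the momentum variable, as an element of `L²(ρ)`. -/
def gradPL2 (ρ : Phase d → ℝ) : cotangent ρ →ₗ[ℝ] Lp (Vec d) 2 (law ρ) where
  toFun ξ := ξ.2.2.2.toLp (gradP ξ)
  map_add' ξ ζ := by
    rw [← MemLp.toLp_add]
    exact MemLp.toLp_congr _ _ (by
      rw [Submodule.coe_add, gradP_add ξ.2.1 ζ.2.1])
  map_smul' c ξ := by
    rw [RingHom.id_apply, ← MemLp.toLp_const_smul]
    exact MemLp.toLp_congr _ _ (by
      rw [Submodule.coe_smul, gradP_smul ξ.2.1])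

lemma integrable_normSq_grad (ξ : cotangent ρ) :
    Integrable (fun x => ‖gradQ ξ x‖ ^ 2) (law ρ) ∧ Integrable (fun x => ‖gradP ξ x‖ ^ 2) (law ρ) :=
  ⟨(memLp_two_iff_integrable_sq_norm ξ.2.2.1.1).1 ξ.2.2.1,
    (memLp_two_iff_integrable_sq_norm ξ.2.2.2.1).1 ξ.2.2.2⟩

lemma norm_toLp_sq {E : Type*} [NormedAddCommGroup E] [InnerProductSpace ℝ E] {α : Type*}
    [MeasurableSpace α] {μ : Measure α} {g : α → E} (hg : MemLp g 2 μ) :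
    ‖hg.toLp g‖ ^ 2 = ∫ x, ‖g x‖ ^ 2 ∂μ := by
  rw [← real_inner_self_eq_norm_sq, L2.inner_def]
  refine integral_congr_ae ?_
  filter_upwards [hg.coeFn_toLp] with x hx
  rw [hx, real_inner_self_eq_norm_sq]

lemma h1Norm_sq (ξ : cotangent ρ) : h1Norm ρ ξ ^ 2 =
    (∫ x, ‖gradQ ξ x‖ ^ 2 ∂(law ρ)) + ∫ x, ‖gradP ξ x‖ ^ 2 ∂(law ρ) := by
  rw [h1Norm, Real.sq_sqrt (integral_nonneg fun x => by positivity),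
    integral_add (integrable_normSq_grad ξ).1 (integrable_normSq_grad ξ).2]

lemma h1Norm_nonneg (ξ : Phase d → ℝ) : 0 ≤ h1Norm ρ ξ := Real.sqrt_nonneg _

lemma norm_gradQL2_le (ξ : cotangent ρ) : ‖gradQL2 ρ ξ‖ ≤ h1Norm ρ ξ := by
  refine abs_le_of_sq_le_sq' ?_ (h1Norm_nonneg _) |>.2
  rw [h1Norm_sq, show ‖gradQL2 ρ ξ‖ ^ 2 = _ from norm_toLp_sq ξ.2.2.1]
  exact le_add_of_nonneg_right (integral_nonneg fun x => by positivity)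

lemma norm_gradPL2_le (ξ : cotangent ρ) : ‖gradPL2 ρ ξ‖ ≤ h1Norm ρ ξ := by
  refine abs_le_of_sq_le_sq' ?_ (h1Norm_nonneg _) |>.2
  rw [h1Norm_sq, show ‖gradPL2 ρ ξ‖ ^ 2 = _ from norm_toLp_sq ξ.2.2.2]
  exact le_add_of_nonneg_left (integral_nonneg fun x => by positivity)

/-- The tangent vector `ξ ↦ ∫ (Y · ∇_q ξ + Z · ∇_p ξ) dρ` given by square integrable fields. -/
def fieldTangent (Y Z : Lp (Vec d) 2 (law ρ)) : tangent ρ :=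
  ⟨(innerₛₗ ℝ Y).comp (gradQL2 ρ) + (innerₛₗ ℝ Z).comp (gradPL2 ρ), ‖Y‖ + ‖Z‖, fun ξ => by
    change |⟪Y, gradQL2 ρ ξ⟫ + ⟪Z, gradPL2 ρ ξ⟫| ≤ _
    rw [add_mul]
    refine (abs_add_le _ _).trans (add_le_add ?_ ?_)
    · refine (abs_real_inner_le_norm _ _).trans ?_
      gcongr
      exact norm_gradQL2_le ξ
    · refine (abs_real_inner_le_norm _ _).trans ?_
      gcongr
      exact norm_gradPL2_le ξ⟩

lemma inner_toLp {E : Type*} [NormedAddCommGroup E] [InnerProductSpace ℝ E] {α : Type*}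
    [MeasurableSpace α] {μ : Measure α} {f g : α → E} (hf : MemLp f 2 μ) (hg : MemLp g 2 μ) :
    ⟪hf.toLp f, hg.toLp g⟫ = ∫ x, ⟪f x, g x⟫ ∂μ := by
  rw [L2.inner_def]
  refine integral_congr_ae ?_
  filter_upwards [hf.coeFn_toLp, hg.coeFn_toLp] with x hx hx'
  rw [hx, hx']

/-- Tangent vectors are continuous along sequences whose gradients converge pointwise and are
dominated by the gradient of the limit, up to a constant. -/
lemma tendsto_tangent [IsFiniteMeasure (law ρ)] (v : tangent ρ) (ξ : cotangent ρ)
    (φ : ℕ → cotangent ρ) (K : ℝ)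
    (hQ : ∀ x, Filter.Tendsto (fun n => gradQ (φ n : Phase d → ℝ) x) Filter.atTop
      (nhds (gradQ (ξ : Phase d → ℝ) x)))
    (hP : ∀ x, Filter.Tendsto (fun n => gradP (φ n : Phase d → ℝ) x) Filter.atTop
      (nhds (gradP (ξ : Phase d → ℝ) x)))
    (hQK : ∀ n x, ‖gradQ (φ n : Phase d → ℝ) x‖ ≤ ‖gradQ (ξ : Phase d → ℝ) x‖ + K)
    (hPK : ∀ n x, ‖gradP (φ n : Phase d → ℝ) x‖ ≤ ‖gradP (ξ : Phase d → ℝ) x‖ + K) :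
    Filter.Tendsto (fun n => v.1 (φ n)) Filter.atTop (nhds (v.1 ξ)) := by
  obtain ⟨C, hC⟩ := v.2
  have hgQ : ∀ n, gradQ ((φ n - ξ : cotangent ρ) : Phase d → ℝ) =
      gradQ (φ n) - gradQ (ξ : Phase d → ℝ) := by
    intro n
    have h1 := gradQ_add (f := φ n) (g := (-1 : ℝ) • (ξ : Phase d → ℝ)) (φ n).2.1
      (contDiff_const.smul ξ.2.1)
    rw [gradQ_smul ξ.2.1] at h1
    rw [sub_eq_add_neg, ← neg_one_smul ℝ ξ, Submodule.coe_add, Submodule.coe_smul, h1]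
    simp [sub_eq_add_neg]
  have hgP : ∀ n, gradP ((φ n - ξ : cotangent ρ) : Phase d → ℝ) =
      gradP (φ n) - gradP (ξ : Phase d → ℝ) := by
    intro n
    have h1 := gradP_add (f := φ n) (g := (-1 : ℝ) • (ξ : Phase d → ℝ)) (φ n).2.1
      (contDiff_const.smul ξ.2.1)
    rw [gradP_smul ξ.2.1] at h1
    rw [sub_eq_add_neg, ← neg_one_smul ℝ ξ, Submodule.coe_add, Submodule.coe_smul, h1]
    simp [sub_eq_add_neg]
  -- dominated convergence for one of the two gradients
  have key : ∀ (G : ℕ → Phase d → Vec d) (g : Phase d → Vec d), (∀ n, Continuous (G n)) →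
      Continuous g → Integrable (fun x => ‖g x‖ ^ 2) (law ρ) →
      (∀ x, Filter.Tendsto (fun n => G n x) Filter.atTop (nhds (g x))) →
      (∀ n x, ‖G n x‖ ≤ ‖g x‖ + K) →
      Filter.Tendsto (fun n => ∫ x, ‖G n x - g x‖ ^ 2 ∂(law ρ)) Filter.atTop (nhds 0) := by
    intro G g hG hg hi hlim hb
    have h0 : (0 : ℝ) = ∫ x, (0 : ℝ) ∂(law ρ) := by simp
    have hm : ∀ n, Continuous fun x => ‖G n x - g x‖ ^ 2 := fun n => by
      have := hG n
      fun_prop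
    have hbd : Integrable (fun x => 8 * ‖g x‖ ^ 2 + 2 * K ^ 2) (law ρ) :=
      (hi.const_mul 8).add (integrable_const (2 * K ^ 2))
    rw [h0]
    refine tendsto_integral_of_dominated_convergence (fun x => 8 * ‖g x‖ ^ 2 + 2 * K ^ 2)
      (fun n => (hm n).aestronglyMeasurable)
      hbd (fun n => ?_) ?_
    · refine Filter.Eventually.of_forall fun x => ?_
      have h1 : ‖G n x - g x‖ ≤ 2 * ‖g x‖ + K := by
        have := norm_sub_le (G n x) (g x)
        linarith [hb n x]
      have h2 : ‖G n x - g x‖ ^ 2 ≤ (2 * ‖g x‖ + K) ^ 2 := by gcongr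
      rw [Real.norm_eq_abs, abs_of_nonneg (by positivity)]
      nlinarith [sq_nonneg (2 * ‖g x‖ - K)]
    · refine Filter.Eventually.of_forall fun x => ?_
      have := (((hlim x).sub_const (g x)).norm.pow 2)
      simpa using this
  have h1 := key (fun n => gradQ (φ n : Phase d → ℝ)) (gradQ (ξ : Phase d → ℝ))
    (fun n => continuous_gradQ (φ n).2.1)
    (continuous_gradQ ξ.2.1) (integrable_normSq_grad ξ).1 hQ hQK
  have h2 := key (fun n => gradP (φ n : Phase d → ℝ)) (gradP (ξ : Phase d → ℝ))
    (fun n => continuous_gradP (φ n).2.1)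
    (continuous_gradP ξ.2.1) (integrable_normSq_grad ξ).2 hP hPK
  have h3 : Filter.Tendsto (fun n => C * h1Norm ρ ((φ n - ξ : cotangent ρ) : Phase d → ℝ))
      Filter.atTop (nhds 0) := by
    have h4 := ((h1.add h2).sqrt).const_mul C
    simp only [add_zero, Real.sqrt_zero, mul_zero] at h4
    refine h4.congr fun n => congrArg (C * ·) ?_
    rw [← Real.sqrt_sq (h1Norm_nonneg (ρ := ρ) ((φ n - ξ : cotangent ρ) : Phase d → ℝ)),
      h1Norm_sq, hgQ, hgP]
    rfl
  rw [tendsto_iff_dist_tendsto_zero]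
  refine squeeze_zero (fun n => dist_nonneg) (fun n => ?_) h3
  rw [Real.dist_eq, ← map_sub]
  exact hC _

end Law

/-! ### Approximation of cotangent vectors by bounded functions and by test functions -/

section Truncation

/-- A smooth truncation: bounded, increasing, contracting, and converging to the identity as `n`
tends to infinity. Unlike a cut-off it maps `C¹` functions to `C¹` functions with smaller gradients
and preserves the sign of increments. -/
def trunc (n : ℕ) (s : ℝ) : ℝ := (n + 1) * Real.arctan (s / (n + 1))

/-- The derivative of `trunc`. -/
def truncDeriv (n : ℕ) (s : ℝ) : ℝ := 1 / (1 + (s / (n + 1)) ^ 2)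

lemma hasDerivAt_trunc (n : ℕ) (s : ℝ) : HasDerivAt (trunc n) (truncDeriv n s) s := by
  have h := ((Real.hasDerivAt_arctan (s / (n + 1))).comp s
    ((hasDerivAt_id s).div_const ((n : ℝ) + 1))).const_mul ((n : ℝ) + 1)
  have hn : ((n : ℝ) + 1) ≠ 0 := by positivity
  refine h.congr_deriv ?_
  unfold truncDeriv
  field_simp

lemma truncDeriv_pos (n : ℕ) (s : ℝ) : 0 < truncDeriv n s := by
  rw [truncDeriv]; positivity

lemma truncDeriv_le_one (n : ℕ) (s : ℝ) : truncDeriv n s ≤ 1 := by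
  rw [truncDeriv, div_le_one (by positivity)]
  linarith [sq_nonneg (s / (n + 1))]

lemma contDiff_trunc (n : ℕ) : ContDiff ℝ 1 (trunc n) := by
  unfold trunc
  exact contDiff_const.mul (Real.contDiff_arctan.comp (contDiff_id.div_const _))

lemma abs_trunc_le (n : ℕ) (s : ℝ) : |trunc n s| ≤ (n + 1) * (Real.pi / 2) := by
  rw [trunc, abs_mul, abs_of_pos (by positivity : (0 : ℝ) < n + 1)]
  gcongr
  exact abs_le.2 ⟨(Real.neg_pi_div_two_lt_arctan _).le, (Real.arctan_lt_pi_div_two _).le⟩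

lemma abs_trunc_sub_le (n : ℕ) (s t : ℝ) : |trunc n s - trunc n t| ≤ |s - t| := by
  have h : LipschitzWith 1 (trunc n) :=
    lipschitzWith_of_nnnorm_deriv_le (fun s => (hasDerivAt_trunc n s).differentiableAt) fun s => by
      rw [(hasDerivAt_trunc n s).deriv, ← NNReal.coe_le_coe, coe_nnnorm, Real.norm_eq_abs,
        abs_of_pos (truncDeriv_pos n s)]
      exact truncDeriv_le_one n s
  simpa [Real.dist_eq] using h.dist_le_mul s t

lemma monotone_trunc (n : ℕ) : Monotone (trunc n) := fun s t hst => by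
  unfold trunc
  have : Real.arctan (s / (n + 1)) ≤ Real.arctan (t / (n + 1)) :=
    Real.arctan_strictMono.monotone (by gcongr)
  gcongr

lemma tendsto_inv_nat_succ :
    Filter.Tendsto (fun n : ℕ => ((n : ℝ) + 1)⁻¹) Filter.atTop (nhds 0) := by
  simpa only [one_div] using tendsto_one_div_add_atTop_nhds_zero_nat (𝕜 := ℝ)

lemma tendsto_trunc (s : ℝ) :
    Filter.Tendsto (fun n => trunc n s) Filter.atTop (nhds s) := by
  have h1 : HasDerivAt (fun u : ℝ => Real.arctan (u * s)) s 0 := by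
    have := (Real.hasDerivAt_arctan (0 * s)).comp (0 : ℝ) ((hasDerivAt_id (0 : ℝ)).mul_const s)
    exact this.congr_deriv (by simp)
  rw [hasDerivAt_iff_tendsto_slope_zero] at h1
  have h2 : Filter.Tendsto (fun n : ℕ => ((n : ℝ) + 1)⁻¹) Filter.atTop
      (nhdsWithin 0 {0}ᶜ) :=
    tendsto_nhdsWithin_iff.2 ⟨tendsto_inv_nat_succ,
      Filter.Eventually.of_forall fun n => by
        have : ((n : ℝ) + 1) ≠ 0 := by positivity
        simpa using this⟩
  refine (h1.comp h2).congr fun n => ?_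
  simp [trunc, div_eq_mul_inv, mul_comm]

lemma tendsto_truncDeriv (s : ℝ) :
    Filter.Tendsto (fun n => truncDeriv n s) Filter.atTop (nhds 1) := by
  have h := ((tendsto_inv_nat_succ.const_mul s).pow 2).const_add 1
  have h2 := h.inv₀ (by norm_num)
  simpa [truncDeriv, div_eq_mul_inv] using h2

variable {d : ℕ} {ρ : Phase d → ℝ}

lemma hasFDerivAt_trunc_comp (n : ℕ) {f : Phase d → ℝ} (hf : ContDiff ℝ 1 f) (x : Phase d) :
    HasFDerivAt (fun y => trunc n (f y)) (truncDeriv n (f x) • fderiv ℝ f x) x :=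
  (hasDerivAt_trunc n (f x)).comp_hasFDerivAt x (hf.differentiable one_ne_zero x).hasFDerivAt

lemma gradQ_trunc (n : ℕ) {f : Phase d → ℝ} (hf : ContDiff ℝ 1 f) (x : Phase d) :
    gradQ (fun y => trunc n (f y)) x = truncDeriv n (f x) • gradQ f x := by
  rw [gradQ_of_hasFDerivAt (hasFDerivAt_trunc_comp n hf x), map_smul,
    gradQ_eq (hf.differentiable one_ne_zero x)]

lemma gradP_trunc (n : ℕ) {f : Phase d → ℝ} (hf : ContDiff ℝ 1 f) (x : Phase d) :
    gradP (fun y => trunc n (f y)) x = truncDeriv n (f x) • gradP f x := by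
  rw [gradP_of_hasFDerivAt (hasFDerivAt_trunc_comp n hf x), map_smul,
    gradP_eq (hf.differentiable one_ne_zero x)]

lemma norm_truncDeriv_smul_le (n : ℕ) (s : ℝ) (v : Vec d) : ‖truncDeriv n s • v‖ ≤ ‖v‖ := by
  rw [norm_smul, Real.norm_eq_abs, abs_of_pos (truncDeriv_pos n s)]
  exact mul_le_of_le_one_left (norm_nonneg v) (truncDeriv_le_one n s)

/-- The truncation of a cotangent vector. -/
def cotangentTrunc (n : ℕ) (ξ : cotangent ρ) : cotangent ρ :=
  ⟨fun x => trunc n ((ξ : Phase d → ℝ) x), (contDiff_trunc n).comp ξ.2.1, by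
    refine ξ.2.2.1.mono (continuous_gradQ ((contDiff_trunc n).comp ξ.2.1)).aestronglyMeasurable
      (Filter.Eventually.of_forall fun x => ?_)
    rw [gradQ_trunc n ξ.2.1]
    exact norm_truncDeriv_smul_le n _ _, by
    refine ξ.2.2.2.mono (continuous_gradP ((contDiff_trunc n).comp ξ.2.1)).aestronglyMeasurable
      (Filter.Eventually.of_forall fun x => ?_)
    rw [gradP_trunc n ξ.2.1]
    exact norm_truncDeriv_smul_le n _ _⟩

lemma tendsto_tangent_trunc [IsFiniteMeasure (law ρ)] (v : tangent ρ) (ξ : cotangent ρ) :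
    Filter.Tendsto (fun n => v.1 (cotangentTrunc n ξ)) Filter.atTop (nhds (v.1 ξ)) := by
  refine tendsto_tangent v ξ _ 0 (fun x => ?_) (fun x => ?_) (fun n x => ?_) fun n x => ?_
  · have := (tendsto_truncDeriv ((ξ : Phase d → ℝ) x)).smul_const (gradQ (ξ : Phase d → ℝ) x)
    rw [one_smul] at this
    exact this.congr fun n => (gradQ_trunc n ξ.2.1 x).symm
  · have := (tendsto_truncDeriv ((ξ : Phase d → ℝ) x)).smul_const (gradP (ξ : Phase d → ℝ) x)
    rw [one_smul] at this
    exact this.congr fun n => (gradP_trunc n ξ.2.1 x).symm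
  · rw [add_zero]
    exact (congrArg norm (gradQ_trunc n ξ.2.1 x)).le.trans (norm_truncDeriv_smul_le n _ _)
  · rw [add_zero]
    exact (congrArg norm (gradP_trunc n ξ.2.1 x)).le.trans (norm_truncDeriv_smul_le n _ _)

end Truncation

section Mollification

open scoped Convolution

/-- Compactly supported `C¹` functions are approximated by test functions, uniformly together with
their derivatives. -/
lemma exists_smooth_c1_approx {E : Type*} [NormedAddCommGroup E] [NormedSpace ℝ E]
    [FiniteDimensional ℝ E] {g : E → ℝ} (hg : ContDiff ℝ 1 g) (hgs : HasCompactSupport g)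
    {ε : ℝ} (hε : 0 < ε) :
    ∃ φ : E → ℝ, ContDiff ℝ ∞ φ ∧ HasCompactSupport φ ∧ (∀ x, |φ x - g x| ≤ ε) ∧
      ∀ x, ‖fderiv ℝ φ x - fderiv ℝ g x‖ ≤ ε := by
  borelize E
  set μ : Measure E := Measure.addHaar
  have hg' : Continuous (fderiv ℝ g) := hg.continuous_fderiv one_ne_zero
  have hgs' : HasCompactSupport (fderiv ℝ g) := hgs.fderiv ℝ
  obtain ⟨δ₁, hδ₁, h1⟩ := Metric.uniformContinuous_iff.1
    (hgs.uniformContinuous_of_continuous hg.continuous) ε hε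
  obtain ⟨δ₂, hδ₂, h2⟩ := Metric.uniformContinuous_iff.1
    (hgs'.uniformContinuous_of_continuous hg') ε hε
  have hδ : 0 < min δ₁ δ₂ := lt_min hδ₁ hδ₂
  let b : ContDiffBump (0 : E) := ⟨min δ₁ δ₂ / 2, min δ₁ δ₂, half_pos hδ, half_lt_self hδ⟩
  have hloc : LocallyIntegrable (b.normed μ) μ := b.continuous_normed.locallyIntegrable
  refine ⟨b.normed μ ⋆[ContinuousLinearMap.lsmul ℝ ℝ, μ] g, ?_, ?_, fun x => ?_, fun x => ?_⟩
  · exact b.hasCompactSupport_normed.contDiff_convolution_left _ b.contDiff_normed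
      hg.continuous.locallyIntegrable
  · exact b.hasCompactSupport_normed.convolution _ hgs
  · refine b.dist_normed_convolution_le hg.continuous.aestronglyMeasurable fun y hy => ?_
    exact (h1 ((Metric.mem_ball.1 hy).trans_le (min_le_left _ _))).le
  · rw [(hgs.hasFDerivAt_convolution_right (ContinuousLinearMap.lsmul ℝ ℝ) hloc hg x).fderiv]
    refine ContinuousLinearMap.opNorm_le_bound _ hε.le fun u => ?_
    rw [_root_.sub_apply, convolution_precompR_apply _ hloc hgs' hg', ← dist_eq_norm]
    refine b.dist_normed_convolution_le
      (hg'.clm_apply continuous_const).aestronglyMeasurable fun y hy => ?_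
    have h3 := (h2 ((Metric.mem_ball.1 hy).trans_le (min_le_right _ _))).le
    rw [dist_eq_norm] at h3 ⊢
    rw [← _root_.sub_apply]
    exact ((fderiv ℝ g y - fderiv ℝ g x).le_opNorm u).trans (by gcongr)

end Mollification

section TestFunctions

variable {d : ℕ} {ρ : Phase d → ℝ}

lemma mem_cotangent_of_compact [IsFiniteMeasure (law ρ)] {f : Phase d → ℝ} (hf : ContDiff ℝ 1 f)
    (hs : HasCompactSupport f) : f ∈ cotangent ρ := by
  obtain ⟨C, hC⟩ := (hs.fderiv ℝ).exists_bound_of_continuous (hf.continuous_fderiv one_ne_zero)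
  refine ⟨hf, MemLp.of_bound (continuous_gradQ hf).aestronglyMeasurable C ?_,
    MemLp.of_bound (continuous_gradP hf).aestronglyMeasurable C ?_⟩
  · refine Filter.Eventually.of_forall fun x => ?_
    rw [gradQ_eq (hf.differentiable one_ne_zero x)]
    exact (norm_covecQ_le _).trans (hC x)
  · refine Filter.Eventually.of_forall fun x => ?_
    rw [gradP_eq (hf.differentiable one_ne_zero x)]
    exact (norm_covecP_le _).trans (hC x)

/-- Bounded cotangent vectors are limits of uniformly bounded test functions, both pointwise and
against every tangent vector. -/
lemma exists_test_approx [IsFiniteMeasure (law ρ)] (ξ : cotangent ρ) {M : ℝ}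
    (hM : ∀ x, |(ξ : Phase d → ℝ) x| ≤ M) :
    ∃ φ : ℕ → cotangent ρ, (∀ n, IsTest (φ n : Phase d → ℝ)) ∧
      (∀ n x, |(φ n : Phase d → ℝ) x| ≤ M + 1) ∧
      (∀ x, Filter.Tendsto (fun n => (φ n : Phase d → ℝ) x) Filter.atTop
        (nhds ((ξ : Phase d → ℝ) x))) ∧
      ∀ v : tangent ρ, Filter.Tendsto (fun n => v.1 (φ n)) Filter.atTop (nhds (v.1 ξ)) := by
  have hM0 : 0 ≤ M := (abs_nonneg _).trans (hM 0)
  let χ : ContDiffBump (0 : Phase d) := ⟨1, 2, one_pos, one_lt_two⟩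
  have hχ : ContDiff ℝ 1 (χ : Phase d → ℝ) := χ.contDiff
  obtain ⟨C, hC⟩ := (χ.hasCompactSupport.fderiv ℝ).exists_bound_of_continuous
    (hχ.continuous_fderiv one_ne_zero)
  have hC0 : 0 ≤ C := (norm_nonneg _).trans (hC 0)
  set e : ℕ → ℝ := fun n => ((n : ℝ) + 1)⁻¹ with he
  have he0 : ∀ n, 0 < e n := fun n => by simp only [he]; positivity
  have he1 : ∀ n, e n ≤ 1 := fun n => inv_le_one_of_one_le₀ (by
    have : (0 : ℝ) ≤ n := n.cast_nonneg
    linarith)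
  have helim : Filter.Tendsto e Filter.atTop (nhds 0) := tendsto_inv_nat_succ
  -- the cutoffs
  set c : ℕ → Phase d → ℝ := fun n x => χ (e n • x) with hc
  have hcd : ∀ n, ContDiff ℝ 1 (c n) := fun n => hχ.comp (contDiff_const_smul _)
  have hcs : ∀ n, HasCompactSupport (c n) := fun n =>
    χ.hasCompactSupport.comp_homeomorph (Homeomorph.smulOfNeZero (e n) (he0 n).ne')
  have hc01 : ∀ n x, 0 ≤ c n x ∧ c n x ≤ 1 := fun n x => ⟨χ.nonneg, χ.le_one⟩
  have hcf : ∀ n x, ‖fderiv ℝ (c n) x‖ ≤ e n * C := by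
    intro n x
    have h1 : HasFDerivAt (c n) (e n • fderiv ℝ χ (e n • x)) x := by
      have h2 := (hχ.differentiable one_ne_zero (e n • x)).hasFDerivAt
      have h3 := h2.comp x ((hasFDerivAt_id (𝕜 := ℝ) x).const_smul (e n))
      refine h3.congr_fderiv ?_
      ext u <;> simp
    rw [h1.fderiv, norm_smul, Real.norm_eq_abs, abs_of_pos (he0 n)]
    exact mul_le_mul_of_nonneg_left (hC _) (he0 n).le
  have hclim : ∀ x, Filter.Tendsto (fun n => c n x) Filter.atTop (nhds 1) := by
    intro x
    have h1 : Filter.Tendsto (fun n => e n • x) Filter.atTop (nhds 0) := by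
      simpa using helim.smul_const x
    have h2 := (χ.continuous.tendsto 0).comp h1
    rwa [χ.one_of_mem_closedBall (by simp [χ.rIn_pos.le])] at h2
  -- the cut off functions and their approximations
  set ψ : ℕ → Phase d → ℝ := fun n x => c n x * (ξ : Phase d → ℝ) x with hψ
  have hψd : ∀ n, ContDiff ℝ 1 (ψ n) := fun n => (hcd n).mul ξ.2.1
  have hψs : ∀ n, HasCompactSupport (ψ n) := fun n => (hcs n).mul_right
  have hψf : ∀ n x, fderiv ℝ (ψ n) x =
      c n x • fderiv ℝ (ξ : Phase d → ℝ) x + (ξ : Phase d → ℝ) x • fderiv ℝ (c n) x := fun n x =>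
    (((hcd n).differentiable one_ne_zero x).hasFDerivAt.mul
      (ξ.2.1.differentiable one_ne_zero x).hasFDerivAt).fderiv
  choose φ hφ1 hφ2 hφ3 hφ4 using fun n => exists_smooth_c1_approx (hψd n) (hψs n) (he0 n)
  have hφd : ∀ n, ContDiff ℝ 1 (φ n) := fun n => (hφ1 n).of_le (by norm_cast)
  have hφlim : ∀ x, Filter.Tendsto (fun n => fderiv ℝ (φ n) x) Filter.atTop
      (nhds (fderiv ℝ (ξ : Phase d → ℝ) x)) := by
    intro x
    have h1 : Filter.Tendsto (fun n => fderiv ℝ (c n) x) Filter.atTop (nhds 0) := by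
      refine squeeze_zero_norm (fun n => hcf n x) ?_
      simpa using helim.mul_const C
    have h2 : Filter.Tendsto (fun n => fderiv ℝ (ψ n) x) Filter.atTop
        (nhds (fderiv ℝ (ξ : Phase d → ℝ) x)) := by
      have h3 := ((hclim x).smul_const (fderiv ℝ (ξ : Phase d → ℝ) x)).add
        (h1.const_smul ((ξ : Phase d → ℝ) x))
      rw [one_smul, smul_zero, add_zero] at h3
      exact h3.congr fun n => (hψf n x).symm
    have h4 : Filter.Tendsto (fun n => fderiv ℝ (φ n) x - fderiv ℝ (ψ n) x) Filter.atTop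
        (nhds 0) := squeeze_zero_norm (fun n => hφ4 n x) helim
    simpa using h4.add h2
  -- bounds for the gradients, where `G` stands for `gradQ` or `gradP`
  have hbound : ∀ (G : (Phase d →L[ℝ] ℝ) →L[ℝ] Vec d), (∀ l, ‖G l‖ ≤ ‖l‖) → ∀ n x,
      ‖G (fderiv ℝ (φ n) x)‖ ≤ ‖G (fderiv ℝ (ξ : Phase d → ℝ) x)‖ + (1 + M * C) := by
    intro G hG n x
    have h1 : G (fderiv ℝ (φ n) x) = G (fderiv ℝ (φ n) x - fderiv ℝ (ψ n) x) +
        (c n x • G (fderiv ℝ (ξ : Phase d → ℝ) x) +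
          (ξ : Phase d → ℝ) x • G (fderiv ℝ (c n) x)) := by
      rw [← map_smul, ← map_smul, ← map_add, ← map_add, ← hψf, sub_add_cancel]
    rw [h1]
    have h2 := (hG _).trans ((hφ4 n x).trans (he1 n))
    have h3 : ‖c n x • G (fderiv ℝ (ξ : Phase d → ℝ) x)‖ ≤
        ‖G (fderiv ℝ (ξ : Phase d → ℝ) x)‖ := by
      rw [norm_smul, Real.norm_eq_abs, abs_of_nonneg (hc01 n x).1]
      exact mul_le_of_le_one_left (norm_nonneg _) (hc01 n x).2
    have h4 : ‖(ξ : Phase d → ℝ) x • G (fderiv ℝ (c n) x)‖ ≤ M * C := by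
      rw [norm_smul, Real.norm_eq_abs]
      refine mul_le_mul (hM x) ((hG _).trans ((hcf n x).trans ?_)) (norm_nonneg _) hM0
      exact mul_le_of_le_one_left hC0 (he1 n)
    refine (norm_add_le _ _).trans ?_
    have := norm_add_le (c n x • G (fderiv ℝ (ξ : Phase d → ℝ) x))
      ((ξ : Phase d → ℝ) x • G (fderiv ℝ (c n) x))
    linarith
  have hξd := ξ.2.1.differentiable one_ne_zero
  have hφd' := fun n => (hφd n).differentiable one_ne_zero
  refine ⟨fun n => ⟨φ n, mem_cotangent_of_compact (hφd n) (hφ2 n)⟩, fun n => ⟨hφ1 n, hφ2 n⟩,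
    fun n x => ?_, fun x => ?_, fun v => ?_⟩
  · have h1 := (hφ3 n x).trans (he1 n)
    have h2 : |ψ n x| ≤ M := by
      rw [hψ]
      simp only [abs_mul]
      rw [abs_of_nonneg (hc01 n x).1]
      exact (mul_le_of_le_one_left (abs_nonneg _) (hc01 n x).2).trans (hM x)
    have h3 := abs_sub_abs_le_abs_sub (φ n x) (ψ n x)
    change |φ n x| ≤ _
    linarith
  · have h1 : Filter.Tendsto (fun n => φ n x - ψ n x) Filter.atTop (nhds 0) :=
      squeeze_zero_norm (fun n => hφ3 n x) helim
    have h2 := (hclim x).mul_const ((ξ : Phase d → ℝ) x)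
    have h3 := h1.add h2
    rw [zero_add, one_mul] at h3
    exact h3.congr fun n => by simp [hψ]
  · refine tendsto_tangent v ξ _ (1 + M * C) (fun x => ?_) (fun x => ?_) (fun n x => ?_)
      fun n x => ?_
    · rw [gradQ_eq (hξd x)]
      exact (((covecQ d).continuous.tendsto _).comp (hφlim x)).congr fun n =>
        (gradQ_eq (hφd' n x)).symm
    · rw [gradP_eq (hξd x)]
      exact (((covecP d).continuous.tendsto _).comp (hφlim x)).congr fun n =>
        (gradP_eq (hφd' n x)).symm
    · rw [gradQ_eq (hξd x)]
      exact (congrArg norm (gradQ_eq (hφd' n x))).le.trans (hbound _ norm_covecQ_le n x)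
    · rw [gradP_eq (hξd x)]
      exact (congrArg norm (gradP_eq (hφd' n x))).le.trans (hbound _ norm_covecP_le n x)

end TestFunctions

/-! ### The mean field potential and the differentials of energy and entropy -/

section MeanField

variable {d : ℕ} {V Φ : Vec d → ℝ} {ρ : Phase d → ℝ}

lemma norm_gradient (f : Vec d → ℝ) (q : Vec d) : ‖gradient f q‖ = ‖fderiv ℝ f q‖ :=
  LinearIsometryEquiv.norm_map _ _

lemma continuous_gradient {f : Vec d → ℝ} (hf : ContDiff ℝ 1 f) : Continuous (gradient f) :=
  (InnerProductSpace.toDual ℝ (Vec d)).symm.continuous.comp (hf.continuous_fderiv one_ne_zero)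

lemma abs_interaction_sub_le (hΦ : ContDiff ℝ 1 Φ) {R : ℝ} {g : Vec d → ℝ}
    (hg : ∀ q q' : Vec d, ‖q‖ ≤ R → ‖gradient Φ (q - q')‖ ≤ g q') {q q₀ : Vec d} (hq : ‖q‖ ≤ R)
    (hq₀ : ‖q₀‖ ≤ R) (q' : Vec d) : |Φ (q - q') - Φ (q₀ - q')| ≤ g q' * ‖q - q₀‖ := by
  have hd : ∀ q, HasFDerivAt (fun q => Φ (q - q')) (fderiv ℝ Φ (q - q')) q := fun q =>
    (hΦ.differentiable one_ne_zero (q - q')).hasFDerivAt.comp q ((hasFDerivAt_id q).sub_const q')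
  refine (convex_closedBall (0 : Vec d) R).norm_image_sub_le_of_norm_hasFDerivWithin_le
    (f := fun q => Φ (q - q')) (fun q _ => (hd q).hasFDerivWithinAt) (fun q hq => ?_)
    (by simpa using hq₀) (by simpa using hq)
  rw [← norm_gradient]
  exact hg q q' (by simpa using hq)

namespace IsRegularState

variable (h : IsRegularState V Φ ρ) (hΦ : ContDiff ℝ 1 Φ)
include h

lemma exists_integrable_conv : ∃ q₀ : Vec d, Integrable fun y : Phase d => ρ y * Φ (q₀ - y.1) := by
  have h1 : ∀ᵐ x : Phase d, Integrable fun y : Phase d => Φ (x.1 - y.1) * ρ x * ρ y :=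
    Integrable.prod_right_ae (μ := volume) (ν := volume) h.interaction
  obtain ⟨x, hx⟩ := h1.exists
  refine ⟨x.1, (hx.const_mul (ρ x)⁻¹).congr (Filter.Eventually.of_forall fun y => ?_)⟩
  have := (h.pos x).ne'
  simp only
  field_simp

lemma exists_bound_grad (R : ℝ) : ∃ G : Phase d → ℝ, Integrable G ∧ ∀ (q : Vec d), ‖q‖ ≤ R →
    ∀ y, ‖ρ y • gradient Φ (q - y.1)‖ ≤ G y := by
  obtain ⟨g, hg1, hg2⟩ := h.dominated R
  refine ⟨_, hg1, fun q hq y => ?_⟩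
  rw [norm_smul, Real.norm_eq_abs, abs_of_pos (h.pos y), mul_comm]
  exact mul_le_mul_of_nonneg_right (hg2 q y.1 hq) (h.pos y).le

include hΦ

/-- Domination of the interaction potential, locally uniformly in the position. -/
lemma exists_bound (R : ℝ) : ∃ G : Phase d → ℝ, Integrable G ∧ ∀ (q : Vec d), ‖q‖ ≤ R →
    ∀ y, |ρ y * Φ (q - y.1)| ≤ G y := by
  obtain ⟨q₀, hq₀⟩ := h.exists_integrable_conv
  set R' := max R ‖q₀‖ with hR'
  obtain ⟨g, hg1, hg2⟩ := h.dominated R'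
  refine ⟨fun y => |ρ y * Φ (q₀ - y.1)| + g y.1 * ρ y * (2 * R'),
    hq₀.abs.add (hg1.mul_const _), fun q hq y => ?_⟩
  have hqR : ‖q‖ ≤ R' := hq.trans (le_max_left _ _)
  have hq₀R : ‖q₀‖ ≤ R' := le_max_right _ _
  have h1 := abs_interaction_sub_le hΦ hg2 hqR hq₀R y.1
  have hg0 : 0 ≤ g y.1 := (norm_nonneg _).trans (hg2 q y.1 hqR)
  have h2 : ‖q - q₀‖ ≤ 2 * R' := (norm_sub_le _ _).trans (by linarith)
  have h3 : |Φ (q - y.1)| ≤ |Φ (q₀ - y.1)| + g y.1 * (2 * R') := by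
    have h4 := abs_sub_abs_le_abs_sub (Φ (q - y.1)) (Φ (q₀ - y.1))
    have h5 := mul_le_mul_of_nonneg_left h2 hg0
    linarith
  simp only [abs_mul, abs_of_pos (h.pos y)]
  have := mul_le_mul_of_nonneg_left h3 (h.pos y).le
  linarith

lemma continuous_conv_integrand (q : Vec d) : Continuous fun y : Phase d => ρ y * Φ (q - y.1) :=
  h.contDiff.continuous.mul (hΦ.continuous.comp (by fun_prop))

lemma integrable_conv (q : Vec d) : Integrable fun y : Phase d => ρ y * Φ (q - y.1) := by
  obtain ⟨G, hG, hb⟩ := h.exists_bound hΦ ‖q‖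
  exact hG.mono' (h.continuous_conv_integrand hΦ q).aestronglyMeasurable
    (Filter.Eventually.of_forall fun y => hb q le_rfl y)

lemma continuous_gradConv_integrand (q : Vec d) :
    Continuous fun y : Phase d => ρ y • gradient Φ (q - y.1) :=
  h.contDiff.continuous.smul ((continuous_gradient hΦ).comp (by fun_prop))

lemma continuous_gradConv : Continuous (gradConv Φ ρ) := by
  rw [continuous_iff_continuousAt]
  intro q
  obtain ⟨G, hG, hb⟩ := h.exists_bound_grad (‖q‖ + 1)
  refine continuousAt_of_dominated (bound := G) (Filter.Eventually.of_forall fun q =>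
    (h.continuous_gradConv_integrand hΦ q).aestronglyMeasurable) ?_ hG ?_
  · filter_upwards [Metric.ball_mem_nhds q one_pos] with q' hq'
    refine Filter.Eventually.of_forall fun y => hb q' ?_ y
    rw [Metric.mem_ball, dist_eq_norm] at hq'
    have := norm_le_norm_add_norm_sub' q' q
    linarith
  · have hc := continuous_gradient hΦ
    refine Filter.Eventually.of_forall fun y => Continuous.continuousAt ?_
    fun_prop

lemma hasFDerivAt_conv (q : Vec d) :
    HasFDerivAt (conv Φ ρ) (InnerProductSpace.toDual ℝ (Vec d) (gradConv Φ ρ q)) q := by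
  obtain ⟨G, hG, hb⟩ := h.exists_bound_grad (‖q‖ + 1)
  have hc : ∀ q : Vec d, Continuous fun y : Phase d => ρ y • fderiv ℝ Φ (q - y.1) := fun q =>
    h.contDiff.continuous.smul ((hΦ.continuous_fderiv one_ne_zero).comp (by fun_prop))
  have hn : ∀ (q' : Vec d) (y : Phase d), ‖ρ y • fderiv ℝ Φ (q' - y.1)‖ =
      ‖ρ y • gradient Φ (q' - y.1)‖ := fun q' y => by
    rw [norm_smul, norm_smul, norm_gradient]
  have hball : ∀ q' ∈ Metric.ball q 1, ‖q'‖ ≤ ‖q‖ + 1 := by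
    intro q' hq'
    rw [Metric.mem_ball, dist_eq_norm] at hq'
    have := norm_le_norm_add_norm_sub' q' q
    linarith
  have key : HasFDerivAt (conv Φ ρ) (∫ y : Phase d, ρ y • fderiv ℝ Φ (q - y.1)) q := by
    refine hasFDerivAt_integral_of_dominated_of_fderiv_le (bound := G)
      (F' := fun q y => ρ y • fderiv ℝ Φ (q - y.1)) (Metric.ball_mem_nhds q one_pos)
      (Filter.Eventually.of_forall fun q =>
        (h.continuous_conv_integrand hΦ q).aestronglyMeasurable)
      (h.integrable_conv hΦ q) (hc q).aestronglyMeasurable ?_ hG ?_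
    · refine Filter.Eventually.of_forall fun y q' hq' => ?_
      rw [hn]
      exact hb q' (hball q' hq') y
    · refine Filter.Eventually.of_forall fun y q' _ => ?_
      exact ((hΦ.differentiable one_ne_zero (q' - y.1)).hasFDerivAt.comp q'
        ((hasFDerivAt_id q').sub_const y.1)).const_mul (ρ y)
  have hq : ‖q‖ ≤ ‖q‖ + 1 := by linarith
  have hi1 : Integrable fun y : Phase d => ρ y • fderiv ℝ Φ (q - y.1) :=
    hG.mono' (hc q).aestronglyMeasurable
      (Filter.Eventually.of_forall fun y => by rw [hn]; exact hb q hq y)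
  have hi2 : Integrable fun y : Phase d => ρ y • gradient Φ (q - y.1) :=
    hG.mono' (h.continuous_gradConv_integrand hΦ q).aestronglyMeasurable
      (Filter.Eventually.of_forall fun y => hb q hq y)
  refine key.congr_fderiv ?_
  ext u
  rw [ContinuousLinearMap.integral_apply hi1, InnerProductSpace.toDual_apply_apply, gradConv,
    real_inner_comm, ← integral_inner hi2]
  refine integral_congr_ae (Filter.Eventually.of_forall fun y => ?_)
  simp only [_root_.smul_apply, smul_eq_mul]
  rw [real_inner_smul_right, real_inner_comm, gradient, InnerProductSpace.toDual_symm_apply]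

lemma contDiff_conv : ContDiff ℝ 1 (conv Φ ρ) := by
  rw [contDiff_one_iff_fderiv]
  refine ⟨fun q => (h.hasFDerivAt_conv hΦ q).differentiableAt, ?_⟩
  rw [show fderiv ℝ (conv Φ ρ) = fun q => InnerProductSpace.toDual ℝ (Vec d) (gradConv Φ ρ q) from
    funext fun q => (h.hasFDerivAt_conv hΦ q).fderiv]
  exact (InnerProductSpace.toDual ℝ (Vec d)).continuous.comp (h.continuous_gradConv hΦ)

variable (hV : ContDiff ℝ 1 V) (m : ℝ)
include hV

lemma contDiff_dEnergy : ContDiff ℝ 1 (dEnergy m V Φ ρ) := by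
  have h1 : ContDiff ℝ 1 fun x : Phase d => ‖x.2‖ ^ 2 / (2 * m) :=
    (contDiff_snd.norm_sq ℝ).div_const _
  exact (h1.add (hV.comp contDiff_fst)).add ((h.contDiff_conv hΦ).comp contDiff_fst)

lemma gradQ_dEnergy (x : Phase d) :
    gradQ (dEnergy m V Φ ρ) x = gradient V x.1 + gradConv Φ ρ x.1 := by
  have h1 : HasFDerivAt (fun q => dEnergy m V Φ ρ (q, x.2)) _ x.1 :=
    ((hV.differentiable one_ne_zero x.1).hasFDerivAt.const_add (‖x.2‖ ^ 2 / (2 * m))).add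
      (h.hasFDerivAt_conv hΦ x.1)
  rw [gradQ, gradient, h1.fderiv, map_add, LinearIsometryEquiv.symm_apply_apply]
  rfl

omit hV h hΦ in
lemma _root_.PreGeneric.gradP_dEnergy (m : ℝ) (x : Phase d) :
    gradP (dEnergy m V Φ ρ) x = (1 / m) • x.2 := by
  have h1 : HasFDerivAt (fun p => dEnergy m V Φ ρ (x.1, p)) _ x.2 :=
    (((hasStrictFDerivAt_norm_sq x.2).hasFDerivAt.mul_const (2 * m)⁻¹).add_const
      (V x.1)).add_const (conv Φ ρ x.1)
  have h2 : (2 * m)⁻¹ • (2 • innerSL ℝ x.2) =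
      InnerProductSpace.toDual ℝ (Vec d) ((1 / m) • x.2) := by
    ext u
    simp only [_root_.smul_apply, innerSL_apply_apply, nsmul_eq_mul, smul_eq_mul,
      InnerProductSpace.toDual_apply_apply, real_inner_smul_left]
    push_cast
    rw [mul_inv]
    ring
  rw [gradP, gradient, h1.fderiv, h2, LinearIsometryEquiv.symm_apply_apply]

lemma dEnergy_mem : dEnergy m V Φ ρ ∈ cotangent ρ := by
  have hC := h.contDiff_dEnergy hΦ hV m
  refine ⟨hC, ?_, ?_⟩
  · rw [memLp_two_law_iff h.contDiff.continuous h.pos (continuous_gradQ hC)]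
    simp only [h.gradQ_dEnergy hΦ hV m]
    exact h.force
  · rw [memLp_two_law_iff h.contDiff.continuous h.pos (continuous_gradP hC)]
    simp only [gradP_dEnergy, norm_smul, mul_pow, mul_assoc]
    exact h.kinetic.const_mul _

omit hΦ hV in
lemma hasFDerivAt_log (x : Phase d) :
    HasFDerivAt (fun y => Real.log (ρ y) + 1) ((ρ x)⁻¹ • fderiv ℝ ρ x) x :=
  ((h.contDiff.differentiable one_ne_zero x).hasFDerivAt.log (h.pos x).ne').add_const 1

omit hΦ hV in
lemma gradQ_log (x : Phase d) :
    gradQ (fun y => Real.log (ρ y) + 1) x = (ρ x)⁻¹ • gradQ ρ x := by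
  rw [gradQ_of_hasFDerivAt (h.hasFDerivAt_log x), map_smul,
    gradQ_eq (h.contDiff.differentiable one_ne_zero x)]

omit hΦ hV in
lemma gradP_log (x : Phase d) :
    gradP (fun y => Real.log (ρ y) + 1) x = (ρ x)⁻¹ • gradP ρ x := by
  rw [gradP_of_hasFDerivAt (h.hasFDerivAt_log x), map_smul,
    gradP_eq (h.contDiff.differentiable one_ne_zero x)]

omit hΦ hV in
lemma contDiff_log : ContDiff ℝ 1 fun y => Real.log (ρ y) + 1 :=
  (h.contDiff.log fun x => (h.pos x).ne').add contDiff_const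

omit hΦ hV in
lemma log_mem : (fun y => Real.log (ρ y) + 1) ∈ cotangent ρ := by
  have key : ∀ (x : Phase d) (w : Vec d), ‖(ρ x)⁻¹ • w‖ ^ 2 * ρ x = ‖w‖ ^ 2 / ρ x := by
    intro x w
    have := (h.pos x).ne'
    rw [norm_smul, mul_pow, Real.norm_eq_abs, sq_abs]
    field_simp
  refine ⟨h.contDiff_log, ?_, ?_⟩
  · rw [memLp_two_law_iff h.contDiff.continuous h.pos (continuous_gradQ h.contDiff_log)]
    simp only [h.gradQ_log, key]
    exact h.fisherQ
  · rw [memLp_two_law_iff h.contDiff.continuous h.pos (continuous_gradP h.contDiff_log)]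
    simp only [h.gradP_log, key]
    exact h.fisherP

lemma dEntropy_mem : dEntropy m V Φ ρ ∈ cotangent ρ :=
  (cotangent ρ).add_mem h.log_mem (h.dEnergy_mem hΦ hV m)

end IsRegularState

end MeanField

section FunctionalDerivative

variable {d : ℕ} {V Φ : Vec d → ℝ} {ρ σ : Phase d → ℝ}

lemma IsTest.continuous (hσ : IsTest σ) : Continuous σ := hσ.1.continuous

lemma IsTest.integrable_mul (hσ : IsTest σ) {f : Phase d → ℝ} (hf : Continuous f) :
    Integrable fun x => f x * σ x :=
  (hf.mul hσ.continuous).integrable_of_hasCompactSupport hσ.2.mul_left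

lemma IsTest.exists_abs_div_le (hσ : IsTest σ) (hc : Continuous ρ) (hpos : ∀ x, 0 < ρ x) :
    ∃ B : ℝ, 0 ≤ B ∧ ∀ x, |σ x| ≤ B * ρ x := by
  have h1 : HasCompactSupport fun x => (ρ x)⁻¹ * σ x := hσ.2.mul_left
  obtain ⟨B, hB⟩ := h1.exists_bound_of_continuous
    ((hc.inv₀ fun x => (hpos x).ne').mul hσ.continuous)
  refine ⟨B, (norm_nonneg _).trans (hB 0), fun x => ?_⟩
  have h2 := hB x
  rw [norm_mul, norm_inv, Real.norm_eq_abs, Real.norm_eq_abs, abs_of_pos (hpos x),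
    inv_mul_le_iff₀ (hpos x)] at h2
  linarith

namespace IsRegularState

variable (h : IsRegularState V Φ ρ)
include h

/-- The mixed interaction energy of a state and a test function is absolutely convergent. -/
lemma integrable_mixed (hΦ : ContDiff ℝ 1 Φ) (hs : ∀ q, Φ (-q) = Φ q) (hσ : IsTest σ) :
    Integrable (fun z : Phase d × Phase d => σ z.2 * Φ (z.1.1 - z.2.1) * ρ z.1)
      (volume.prod volume) := by
  have hρc := h.contDiff.continuous
  have hσc := hσ.continuous
  have hΦc := hΦ.continuous
  have hc : Continuous fun z : Phase d × Phase d => σ z.2 * Φ (z.1.1 - z.2.1) * ρ z.1 := by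
    fun_prop
  have hsym : ∀ x y : Phase d, Φ (x.1 - y.1) = Φ (y.1 - x.1) := fun x y => by
    rw [← hs, neg_sub]
  rw [integrable_prod_iff' hc.aestronglyMeasurable]
  constructor
  · refine Filter.Eventually.of_forall fun y => ?_
    refine ((h.integrable_conv hΦ y.1).const_mul (σ y)).congr
      (Filter.Eventually.of_forall fun x => ?_)
    simp only [hsym x y]
    ring
  · obtain ⟨R, hR⟩ := hσ.2.isCompact.isBounded.subset_closedBall 0
    obtain ⟨G, hG, hb⟩ := h.exists_bound hΦ R
    have hi : Integrable fun y : Phase d => |σ y| * ∫ x, G x := by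
      have := (hσc.integrable_of_hasCompactSupport hσ.2 (μ := volume)).abs
      exact this.mul_const _
    refine hi.mono' (hc.norm.stronglyMeasurable.comp_measurable
      measurable_swap).integral_prod_right'.aestronglyMeasurable
      (Filter.Eventually.of_forall fun y => ?_)
    rw [Real.norm_eq_abs, abs_of_nonneg (integral_nonneg fun x => norm_nonneg _)]
    by_cases hy : σ y = 0
    · simp [hy]
    · have hyR : ‖y.1‖ ≤ R := by
        have := hR (subset_tsupport _ hy)
        rw [mem_closedBall_zero_iff] at this
        exact (norm_fst_le y).trans this
      rw [← integral_const_mul]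
      refine integral_mono_of_nonneg (Filter.Eventually.of_forall fun x => norm_nonneg _)
        (hG.const_mul _) (Filter.Eventually.of_forall fun x => ?_)
      have h1 := hb y.1 hyR x
      simp only [hsym x y]
      rw [Real.norm_eq_abs, mul_assoc, abs_mul, mul_comm (Φ _)]
      gcongr

lemma energy_functionalDeriv (hΦ : ContDiff ℝ 1 Φ) (hs : ∀ q, Φ (-q) = Φ q)
    (hV : ContDiff ℝ 1 V) (m : ℝ) (hσ : IsTest σ) :
    HasDerivAt (fun t : ℝ => energy m V Φ fun x => ρ x + t * σ x)
      (∫ x, dEnergy m V Φ ρ x * σ x) 0 := by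
  have hρc := h.contDiff.continuous
  have hσc := hσ.continuous
  have hΦc := hΦ.continuous
  have hVc := hV.continuous
  have hCc := (h.contDiff_conv hΦ).continuous
  set e : Phase d → ℝ := fun x => ‖x.2‖ ^ 2 / (2 * m) + V x.1 with he
  have hec : Continuous e := by fun_prop
  have hmix := h.integrable_mixed hΦ hs hσ
  -- the four integrals occurring in the expansion of the energy
  have i1 : Integrable fun x => e x * ρ x := by
    refine ((h.kinetic.const_mul (2 * m)⁻¹).add h.potential).congr
      (Filter.Eventually.of_forall fun x => ?_)
    simp only [he, Pi.add_apply]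
    ring
  have i2 : Integrable fun x : Phase d => conv Φ ρ x.1 * ρ x := by
    have h1 := Integrable.integral_prod_left (μ := volume) (ν := volume) h.interaction
    refine h1.congr (Filter.Eventually.of_forall fun x => ?_)
    simp only [conv]
    rw [← integral_mul_const]
    exact integral_congr_ae (Filter.Eventually.of_forall fun y => by simp only; ring)
  have i3 : Integrable fun x => e x * σ x := hσ.integrable_mul hec
  have i4 : Integrable fun x : Phase d => conv Φ ρ x.1 * σ x :=
    hσ.integrable_mul (hCc.comp continuous_fst)
  have i5 : Integrable fun x : Phase d => conv Φ σ x.1 * ρ x := by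
    refine hmix.integral_prod_left.congr (Filter.Eventually.of_forall fun x => ?_)
    simp only [conv]
    rw [← integral_mul_const]
  have i6 : Integrable fun x : Phase d => conv Φ σ x.1 * σ x := by
    obtain ⟨B, -, hB⟩ := hσ.exists_abs_div_le hρc h.pos
    have h1 : Integrable fun x : Phase d => (σ x / ρ x) * (conv Φ σ x.1 * ρ x) := by
      refine i5.bdd_mul (c := B)
        (hσc.div hρc fun x => (h.pos x).ne').aestronglyMeasurable
        (Filter.Eventually.of_forall fun x => ?_)
      rw [norm_div, Real.norm_eq_abs, Real.norm_eq_abs, abs_of_pos (h.pos x),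
        div_le_iff₀ (h.pos x)]
      exact hB x
    refine h1.congr (Filter.Eventually.of_forall fun x => ?_)
    have := (h.pos x).ne'
    simp only
    field_simp
  -- by Fubini and the symmetry of `Φ` both mixed terms agree
  have hswap : ∫ x : Phase d, conv Φ σ x.1 * ρ x = ∫ x : Phase d, conv Φ ρ x.1 * σ x := by
    have h1 : ∫ x : Phase d, conv Φ σ x.1 * ρ x =
        ∫ x : Phase d, ∫ y : Phase d, σ y * Φ (x.1 - y.1) * ρ x :=
      integral_congr_ae (Filter.Eventually.of_forall fun x => by
        simp only [conv]
        rw [← integral_mul_const])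
    rw [h1, integral_integral_swap (f := fun x y : Phase d => σ y * Φ (x.1 - y.1) * ρ x) hmix]
    refine integral_congr_ae (Filter.Eventually.of_forall fun y => ?_)
    simp only [conv]
    rw [← integral_mul_const]
    refine integral_congr_ae (Filter.Eventually.of_forall fun x => ?_)
    simp only
    rw [← hs (y.1 - x.1), neg_sub]
    ring
  have hconv : ∀ (t : ℝ) (q : Vec d),
      conv Φ (fun x => ρ x + t * σ x) q = conv Φ ρ q + t * conv Φ σ q := by
    intro t q
    have j2 : Integrable fun y : Phase d => σ y * Φ (q - y.1) := by
      have h1 : Continuous fun y : Phase d => Φ (q - y.1) := by fun_prop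
      exact (hσ.integrable_mul h1).congr (Filter.Eventually.of_forall fun y => mul_comm _ _)
    simp only [conv]
    rw [← integral_const_mul, ← integral_add (h.integrable_conv hΦ q) (j2.const_mul t)]
    exact integral_congr_ae (Filter.Eventually.of_forall fun y => by simp only; ring)
  set a := ∫ x, (e x * ρ x + 1 / 2 * (conv Φ ρ x.1 * ρ x)) with ha
  set b := ∫ x, dEnergy m V Φ ρ x * σ x with hb
  set c := ∫ x : Phase d, conv Φ σ x.1 * σ x with hc
  have hexp : ∀ t : ℝ, (energy m V Φ fun x => ρ x + t * σ x) = a + t * b + t ^ 2 * (1 / 2 * c) := by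
    intro t
    have k1 : Integrable fun x : Phase d => e x * ρ x + 1 / 2 * (conv Φ ρ x.1 * ρ x) :=
      i1.add (i2.const_mul _)
    have k2 : Integrable fun x : Phase d => e x * σ x + 1 / 2 * (conv Φ ρ x.1 * σ x) +
        1 / 2 * (conv Φ σ x.1 * ρ x) := (i3.add (i4.const_mul _)).add (i5.const_mul _)
    have hb' : b = ∫ x : Phase d, (e x * σ x + 1 / 2 * (conv Φ ρ x.1 * σ x) +
        1 / 2 * (conv Φ σ x.1 * ρ x)) := by
      have k3 : Integrable fun x : Phase d => e x * σ x + 1 / 2 * (conv Φ ρ x.1 * σ x) :=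
        i3.add (i4.const_mul _)
      rw [integral_add k3 (i5.const_mul _), integral_add i3 (i4.const_mul _), integral_const_mul,
        integral_const_mul, hswap, hb]
      have k4 : ∫ x : Phase d, dEnergy m V Φ ρ x * σ x =
          ∫ x : Phase d, (e x * σ x + conv Φ ρ x.1 * σ x) :=
        integral_congr_ae (Filter.Eventually.of_forall fun x => by
          simp only [dEnergy, he]; ring)
      rw [k4, integral_add i3 i4]
      ring
    have k12 : Integrable fun x : Phase d => (e x * ρ x + 1 / 2 * (conv Φ ρ x.1 * ρ x)) +
        t * (e x * σ x + 1 / 2 * (conv Φ ρ x.1 * σ x) + 1 / 2 * (conv Φ σ x.1 * ρ x)) :=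
      k1.add (k2.const_mul t)
    rw [hb', ha, hc, ← integral_const_mul, ← integral_const_mul, ← integral_const_mul,
      ← integral_add k1 (k2.const_mul t), ← integral_add k12 ((i6.const_mul _).const_mul _),
      energy]
    refine integral_congr_ae (Filter.Eventually.of_forall fun x => ?_)
    simp only [hconv, he]
    ring
  have hpoly : HasDerivAt (fun t : ℝ => a + t * b + t ^ 2 * (1 / 2 * c)) b 0 := by
    have := (((hasDerivAt_id (0 : ℝ)).mul_const b).const_add a).add
      (((hasDerivAt_id (0 : ℝ)).pow 2).mul_const (1 / 2 * c))
    exact this.congr_deriv (by simp)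
  exact hpoly.congr_of_eventuallyEq (Filter.Eventually.of_forall hexp)

lemma boltzmann_functionalDeriv (hσ : IsTest σ) :
    HasDerivAt (fun t : ℝ => ∫ x, Real.log (ρ x + t * σ x) * (ρ x + t * σ x))
      (∫ x, (Real.log (ρ x) + 1) * σ x) 0 := by
  have hρc := h.contDiff.continuous
  have hσc := hσ.continuous
  obtain ⟨B, hB0, hB⟩ := hσ.exists_abs_div_le hρc h.pos
  set ε := 1 / (2 * (B + 1)) with hε
  have hε0 : 0 < ε := by positivity
  -- for small `t` the perturbed density is comparable to the original one
  have hcomp : ∀ t ∈ Metric.ball (0 : ℝ) ε, ∀ x, ρ x / 2 ≤ ρ x + t * σ x ∧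
      ρ x + t * σ x ≤ 2 * ρ x := by
    intro t ht x
    have ht' : |t| ≤ ε := by simpa using (Metric.mem_ball.1 ht).le
    have h1 : |t * σ x| ≤ ρ x / 2 := by
      rw [abs_mul]
      calc |t| * |σ x| ≤ ε * (B * ρ x) := by gcongr; exact hB x
        _ ≤ ε * ((B + 1) * ρ x) := by
          have := (h.pos x).le
          gcongr
          linarith
        _ = ρ x / 2 := by rw [hε]; field_simp
    have := abs_le.1 h1
    have := h.pos x
    constructor <;> linarith
  have hlogc : Continuous fun x => Real.log (ρ x) :=
    hρc.log fun x => (h.pos x).ne'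
  have hbound : Integrable fun x => (|Real.log (ρ x)| + Real.log 2 + 1) * |σ x| := by
    have h1 := hσ.integrable_mul (f := fun x => |Real.log (ρ x)| + Real.log 2 + 1)
      (by fun_prop)
    refine h1.abs.congr (Filter.Eventually.of_forall fun x => ?_)
    have : 0 ≤ |Real.log (ρ x)| + Real.log 2 + 1 := by
      have := Real.log_nonneg one_le_two
      positivity
    simp only [abs_mul, abs_of_nonneg this]
  have key := hasDerivAt_integral_of_dominated_loc_of_deriv_le (μ := (volume : Measure (Phase d)))
    (F := fun t x => Real.log (ρ x + t * σ x) * (ρ x + t * σ x))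
    (F' := fun t x => (Real.log (ρ x + t * σ x) + 1) * σ x) (x₀ := (0 : ℝ))
    (bound := fun x => (|Real.log (ρ x)| + Real.log 2 + 1) * |σ x|)
    (Metric.ball_mem_nhds (0 : ℝ) hε0) ?_ ?_ ?_ ?_ hbound ?_
  · simpa using key.2
  · refine Filter.Eventually.of_forall fun t => ?_
    have : Measurable fun x => ρ x + t * σ x := by fun_prop
    exact ((Real.measurable_log.comp this).mul this).aestronglyMeasurable
  · simpa using h.entropic
  · have : Measurable fun x => ρ x + 0 * σ x := by fun_prop
    exact (((Real.measurable_log.comp this).add_const 1).mul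
      hσc.measurable).aestronglyMeasurable
  · refine Filter.Eventually.of_forall fun x t ht => ?_
    obtain ⟨h1, h2⟩ := hcomp t ht x
    have hx := h.pos x
    have hpos : 0 < ρ x + t * σ x := by linarith
    rw [norm_mul, Real.norm_eq_abs, Real.norm_eq_abs]
    gcongr
    refine (abs_add_le _ _).trans ?_
    rw [abs_one]
    gcongr
    have h3 := Real.log_le_log hpos h2
    have h4 := Real.log_le_log (by linarith) h1
    rw [Real.log_mul two_ne_zero hx.ne'] at h3
    rw [Real.log_div hx.ne' two_ne_zero] at h4
    have h5 := neg_abs_le (Real.log (ρ x))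
    have h6 := le_abs_self (Real.log (ρ x))
    exact abs_le.2 ⟨by linarith, by linarith⟩
  · refine Filter.Eventually.of_forall fun x t ht => ?_
    have hpos : 0 < ρ x + t * σ x := by
      have := (hcomp t ht x).1
      have := h.pos x
      linarith
    have h1 : HasDerivAt (fun t => ρ x + t * σ x) (σ x) t := by
      simpa using ((hasDerivAt_id t).mul_const (σ x)).const_add (ρ x)
    refine ((h1.log hpos.ne').mul h1).congr_deriv ?_
    rw [div_mul_cancel₀ _ hpos.ne']
    ring

lemma entropy_functionalDeriv (hΦ : ContDiff ℝ 1 Φ) (hs : ∀ q, Φ (-q) = Φ q)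
    (hV : ContDiff ℝ 1 V) (m : ℝ) (hσ : IsTest σ) :
    HasDerivAt (fun t : ℝ => entropy m V Φ fun x => ρ x + t * σ x)
      (∫ x, dEntropy m V Φ ρ x * σ x) 0 := by
  have h1 := (h.boltzmann_functionalDeriv hσ).add (h.energy_functionalDeriv hΦ hs hV m hσ)
  refine h1.congr_deriv ?_
  rw [← integral_add (hσ.integrable_mul h.contDiff_log.continuous)
    (hσ.integrable_mul (h.contDiff_dEnergy hΦ hV m).continuous)]
  exact integral_congr_ae (Filter.Eventually.of_forall fun x => by
    simp only [dEntropy]; ring)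

end IsRegularState

end FunctionalDerivative

/-! ### The Hamiltonian vector field -/

section Hamiltonian

variable {d : ℕ} {V Φ : Vec d → ℝ} {ρ : Phase d → ℝ}

instance : (volume : Measure (Phase d)).IsAddHaarMeasure :=
  inferInstanceAs ((volume : Measure (Vec d)).prod (volume : Measure (Vec d))).IsAddHaarMeasure

lemma fieldTangent_eq_inner (Y Z : Lp (Vec d) 2 (law ρ)) (ξ : cotangent ρ) :
    (fieldTangent Y Z).1 ξ = ⟪Y, gradQL2 ρ ξ⟫ + ⟪Z, gradPL2 ρ ξ⟫ := rfl

/-- Integration by parts against a function that is constant in the direction of derivation. -/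
lemma integral_mul_fderiv_eq_zero {ρ f : Phase d → ℝ} (hρ : ContDiff ℝ 1 ρ) {v : Phase d}
    (hf : ∀ (x : Phase d) (t : ℝ), f (x + t • v) = f x) (h1 : Integrable fun x => f x * ρ x)
    (h2 : Integrable fun x => f x * fderiv ℝ ρ x v) : ∫ x, f x * fderiv ℝ ρ x v = 0 := by
  have key := integral_bilinear_hasLineDerivAt_right_eq_neg_left_of_integrable
    (μ := (volume : Measure (Phase d))) (f := f) (f' := fun _ => 0) (g := ρ)
    (g' := fun x => fderiv ℝ ρ x v) (v := v) (B := ContinuousLinearMap.mul ℝ ℝ)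
    (by simp) (by simpa using h2) (by simpa using h1)
    (fun x _ => by
      rw [HasLineDerivAt]
      simp only [hf]
      exact hasDerivAt_const _ _)
    (fun x _ => (hρ.differentiable one_ne_zero x).hasFDerivAt.hasLineDerivAt v)
  simpa using key

/-- A field which does not depend on the variables of differentiation is orthogonal to the gradient
of `ρ`. Here `g` is the gradient along the subspace embedded by `i`. Finite Fisher information makes
the integral absolutely convergent. -/
lemma integral_inner_grad_eq_zero (hρ : ContDiff ℝ 1 ρ) (hpos : ∀ x, 0 < ρ x)
    (hint : Integrable ρ) (i : Vec d →L[ℝ] Phase d) {g Y : Phase d → Vec d}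
    (hgi : ∀ x u, ⟪g x, u⟫ = fderiv ℝ ρ x (i u)) (hfisher : Integrable fun x => ‖g x‖ ^ 2 / ρ x)
    (hY : Continuous Y) (hYi : ∀ x u, Y (x + i u) = Y x)
    (hYint : Integrable fun x => ‖Y x‖ ^ 2 * ρ x) :
    Integrable (fun x => ⟪Y x, g x⟫) ∧ ∫ x, ⟪Y x, g x⟫ = 0 := by
  set e : Fin d → Vec d := fun k => EuclideanSpace.single k 1 with he
  have hcoord : ∀ (w : Vec d) (k : Fin d), w k = ⟪w, e k⟫ := fun w k => by
    rw [he, EuclideanSpace.inner_single_right]; simp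
  have hsum : ∀ x, ⟪Y x, g x⟫ = ∑ k, Y x k * fderiv ℝ ρ x (i (e k)) := by
    intro x
    rw [PiLp.inner_apply]
    refine Finset.sum_congr rfl fun k _ => ?_
    rw [← hgi, ← hcoord]
    simp [mul_comm]
  have hle : ∀ (w : Vec d) k, |w k| ≤ ‖w‖ := fun w k => by
    rw [← Real.norm_eq_abs]; exact PiLp.norm_apply_le w k
  have h1 : ∀ k, Integrable fun x => Y x k * ρ x := by
    intro k
    have hc : Continuous fun x => Y x k := by fun_prop
    refine (hint.add hYint).mono' (hc.mul hρ.continuous).aestronglyMeasurable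
      (Filter.Eventually.of_forall fun x => ?_)
    rw [norm_mul, Real.norm_eq_abs, Real.norm_eq_abs, abs_of_pos (hpos x), Pi.add_apply]
    have h3 := hle (Y x) k
    have h4 : |Y x k| ≤ 1 + ‖Y x‖ ^ 2 := by nlinarith [sq_nonneg (‖Y x‖ - 1), norm_nonneg (Y x)]
    have := mul_le_mul_of_nonneg_right h4 (hpos x).le
    linarith
  have h2 : ∀ k, Integrable fun x => Y x k * fderiv ℝ ρ x (i (e k)) := by
    intro k
    have hc : Continuous fun x => Y x k := by fun_prop
    have hc' : Continuous fun x => fderiv ℝ ρ x (i (e k)) :=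
      (hρ.continuous_fderiv one_ne_zero).clm_apply continuous_const
    refine (hYint.add hfisher).mono' (hc.mul hc').aestronglyMeasurable
      (Filter.Eventually.of_forall fun x => ?_)
    rw [← hgi, ← hcoord, norm_mul, Real.norm_eq_abs, Real.norm_eq_abs, Pi.add_apply]
    have hx := hpos x
    have h3 : |Y x k| * |g x k| ≤ ‖Y x‖ * ‖g x‖ := by gcongr <;> exact hle _ k
    refine h3.trans ?_
    rw [← sub_nonneg]
    have h4 : ‖Y x‖ ^ 2 * ρ x + ‖g x‖ ^ 2 / ρ x - ‖Y x‖ * ‖g x‖ =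
        ((‖Y x‖ * ρ x - ‖g x‖) ^ 2 + ‖Y x‖ * ‖g x‖ * ρ x) / ρ x := by
      field_simp
      ring
    rw [h4]
    positivity
  constructor
  · exact (integrable_finsetSum _ fun k _ => h2 k).congr
      (Filter.Eventually.of_forall fun x => (hsum x).symm)
  · rw [integral_congr_ae (Filter.Eventually.of_forall hsum), integral_finsetSum _ fun k _ => h2 k]
    refine Finset.sum_eq_zero fun k _ =>
      integral_mul_fderiv_eq_zero hρ (fun x t => ?_) (h1 k) (h2 k)
    rw [← map_smul, hYi]

namespace IsRegularState

variable (h : IsRegularState V Φ ρ) (hΦ : ContDiff ℝ 1 Φ) (hV : ContDiff ℝ 1 V) (m : ℝ)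

/-- The differential of the energy, as a cotangent vector. -/
def energyCovector : cotangent ρ := ⟨dEnergy m V Φ ρ, h.dEnergy_mem hΦ hV m⟩

/-- The differential of the entropy, as a cotangent vector. -/
def entropyCovector : cotangent ρ := ⟨dEntropy m V Φ ρ, h.dEntropy_mem hΦ hV m⟩

/-- The function `log ρ + 1`, as a cotangent vector. -/
def logCovector : cotangent ρ := ⟨fun y => Real.log (ρ y) + 1, h.log_mem⟩

lemma entropyCovector_eq :
    h.entropyCovector hΦ hV m = h.logCovector + h.energyCovector hΦ hV m := rfl

/-- The tangent vector represented by the distribution `hamField`. -/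
def hamTangent : tangent ρ :=
  fieldTangent (gradPL2 ρ (h.energyCovector hΦ hV m)) (-gradQL2 ρ (h.energyCovector hΦ hV m))

lemma hamTangent_apply (ξ : cotangent ρ) : (h.hamTangent hΦ hV m).1 ξ =
    ⟪gradPL2 ρ (h.energyCovector hΦ hV m), gradQL2 ρ ξ⟫ -
      ⟪gradQL2 ρ (h.energyCovector hΦ hV m), gradPL2 ρ ξ⟫ := by
  rw [hamTangent, fieldTangent_eq_inner, inner_neg_left, sub_eq_add_neg]

lemma inner_gradPL2_gradQL2 (ξ ζ : cotangent ρ) :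
    ⟪gradPL2 ρ ξ, gradQL2 ρ ζ⟫ = ∫ x, ⟪gradP (ξ : Phase d → ℝ) x,
      gradQ (ζ : Phase d → ℝ) x⟫ ∂(law ρ) := inner_toLp ξ.2.2.2 ζ.2.2.1

lemma inner_gradQL2_gradPL2 (ξ ζ : cotangent ρ) :
    ⟪gradQL2 ρ ξ, gradPL2 ρ ζ⟫ = ∫ x, ⟪gradQ (ξ : Phase d → ℝ) x,
      gradP (ζ : Phase d → ℝ) x⟫ ∂(law ρ) := inner_toLp ξ.2.2.1 ζ.2.2.2

lemma represents_hamTangent : Represents (h.hamTangent hΦ hV m) (hamField m V Φ ρ) := by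
  intro φ _
  have hc := h.contDiff.continuous
  rw [hamTangent_apply, inner_gradPL2_gradQL2, inner_gradQL2_gradPL2,
    integral_law hc h.pos, integral_law hc h.pos]
  simp only [hamField, poisson, sympl, divQ, divP, Pi.add_apply, energyCovector]
  rw [← integral_neg, sub_eq_add_neg]
  refine congrArg₂ (· + ·) (integral_congr_ae (Filter.Eventually.of_forall fun x => ?_))
    (congrArg _ (integral_congr_ae (Filter.Eventually.of_forall fun x => ?_)))
  · simp only [smul_neg, inner_neg_left, neg_neg, real_inner_smul_left, smul_eq_mul]
  · simp only [real_inner_smul_left, smul_eq_mul]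

/-- The Hamiltonian vector field preserves the entropy: it annihilates the differential of the
energy by antisymmetry, and `log ρ` because it is divergence free. -/
lemma hamTangent_entropyCovector : (h.hamTangent hΦ hV m).1 (h.entropyCovector hΦ hV m) = 0 := by
  have hc := h.contDiff.continuous
  have hE : (h.hamTangent hΦ hV m).1 (h.energyCovector hΦ hV m) = 0 := by
    rw [hamTangent_apply, real_inner_comm, sub_self]
  rw [entropyCovector_eq, map_add, hE, add_zero, hamTangent_apply, inner_gradPL2_gradQL2,
    inner_gradQL2_gradPL2, integral_law hc h.pos, integral_law hc h.pos]
  have hQ := integral_inner_grad_eq_zero h.contDiff h.pos h.integrable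
    (ContinuousLinearMap.inl ℝ (Vec d) (Vec d))
    (fun x u => by rw [inner_gradQ (h.contDiff.differentiable one_ne_zero x)]; rfl) h.fisherQ
    (Y := fun x => (1 / m) • x.2) (by fun_prop) (fun x u => by simp)
    (by simp only [norm_smul, mul_pow, mul_assoc]; exact h.kinetic.const_mul _)
  have hP := integral_inner_grad_eq_zero h.contDiff h.pos h.integrable
    (ContinuousLinearMap.inr ℝ (Vec d) (Vec d))
    (fun x u => by rw [inner_gradP (h.contDiff.differentiable one_ne_zero x)]; rfl) h.fisherP
    (Y := fun x => gradient V x.1 + gradConv Φ ρ x.1)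
    (((continuous_gradient hV).comp continuous_fst).add
      ((h.continuous_gradConv hΦ).comp continuous_fst)) (fun x u => by simp) h.force
  have e1 : ∀ x, ρ x • ⟪gradP (h.energyCovector hΦ hV m : Phase d → ℝ) x,
      gradQ (h.logCovector : Phase d → ℝ) x⟫ = ⟪(1 / m) • x.2, gradQ ρ x⟫ := by
    intro x
    have := (h.pos x).ne'
    simp only [energyCovector, logCovector]
    rw [h.gradQ_log, gradP_dEnergy, real_inner_smul_right, smul_eq_mul, mul_inv_cancel_left₀ this]
  have e2 : ∀ x, ρ x • ⟪gradQ (h.energyCovector hΦ hV m : Phase d → ℝ) x,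
      gradP (h.logCovector : Phase d → ℝ) x⟫ =
        ⟪gradient V x.1 + gradConv Φ ρ x.1, gradP ρ x⟫ := by
    intro x
    have := (h.pos x).ne'
    simp only [energyCovector, logCovector]
    rw [h.gradP_log, h.gradQ_dEnergy hΦ hV, real_inner_smul_right, smul_eq_mul,
      mul_inv_cancel_left₀ this]
  simp only [e1, e2, hQ.2, hP.2, sub_self]

include h hΦ hV in
/-- The evolution is the sum of its Hamiltonian and its dissipative part. -/
lemma dynamics_eq (G : (Phase d → ℝ) → Phase d → ℝ) (φ : Phase d → ℝ) :
    dynamics m V Φ G ρ φ = hamField m V Φ ρ φ + adjointGen G ρ φ := by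
  simp only [dynamics, hamField, poisson, sympl, divQ, divP, Pi.add_apply, Pi.neg_apply,
    gradP_dEnergy, h.gradQ_dEnergy hΦ hV m, smul_neg, inner_neg_left, integral_neg, smul_add]

end IsRegularState

end Hamiltonian

/-! ### The Vlasov-Fokker-Planck equation -/

section VlasovFokkerPlanck

variable {d : ℕ} {V Φ : Vec d → ℝ} {ρ : Phase d → ℝ}

lemma lapP_eq {φ : Phase d → ℝ} (hφ : ContDiff ℝ ∞ φ) (x : Phase d) :
    lapP φ x = ∑ k : Fin d, fderiv ℝ (fun y => fderiv ℝ φ y (0, EuclideanSpace.single k 1)) x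
      (0, EuclideanSpace.single k 1) := by
  have hd : Differentiable ℝ φ := hφ.differentiable (by simp)
  have hd2 : Differentiable ℝ (fderiv ℝ φ) :=
    (hφ.fderiv_right (m := 1) (by norm_cast)).differentiable one_ne_zero
  have hi : ∀ p : Vec d, HasFDerivAt (fun p : Vec d => (x.1, p))
      (ContinuousLinearMap.inr ℝ (Vec d) (Vec d)) p := fun p => hasFDerivAt_prodMk_right x.1 p
  have h1 : fderiv ℝ (fun p => φ (x.1, p)) = fun p => (fderiv ℝ φ (x.1, p)).comp
      (ContinuousLinearMap.inr ℝ (Vec d) (Vec d)) :=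
    funext fun p => (HasFDerivAt.comp (g := φ) p (hd _).hasFDerivAt (hi p)).fderiv
  rw [lapP, InnerProductSpace.laplacian_eq_iteratedFDeriv_orthonormalBasis _
    (EuclideanSpace.basisFun (Fin d) ℝ)]
  refine Finset.sum_congr rfl fun k _ => ?_
  rw [iteratedFDeriv_two_apply, h1]
  simp only [Matrix.cons_val_zero, Matrix.cons_val_one, EuclideanSpace.basisFun_apply]
  set e : Vec d := EuclideanSpace.single k 1
  have h2 : HasFDerivAt (fun p => fderiv ℝ φ (x.1, p))
      ((fderiv ℝ (fderiv ℝ φ) x).comp (ContinuousLinearMap.inr ℝ (Vec d) (Vec d))) x.2 :=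
    HasFDerivAt.comp (g := fderiv ℝ φ) x.2 (hd2 x).hasFDerivAt (hi x.2)
  have h3 :=
    (h2.clm_comp (hasFDerivAt_const (ContinuousLinearMap.inr ℝ (Vec d) (Vec d)) x.2)).fderiv
  have h4 := ((hd2 x).hasFDerivAt.clm_apply (hasFDerivAt_const ((0, e) : Phase d) x)).fderiv
  rw [h3, h4]
  simp

/-- Integration by parts for the Laplacian in the momentum variable. -/
lemma integral_lapP_mul (hρ : ContDiff ℝ 1 ρ) {φ : Phase d → ℝ} (hφ : IsTest φ) :
    Integrable (fun x => lapP φ x * ρ x) ∧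
      ∫ x, lapP φ x * ρ x = -∫ x, ⟪gradP ρ x, gradP φ x⟫ := by
  set e : Fin d → Phase d := fun k => (0, EuclideanSpace.single k 1) with he
  set D : Fin d → Phase d → ℝ := fun k y => fderiv ℝ φ y (e k) with hD
  have hd : Differentiable ℝ φ := hφ.1.differentiable (by simp)
  have hDd : ∀ k, ContDiff ℝ 1 (D k) := fun k =>
    (hφ.1.fderiv_right (m := 1) (by norm_cast)).clm_apply contDiff_const
  have hDs : ∀ k, HasCompactSupport (D k) := fun k => hφ.2.fderiv_apply ℝ (e k)
  have hDs' : ∀ k, HasCompactSupport fun x => fderiv ℝ (D k) x (e k) := fun k =>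
    (hDs k).fderiv_apply ℝ (e k)
  have hDc : ∀ k, Continuous fun x => fderiv ℝ (D k) x (e k) := fun k =>
    ((hDd k).continuous_fderiv one_ne_zero).clm_apply continuous_const
  have hρc : ∀ k, Continuous fun x => fderiv ℝ ρ x (e k) := fun k =>
    (hρ.continuous_fderiv one_ne_zero).clm_apply continuous_const
  have i1 : ∀ k, Integrable fun x => ρ x * fderiv ℝ (D k) x (e k) := fun k =>
    (hρ.continuous.mul (hDc k)).integrable_of_hasCompactSupport (hDs' k).mul_left
  have i2 : ∀ k, Integrable fun x => fderiv ℝ ρ x (e k) * D k x := fun k =>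
    ((hρc k).mul (hDd k).continuous).integrable_of_hasCompactSupport (hDs k).mul_left
  have i3 : ∀ k, Integrable fun x => ρ x * D k x := fun k =>
    (hρ.continuous.mul (hDd k).continuous).integrable_of_hasCompactSupport (hDs k).mul_left
  have hpt : ∀ x, lapP φ x * ρ x = ∑ k, ρ x * fderiv ℝ (D k) x (e k) := fun x => by
    rw [lapP_eq hφ.1, mul_comm, Finset.mul_sum]
  have hpt2 : ∀ x, ⟪gradP ρ x, gradP φ x⟫ = ∑ k, fderiv ℝ ρ x (e k) * D k x := by
    intro x
    rw [PiLp.inner_apply]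
    refine Finset.sum_congr rfl fun k _ => ?_
    simp only [hD, he]
    rw [← inner_gradP (hρ.differentiable one_ne_zero x), ← inner_gradP (hd x),
      EuclideanSpace.inner_single_right, EuclideanSpace.inner_single_right]
    simp [mul_comm]
  refine ⟨(integrable_finsetSum _ fun k _ => i1 k).congr
    (Filter.Eventually.of_forall fun x => (hpt x).symm), ?_⟩
  rw [integral_congr_ae (Filter.Eventually.of_forall hpt), integral_finsetSum _ fun k _ => i1 k,
    integral_congr_ae (Filter.Eventually.of_forall hpt2), integral_finsetSum _ fun k _ => i2 k,
    ← Finset.sum_neg_distrib]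
  exact Finset.sum_congr rfl fun k _ => integral_mul_fderiv_eq_neg_fderiv_mul_of_integrable
    (i2 k) (i1 k) (i3 k) (fun x _ => hρ.differentiable one_ne_zero x)
    fun x _ => (hDd k).differentiable one_ne_zero x

lemma psiStarVFP_eq {γ : ℝ} (hγ : 0 < γ) : psiStarVFP γ ρ = quadModular (gradPL2 ρ) γ := by
  funext ξ
  rw [quadModular, show ‖gradPL2 ρ ξ‖ ^ 2 = _ from norm_toLp_sq ξ.2.2.2, ← integral_const_mul,
    ofReal_integral_eq_lintegral_ofReal ((integrable_normSq_grad ξ).2.const_mul γ)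
      (Filter.Eventually.of_forall fun x => by positivity)]
  rfl

namespace IsRegularState

variable (h : IsRegularState V Φ ρ) (hΦ : ContDiff ℝ 1 Φ) (hV : ContDiff ℝ 1 V) (m γ : ℝ)

/-- The covector `-dS / 2` at which the dissipation potential is differentiated. -/
def forceCovector : cotangent ρ := -((1 / 2 : ℝ) • h.entropyCovector hΦ hV m)

/-- The dissipative part of the Vlasov-Fokker-Planck equation, as a tangent vector. -/
def vfpTangent : tangent ρ :=
  fieldTangent 0 ((2 * γ) • gradPL2 ρ (h.forceCovector hΦ hV m))

lemma vfpTangent_apply (ξ : cotangent ρ) : (h.vfpTangent hΦ hV m γ).1 ξ =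
    2 * γ * ⟪gradPL2 ρ (h.forceCovector hΦ hV m), gradPL2 ρ ξ⟫ := by
  rw [vfpTangent, fieldTangent_eq_inner, inner_zero_left, zero_add, real_inner_smul_left]

lemma represents_vfpTangent :
    Represents (h.vfpTangent hΦ hV m γ) (adjointGen (genVFP m γ) ρ) := by
  intro φ hφ
  have hc := h.contDiff.continuous
  have hφ1 : ContDiff ℝ 1 (φ : Phase d → ℝ) := φ.2.1
  have h1 : 2 * γ * ⟪gradPL2 ρ (h.forceCovector hΦ hV m), gradPL2 ρ φ⟫ =
      -γ * ⟪gradPL2 ρ (h.entropyCovector hΦ hV m), gradPL2 ρ φ⟫ := by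
    rw [forceCovector, map_neg, map_smul, inner_neg_left, real_inner_smul_left]
    ring
  have h2 : ⟪gradPL2 ρ (h.entropyCovector hΦ hV m), gradPL2 ρ φ⟫ =
      ∫ x, ⟪gradP (dEntropy m V Φ ρ) x, gradP (φ : Phase d → ℝ) x⟫ ∂(law ρ) :=
    inner_toLp (h.entropyCovector hΦ hV m).2.2.2 φ.2.2.2
  have h3 : ∀ x, gradP (dEntropy m V Φ ρ) x = (ρ x)⁻¹ • gradP ρ x + (1 / m) • x.2 := by
    intro x
    have := congrFun (gradP_add h.contDiff_log (h.contDiff_dEnergy hΦ hV m)) x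
    rw [Pi.add_apply, h.gradP_log, gradP_dEnergy] at this
    exact this
  have hs : HasCompactSupport (gradP (φ : Phase d → ℝ)) := by
    refine (hφ.2.fderiv ℝ).mono' fun x hx => ?_
    refine subset_tsupport _ fun h0 => hx ?_
    rw [gradP_eq (hφ1.differentiable one_ne_zero x), h0, map_zero]
  have hgc := continuous_gradP hφ1
  have hgρ := continuous_gradP h.contDiff
  have j1 : Integrable fun x => ⟪gradP ρ x, gradP (φ : Phase d → ℝ) x⟫ :=
    (hgρ.inner hgc).integrable_of_hasCompactSupport
      (hs.mono fun x hx => fun h0 => hx (by simp [h0]))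
  have j2 : Integrable fun x : Phase d => ρ x * ⟪(1 / m) • x.2, gradP (φ : Phase d → ℝ) x⟫ := by
    refine Continuous.integrable_of_hasCompactSupport (by fun_prop)
      (hs.mono fun x hx => fun h0 => hx (by simp [h0]))
  obtain ⟨j3, j4⟩ := integral_lapP_mul h.contDiff hφ
  rw [vfpTangent_apply, h1, h2, integral_law hc h.pos]
  have e1 : ∀ x, ρ x • ⟪gradP (dEntropy m V Φ ρ) x, gradP (φ : Phase d → ℝ) x⟫ =
      ⟪gradP ρ x, gradP (φ : Phase d → ℝ) x⟫ +
        ρ x * ⟪(1 / m) • x.2, gradP (φ : Phase d → ℝ) x⟫ := by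
    intro x
    have := (h.pos x).ne'
    rw [h3, inner_add_left, real_inner_smul_left, smul_eq_mul]
    field_simp
  have e2 : ∀ x, genVFP m γ (φ : Phase d → ℝ) x * ρ x =
      -γ * (ρ x * ⟪(1 / m) • x.2, gradP (φ : Phase d → ℝ) x⟫) +
        γ * (lapP (φ : Phase d → ℝ) x * ρ x) := by
    intro x
    rw [genVFP]
    ring
  simp only [e1, adjointGen, e2]
  rw [integral_add j1 j2, integral_add (j2.const_mul _) (j3.const_mul _), integral_const_mul,
    integral_const_mul, j4]
  ring

end IsRegularState

/-- The velocity of the momentum noise is `2γ ∇ₚη`, the derivative of the potential at `η = -dS /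
2`. Hence equality holds in the Young inequality at `η`. -/
theorem isPreGeneric_vlasovFokkerPlanck (hV : ContDiff ℝ 1 V) (hΦ : ContDiff ℝ 1 Φ)
    (hs : ∀ q, Φ (-q) = Φ q) (m : ℝ) {γ : ℝ} (hγ : 0 < γ) :
    IsPreGeneric {ρ | IsRegularState V Φ ρ} (entropy m V Φ)
      (fun ρ => legendre (tangent ρ) (psiStarVFP γ ρ)) (psiStarVFP γ)
      (hamField m V Φ) (dynamics m V Φ (genVFP m γ)) := by
  intro ρ h
  have h : IsRegularState V Φ ρ := h
  refine ⟨h.entropyCovector hΦ hV m, h.hamTangent hΦ hV m,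
    h.hamTangent hΦ hV m + h.vfpTangent hΦ hV m γ,
    fun σ hσ _ => h.entropy_functionalDeriv hΦ hs hV m hσ, h.represents_hamTangent hΦ hV m,
    fun φ hφ => ?_, ?_⟩
  · rw [h.dynamics_eq hΦ hV, ← h.represents_hamTangent hΦ hV m φ hφ,
      ← h.represents_vfpTangent hΦ hV m γ φ hφ]
    rfl
  · beta_reduce
    rw [psiStarVFP_eq hγ]
    refine (isUniformModular_quadModular (B := gradPL2 ρ) hγ).isPreGenericAt
      (isSymmDissipationPair_quadModular hγ fun ξ => ⟨fieldTangent 0 (gradPL2 ρ ξ), fun x => ?_⟩)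
      rfl (h.hamTangent_entropyCovector hΦ hV m) ENNReal.ofReal_ne_top fun x _ => ?_
    · exact (fieldTangent_eq_inner 0 (gradPL2 ρ ξ) x).trans (by rw [inner_zero_left, zero_add])
    · have hsub : h.hamTangent hΦ hV m + h.vfpTangent hΦ hV m γ - h.hamTangent hΦ hV m =
          h.vfpTangent hΦ hV m γ :=
        Subtype.ext (add_sub_cancel_left (h.hamTangent hΦ hV m).1 (h.vfpTangent hΦ hV m γ).1)
      rw [hsub, h.vfpTangent_apply, h.vfpTangent_apply]
      have h1 := two_mul_inner_le (B := gradPL2 ρ) hγ (h.forceCovector hΦ hV m) x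
      rw [show -((1 / 2 : ℝ) • h.entropyCovector hΦ hV m) = h.forceCovector hΦ hV m from rfl,
        toReal_quadModular hγ (h.forceCovector hΦ hV m), real_inner_self_eq_norm_sq]
      linarith

end VlasovFokkerPlanck

/-! ### Velocity increments and tangent vectors given by collision fluxes -/

section Collisions

variable {d : ℕ} {ρ : Phase d → ℝ}

/-- The increments `ξ(q, p') - ξ(q, p)` of a cotangent vector, as a function of `(q, p, p')`. -/
def increment (ρ : Phase d → ℝ) : cotangent ρ →ₗ[ℝ] (Vec d × Vec d × Vec d → ℝ) where
  toFun ξ o := (ξ : Phase d → ℝ) (o.1, o.2.2) - (ξ : Phase d → ℝ) (o.1, o.2.1)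
  map_add' ξ ζ := by
    funext o
    simp only [Submodule.coe_add, Pi.add_apply]
    ring
  map_smul' c ξ := by
    funext o
    simp only [Submodule.coe_smul, Pi.smul_apply, smul_eq_mul, RingHom.id_apply]
    ring

lemma increment_apply (ξ : cotangent ρ) (o : Vec d × Vec d × Vec d) :
    increment ρ ξ o = (ξ : Phase d → ℝ) (o.1, o.2.2) - (ξ : Phase d → ℝ) (o.1, o.2.1) := rfl

lemma continuous_increment (ξ : cotangent ρ) : Continuous (increment ρ ξ) := by
  have := ξ.2.1.continuous
  simp only [increment, LinearMap.coe_mk, AddHom.coe_mk]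
  fun_prop

lemma setLIntegral_closedBall_translate_le (f : Phase d → ℝ≥0∞) {w : Phase d} {R S : ℝ}
    (hw : ‖w‖ ≤ S) :
    ∫⁻ x in Metric.closedBall 0 R, f (x + w) ≤ ∫⁻ x in Metric.closedBall 0 (R + S), f x := by
  rw [← lintegral_indicator Metric.isClosed_closedBall.measurableSet,
    ← lintegral_indicator Metric.isClosed_closedBall.measurableSet,
    ← lintegral_add_right_eq_self ((Metric.closedBall 0 (R + S)).indicator f) w]
  refine lintegral_mono fun x => ?_
  by_cases hx : x ∈ Metric.closedBall 0 R
  · have hx' : x + w ∈ Metric.closedBall 0 (R + S) := by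
      rw [mem_closedBall_zero_iff] at hx ⊢
      exact (norm_add_le _ _).trans (add_le_add hx hw)
    rw [Set.indicator_of_mem hx, Set.indicator_of_mem hx']
  · rw [Set.indicator_of_notMem hx]
    exact zero_le

/-- Mean increments over a ball are controlled by the mean of the gradient over a larger ball. -/
lemma setLIntegral_translate_sub_le {f : Phase d → ℝ} (hf : ContDiff ℝ 1 f) {h : Vec d} {R S : ℝ}
    (hh : ‖h‖ ≤ S) :
    ∫⁻ x in Metric.closedBall 0 R, ‖f (x + (0, h)) - f x‖ₑ ≤
      ENNReal.ofReal S * ∫⁻ x in Metric.closedBall 0 (R + S), ‖gradP f x‖ₑ := by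
  have hd := hf.differentiable one_ne_zero
  have hg := continuous_gradP hf
  have hgm := hg.measurable.enorm
  have hftc : ∀ x : Phase d, f (x + (0, h)) - f x =
      ∫ t in (0 : ℝ)..1, ⟪gradP f (x + t • ((0, h) : Phase d)), h⟫ := by
    intro x
    have h1 : ∀ t : ℝ, HasDerivAt (fun t : ℝ => f (x + t • ((0, h) : Phase d)))
        ⟪gradP f (x + t • ((0, h) : Phase d)), h⟫ t := by
      intro t
      rw [inner_gradP (hd _)]
      have h2 : HasDerivAt (fun t : ℝ => x + t • ((0, h) : Phase d)) (0, h) t := by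
        simpa using ((hasDerivAt_id t).smul_const ((0, h) : Phase d)).const_add x
      exact (hd _).hasFDerivAt.comp_hasDerivAt t h2
    rw [intervalIntegral.integral_eq_sub_of_hasDerivAt (fun t _ => h1 t)
      ((by fun_prop : Continuous fun t : ℝ =>
        ⟪gradP f (x + t • ((0, h) : Phase d)), h⟫).intervalIntegrable _ _)]
    simp
  have hpt : ∀ x : Phase d, ‖f (x + (0, h)) - f x‖ₑ ≤
      ∫⁻ t in Set.Ioc (0 : ℝ) 1, ENNReal.ofReal S * ‖gradP f (x + t • ((0, h) : Phase d))‖ₑ := by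
    intro x
    rw [hftc, intervalIntegral.integral_of_le zero_le_one]
    refine (enorm_integral_le_lintegral_enorm _).trans (lintegral_mono fun t => ?_)
    rw [← ofReal_norm, ← ofReal_norm,
      ← ENNReal.ofReal_mul ((norm_nonneg h).trans hh)]
    refine ENNReal.ofReal_le_ofReal ((norm_inner_le_norm _ _).trans ?_)
    rw [mul_comm]
    gcongr
  have hm : Measurable fun z : Phase d × ℝ =>
      ENNReal.ofReal S * ‖gradP f (z.1 + z.2 • ((0, h) : Phase d))‖ₑ :=
    ((by fun_prop : Continuous fun z : Phase d × ℝ =>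
      gradP f (z.1 + z.2 • ((0, h) : Phase d))).measurable.enorm).const_mul _
  calc ∫⁻ x in Metric.closedBall 0 R, ‖f (x + (0, h)) - f x‖ₑ
      ≤ ∫⁻ x in Metric.closedBall 0 R, ∫⁻ t in Set.Ioc (0 : ℝ) 1,
          ENNReal.ofReal S * ‖gradP f (x + t • ((0, h) : Phase d))‖ₑ := lintegral_mono hpt
    _ = ∫⁻ t in Set.Ioc (0 : ℝ) 1, ∫⁻ x in Metric.closedBall 0 R,
          ENNReal.ofReal S * ‖gradP f (x + t • ((0, h) : Phase d))‖ₑ :=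
        lintegral_lintegral_swap hm.aemeasurable
    _ ≤ ∫⁻ _ in Set.Ioc (0 : ℝ) 1,
          ENNReal.ofReal S * ∫⁻ x in Metric.closedBall 0 (R + S), ‖gradP f x‖ₑ := by
        refine setLIntegral_mono measurable_const fun t ht => ?_
        rw [lintegral_const_mul _ (by exact hgm.comp (measurable_id.add_const _))]
        refine mul_le_mul_right ?_ _
        refine setLIntegral_closedBall_translate_le (fun x => ‖gradP f x‖ₑ) ?_
        have h3 : ‖((0, h) : Phase d)‖ = ‖h‖ := by simp [Prod.norm_def]
        rw [norm_smul, h3, Real.norm_eq_abs, abs_of_pos ht.1]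
        exact (mul_le_of_le_one_left (norm_nonneg h) ht.2).trans hh
    _ = _ := by simp

lemma lintegral_enorm_gradP_le (hpr : IsProbabilityMeasure (law ρ)) (ξ : cotangent ρ) :
    ∫⁻ x, ‖gradP (ξ : Phase d → ℝ) x‖ₑ ∂(law ρ) ≤ ENNReal.ofReal (h1Norm ρ ξ) := by
  rw [← eLpNorm_one_eq_lintegral_enorm]
  refine (eLpNorm_le_eLpNorm_of_exponent_le (by norm_num : (1 : ℝ≥0∞) ≤ 2) ξ.2.2.2.1).trans ?_
  rw [← ENNReal.ofReal_toReal ξ.2.2.2.eLpNorm_ne_top, ← Lp.norm_toLp _ ξ.2.2.2]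
  exact ENNReal.ofReal_le_ofReal (norm_gradPL2_le ξ)

lemma exists_setLIntegral_enorm_gradP_le (hc : Continuous ρ) (hpos : ∀ x, 0 < ρ x)
    (hpr : IsProbabilityMeasure (law ρ)) (R : ℝ) : ∃ C : ℝ≥0, ∀ ξ : cotangent ρ,
      ∫⁻ x in Metric.closedBall 0 R, ‖gradP (ξ : Phase d → ℝ) x‖ₑ ≤
        C * ENNReal.ofReal (h1Norm ρ ξ) := by
  obtain ⟨K, hK⟩ := (isCompact_closedBall (0 : Phase d) R).exists_bound_of_continuousOn
    (f := fun x => (ρ x)⁻¹) (hc.inv₀ fun x => (hpos x).ne').continuousOn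
  refine ⟨K.toNNReal, fun ξ => ?_⟩
  have hm : Measurable fun x => ‖gradP (ξ : Phase d → ℝ) x‖ₑ :=
    (continuous_gradP ξ.2.1).measurable.enorm
  calc ∫⁻ x in Metric.closedBall 0 R, ‖gradP (ξ : Phase d → ℝ) x‖ₑ
      ≤ ∫⁻ x in Metric.closedBall 0 R,
          K.toNNReal * (ENNReal.ofReal (ρ x) * ‖gradP (ξ : Phase d → ℝ) x‖ₑ) := by
        refine setLIntegral_mono (by fun_prop) fun x hx => ?_
        have h1 := hK x hx
        rw [Real.norm_eq_abs, abs_of_pos (inv_pos.2 (hpos x))] at h1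
        have h2 : (1 : ℝ≥0∞) ≤ ENNReal.ofReal K * ENNReal.ofReal (ρ x) := by
          rw [← ENNReal.ofReal_mul ((inv_pos.2 (hpos x)).le.trans h1), ENNReal.one_le_ofReal]
          calc (1 : ℝ) = (ρ x)⁻¹ * ρ x := (inv_mul_cancel₀ (hpos x).ne').symm
            _ ≤ K * ρ x := by gcongr; exact (hpos x).le
        rw [← mul_assoc]
        exact le_mul_of_one_le_left zero_le h2
    _ ≤ ∫⁻ x, K.toNNReal * (ENNReal.ofReal (ρ x) * ‖gradP (ξ : Phase d → ℝ) x‖ₑ) :=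
        setLIntegral_le_lintegral _ _
    _ = K.toNNReal * ∫⁻ x, ‖gradP (ξ : Phase d → ℝ) x‖ₑ ∂(law ρ) := by
        rw [lintegral_const_mul _ (by fun_prop), law,
          lintegral_withDensity_eq_lintegral_mul _ hc.measurable.ennreal_ofReal hm]
        rfl
    _ ≤ _ := by
        gcongr
        exact lintegral_enorm_gradP_le hpr ξ

/-- Local increments are bounded by the seminorm of the cotangent space. After the substitution
`p' = p + h`, for each `h` the mean increment is bounded by the gradient on a larger ball, where `ρ`
is bounded from below. -/
lemma exists_setLIntegral_increment_le (hc : Continuous ρ) (hpos : ∀ x, 0 < ρ x)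
    (hpr : IsProbabilityMeasure (law ρ)) (R : ℝ) : ∃ C : ℝ≥0, ∀ ξ : cotangent ρ,
      ∫⁻ o in Metric.closedBall 0 R, ‖increment ρ ξ o‖ₑ ≤ C * ENNReal.ofReal (h1Norm ρ ξ) := by
  obtain ⟨C, hC⟩ := exists_setLIntegral_enorm_gradP_le hc hpos hpr (R + 2 * R)
  set B : Set (Vec d) := Metric.closedBall 0 (2 * R) with hB
  have hBv : volume B ≠ ⊤ := measure_closedBall_lt_top.ne
  refine ⟨(volume B).toNNReal * ((2 * R).toNNReal * C), fun ξ => ?_⟩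
  have hξ := ξ.2.1.continuous
  -- the increments in the variables `x = (q, p)` and `h = p' - p`, localised
  set G : Phase d → Vec d → ℝ≥0∞ := fun x h => (Metric.closedBall (0 : Phase d) R).indicator
    (fun x => B.indicator (fun h => ‖(ξ : Phase d → ℝ) (x + (0, h)) - (ξ : Phase d → ℝ) x‖ₑ) h) x
    with hG
  have hGm : Measurable (Function.uncurry G) := by
    have h1 : Measurable fun z : Phase d × Vec d =>
        ‖(ξ : Phase d → ℝ) (z.1 + (0, z.2)) - (ξ : Phase d → ℝ) z.1‖ₑ :=
      (by fun_prop : Continuous fun z : Phase d × Vec d =>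
        (ξ : Phase d → ℝ) (z.1 + (0, z.2)) - (ξ : Phase d → ℝ) z.1).measurable.enorm
    have h2 := h1.indicator ((Metric.isClosed_closedBall (x := (0 : Phase d))
      (ε := R)).measurableSet.prod (Metric.isClosed_closedBall (x := (0 : Vec d))
      (ε := 2 * R)).measurableSet)
    convert h2 using 1
    funext z
    by_cases h3 : z.1 ∈ Metric.closedBall (0 : Phase d) R
    · by_cases h4 : z.2 ∈ B
      · rw [Set.indicator_of_mem (Set.mk_mem_prod h3 h4)]
        simp only [hG, Function.uncurry, Set.indicator_of_mem h3, Set.indicator_of_mem h4]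
      · rw [Set.indicator_of_notMem fun h5 => h4 h5.2]
        simp only [hG, Function.uncurry, Set.indicator_of_mem h3, Set.indicator_of_notMem h4]
    · rw [Set.indicator_of_notMem fun h5 => h3 h5.1]
      simp only [hG, Function.uncurry, Set.indicator_of_notMem h3]
  have hF : Measurable ((Metric.closedBall (0 : Vec d × Vec d × Vec d) R).indicator
      fun o => ‖increment ρ ξ o‖ₑ) :=
    (continuous_increment ξ).measurable.enorm.indicator Metric.isClosed_closedBall.measurableSet
  calc ∫⁻ o in Metric.closedBall 0 R, ‖increment ρ ξ o‖ₑ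
      = ∫⁻ q : Vec d, ∫⁻ p : Vec d, ∫⁻ p' : Vec d,
          (Metric.closedBall (0 : Vec d × Vec d × Vec d) R).indicator
            (fun o => ‖increment ρ ξ o‖ₑ) (q, p, p') := by
        rw [← lintegral_indicator Metric.isClosed_closedBall.measurableSet, Measure.volume_eq_prod,
          lintegral_prod _ hF.aemeasurable]
        refine lintegral_congr fun q => ?_
        rw [Measure.volume_eq_prod, lintegral_prod _ (by fun_prop)]
    _ ≤ ∫⁻ q : Vec d, ∫⁻ p : Vec d, ∫⁻ h : Vec d, G (q, p) h := by
        refine lintegral_mono fun q => lintegral_mono fun p => ?_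
        rw [← lintegral_add_left_eq_self _ p]
        refine lintegral_mono fun h => ?_
        by_cases hx : (q, p, p + h) ∈ Metric.closedBall (0 : Vec d × Vec d × Vec d) R
        · rw [Set.indicator_of_mem hx]
          simp only [mem_closedBall_zero_iff, Prod.norm_def, max_le_iff] at hx
          have h1 : (q, p) ∈ Metric.closedBall (0 : Phase d) R := by
            simp only [mem_closedBall_zero_iff, Prod.norm_def, max_le_iff]
            exact ⟨hx.1, hx.2.1⟩
          have h2 : h ∈ B := by
            rw [hB, mem_closedBall_zero_iff]
            have := norm_sub_le (p + h) p
            rw [add_sub_cancel_left] at this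
            linarith [hx.2.1, hx.2.2]
          simp only [hG]
          rw [Set.indicator_of_mem h1, Set.indicator_of_mem h2, increment_apply]
          simp
        · rw [Set.indicator_of_notMem hx]
          exact zero_le
    _ = ∫⁻ x, ∫⁻ h : Vec d, G x h := by
        rw [Measure.volume_eq_prod (Vec d) (Vec d),
          lintegral_prod _ hGm.lintegral_prod_right.aemeasurable]
    _ = ∫⁻ h : Vec d, ∫⁻ x, G x h := lintegral_lintegral_swap hGm.aemeasurable
    _ ≤ ∫⁻ h : Vec d, B.indicator (fun _ => ENNReal.ofReal (2 * R) *
          ∫⁻ x in Metric.closedBall 0 (R + 2 * R), ‖gradP (ξ : Phase d → ℝ) x‖ₑ) h := by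
        refine lintegral_mono fun h => ?_
        simp only [hG]
        rw [lintegral_indicator Metric.isClosed_closedBall.measurableSet]
        by_cases hh : h ∈ B
        · simp only [Set.indicator_of_mem hh]
          exact setLIntegral_translate_sub_le ξ.2.1 (by rwa [hB, mem_closedBall_zero_iff] at hh)
        · simp [Set.indicator_of_notMem hh]
    _ = volume B * (ENNReal.ofReal (2 * R) *
          ∫⁻ x in Metric.closedBall 0 (R + 2 * R), ‖gradP (ξ : Phase d → ℝ) x‖ₑ) := by
        rw [lintegral_indicator Metric.isClosed_closedBall.measurableSet, setLIntegral_const,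
          mul_comm]
    _ ≤ volume B * (ENNReal.ofReal (2 * R) * (C * ENNReal.ofReal (h1Norm ρ ξ))) := by
        gcongr
        exact hC ξ
    _ = _ := by
        rw [ENNReal.coe_mul, ENNReal.coe_mul, ENNReal.coe_toNNReal hBv, mul_assoc, mul_assoc]
        rfl

/-- A continuous collision flux `θ`, restricted to a ball, is a tangent vector. -/
lemma exists_tangent_of_flux (hc : Continuous ρ) (hpos : ∀ x, 0 < ρ x)
    (hpr : IsProbabilityMeasure (law ρ)) {θ : Vec d × Vec d × Vec d → ℝ} (hθ : Continuous θ)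
    {R : ℝ} (hR : 0 ≤ R) : ∃ v : tangent ρ, ∀ ξ : cotangent ρ,
      v.1 ξ = ∫ o in Metric.closedBall 0 R, θ o * increment ρ ξ o := by
  have hint : ∀ ξ : cotangent ρ, IntegrableOn (fun o => θ o * increment ρ ξ o)
      (Metric.closedBall 0 R) := fun ξ =>
    (hθ.mul (continuous_increment ξ)).continuousOn.integrableOn_compact (isCompact_closedBall _ _)
  obtain ⟨C, hC⟩ := exists_setLIntegral_increment_le hc hpos hpr R
  obtain ⟨K, hK⟩ := (isCompact_closedBall (0 : Vec d × Vec d × Vec d)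
    R).exists_bound_of_continuousOn hθ.continuousOn
  have hK0 : 0 ≤ K := (norm_nonneg _).trans (hK 0 (Metric.mem_closedBall_self hR))
  refine ⟨⟨{ toFun := fun ξ => ∫ o in Metric.closedBall 0 R, θ o * increment ρ ξ o
             map_add' := fun ξ ζ => ?_
             map_smul' := fun c ξ => ?_ }, K * C, fun ξ => ?_⟩, fun ξ => rfl⟩
  · rw [← integral_add (hint ξ) (hint ζ)]
    simp only [map_add, Pi.add_apply, mul_add]
  · rw [RingHom.id_apply, smul_eq_mul, ← integral_const_mul]
    simp only [map_smul, Pi.smul_apply, smul_eq_mul]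
    refine integral_congr_ae (Filter.Eventually.of_forall fun o => ?_)
    ring
  · have h1 : ‖∫ o in Metric.closedBall 0 R, θ o * increment ρ ξ o‖ₑ ≤
        ENNReal.ofReal (K * C * h1Norm ρ ξ) := by
      refine (enorm_integral_le_lintegral_enorm _).trans ?_
      calc ∫⁻ o in Metric.closedBall 0 R, ‖θ o * increment ρ ξ o‖ₑ
          ≤ ∫⁻ o in Metric.closedBall 0 R, ENNReal.ofReal K * ‖increment ρ ξ o‖ₑ := by
            refine setLIntegral_mono
              ((continuous_increment ξ).measurable.enorm.const_mul _) fun o ho => ?_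
            rw [enorm_mul, ← ofReal_norm (θ o)]
            gcongr
            exact hK o ho
        _ ≤ ENNReal.ofReal K * (C * ENNReal.ofReal (h1Norm ρ ξ)) := by
            rw [lintegral_const_mul _ (continuous_increment ξ).measurable.enorm]
            gcongr
            exact hC ξ
        _ = _ := by
            rw [← ENNReal.ofReal_coe_nnreal, ← ENNReal.ofReal_mul C.coe_nonneg,
              ← ENNReal.ofReal_mul hK0, mul_assoc]
    rw [← ofReal_norm, Real.norm_eq_abs] at h1
    exact (ENNReal.ofReal_le_ofReal_iff (by have := h1Norm_nonneg (ρ := ρ) ξ; positivity)).1 h1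

end Collisions

/-! ### The collision rates of the Andersen thermostat -/

section Rates

variable {d : ℕ} {ρ : Phase d → ℝ} {m γ : ℝ}

/-- The symmetrised jump rate `γ √(M(p) M(p') ρ(q, p) ρ(q, p'))`, where `M` is the Maxwellian. -/
def collisionRate (m γ : ℝ) (ρ : Phase d → ℝ) (o : Vec d × Vec d × Vec d) : ℝ :=
  γ * ((2 * Real.pi * m) ^ (-(d : ℝ) / 2) *
    Real.exp (-(‖o.2.1‖ ^ 2 + ‖o.2.2‖ ^ 2) / (4 * m))) *
    Real.sqrt (ρ (o.1, o.2.2) * ρ (o.1, o.2.1))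

/-- The measure with density `collisionRate` on triples `(q, p, p')`. -/
def collisionMeasure (m γ : ℝ) (ρ : Phase d → ℝ) : Measure (Vec d × Vec d × Vec d) :=
  volume.withDensity fun o => ENNReal.ofReal (collisionRate m γ ρ o)

/-- The jump rate `ρ(q, p) M(p')` from `p` to `p'`. -/
def jumpRate (m : ℝ) (ρ : Phase d → ℝ) (o : Vec d × Vec d × Vec d) : ℝ :=
  ρ (o.1, o.2.1) * maxwell m o.2.2

/-- The exchange of the momenta before and after a jump. -/
def swapMomenta (d : ℕ) : Vec d × Vec d × Vec d ≃ᵐ Vec d × Vec d × Vec d :=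
  MeasurableEquiv.prodCongr (MeasurableEquiv.refl _) MeasurableEquiv.prodComm

lemma swapMomenta_apply (o : Vec d × Vec d × Vec d) :
    swapMomenta d o = (o.1, o.2.2, o.2.1) := rfl

lemma measurePreserving_swapMomenta : MeasurePreserving (swapMomenta d) volume volume :=
  (MeasurePreserving.id (volume : Measure (Vec d))).prod
    (Measure.measurePreserving_swap (μ := (volume : Measure (Vec d)))
      (ν := (volume : Measure (Vec d))))

lemma measurePreserving_assoc : MeasurePreserving
    (MeasurableEquiv.prodAssoc : (Vec d × Vec d) × Vec d ≃ᵐ Vec d × Vec d × Vec d) volume volume :=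
  measurePreserving_prodAssoc volume volume volume

lemma integrable_maxwell (hm : 0 < m) : Integrable (maxwell m : Vec d → ℝ) := by
  have hb : 0 < 1 / (2 * m) := by positivity
  have h1 : Integrable fun p : Vec d => Real.exp (-(1 / (2 * m)) * ‖p‖ ^ 2) := by
    refine Integrable.of_integral_ne_zero ?_
    rw [GaussianFourier.integral_rexp_neg_mul_sq_norm hb]
    positivity
  refine (h1.const_mul ((2 * Real.pi * m) ^ (-(d : ℝ) / 2))).congr
    (Filter.Eventually.of_forall fun p => ?_)
  simp only [maxwell]
  congr 2
  ring

lemma integrable_jumpRate (hm : 0 < m) (hρ : Integrable ρ) : Integrable (jumpRate m ρ) :=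
  (measurePreserving_assoc.integrable_comp_emb MeasurableEquiv.prodAssoc.measurableEmbedding).1
    (hρ.mul_prod (integrable_maxwell hm))

lemma integrable_jumpRate_swap (hm : 0 < m) (hρ : Integrable ρ) :
    Integrable fun o => jumpRate m ρ (swapMomenta d o) :=
  (measurePreserving_swapMomenta.integrable_comp_emb (swapMomenta d).measurableEmbedding).2
    (integrable_jumpRate hm hρ)

lemma integral_momenta {F : Vec d × Vec d × Vec d → ℝ} (hF : Integrable F) :
    ∫ o, F o = ∫ x : Phase d, ∫ p' : Vec d, F (x.1, x.2, p') := by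
  rw [← measurePreserving_assoc.integral_comp']
  exact integral_prod _
    ((measurePreserving_assoc.integrable_comp_emb
      MeasurableEquiv.prodAssoc.measurableEmbedding).2 hF)

lemma continuous_collisionRate (hρ : Continuous ρ) : Continuous (collisionRate m γ ρ) := by
  unfold collisionRate
  fun_prop

lemma collisionRate_pos (hm : 0 < m) (hγ : 0 < γ) (hpos : ∀ x, 0 < ρ x)
    (o : Vec d × Vec d × Vec d) : 0 < collisionRate m γ ρ o := by
  have := mul_pos (hpos (o.1, o.2.2)) (hpos (o.1, o.2.1))
  unfold collisionRate
  positivity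

lemma integrable_collisionMeasure_iff (hρ : Continuous ρ) (h0 : ∀ o, 0 < collisionRate m γ ρ o)
    {g : Vec d × Vec d × Vec d → ℝ} : Integrable g (collisionMeasure m γ ρ) ↔
      Integrable fun o => collisionRate m γ ρ o * g o := by
  rw [collisionMeasure, integrable_withDensity_iff_integrable_smul₀'
    (continuous_collisionRate hρ).measurable.ennreal_ofReal.aemeasurable
    (Filter.Eventually.of_forall fun _ => ENNReal.ofReal_lt_top)]
  simp only [ENNReal.toReal_ofReal (h0 _).le, smul_eq_mul]

lemma integral_collisionMeasure (hρ : Continuous ρ) (h0 : ∀ o, 0 < collisionRate m γ ρ o)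
    (g : Vec d × Vec d × Vec d → ℝ) :
    ∫ o, g o ∂(collisionMeasure m γ ρ) = ∫ o, collisionRate m γ ρ o * g o := by
  rw [collisionMeasure, integral_withDensity_eq_integral_toReal_smul
    (continuous_collisionRate hρ).measurable.ennreal_ofReal
    (Filter.Eventually.of_forall fun _ => ENNReal.ofReal_lt_top)]
  simp only [ENNReal.toReal_ofReal (h0 _).le, smul_eq_mul]

lemma measurable_increment (ξ : cotangent ρ) : Measurable (increment ρ ξ) :=
  (continuous_increment ξ).measurable

lemma psiStarAT_eq (hρ : Continuous ρ) (h0 : ∀ o, 0 < collisionRate m γ ρ o) :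
    psiStarAT m γ ρ = coshModular (collisionMeasure m γ ρ) (increment ρ) := by
  funext ξ
  have h1 : Measurable fun o => ENNReal.ofReal (Real.cosh (increment ρ ξ o) - 1) :=
    (measurable_cosh_sub_one measurable_increment ξ).ennreal_ofReal
  have h2 := (continuous_collisionRate (m := m) (γ := γ) hρ).measurable.ennreal_ofReal
  have h3 := h2.mul h1
  rw [coshModular, collisionMeasure, lintegral_withDensity_eq_lintegral_mul _ h2 h1,
    Measure.volume_eq_prod, lintegral_prod _ h3.aemeasurable, psiStarAT]
  refine lintegral_congr fun q => ?_
  rw [Measure.volume_eq_prod,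
    lintegral_prod _ (by exact (h3.comp measurable_prodMk_left).aemeasurable)]
  refine lintegral_congr fun p => lintegral_congr fun p' => ?_
  simp only [Pi.mul_apply]
  rw [← ENNReal.ofReal_mul (h0 _).le, increment_apply]
  congr 1
  simp only [collisionRate]
  ring

end Rates

section Force

variable {d : ℕ} {V Φ : Vec d → ℝ} {ρ : Phase d → ℝ} {m γ : ℝ}

lemma increment_swapMomenta (ξ : cotangent ρ) (o : Vec d × Vec d × Vec d) :
    increment ρ ξ (swapMomenta d o) = -increment ρ ξ o := by
  rw [increment_apply, increment_apply, swapMomenta_apply, neg_sub]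

lemma collisionRate_swapMomenta (o : Vec d × Vec d × Vec d) :
    collisionRate m γ ρ (swapMomenta d o) = collisionRate m γ ρ o := by
  simp only [collisionRate, swapMomenta_apply, mul_comm (ρ (o.1, o.2.1)),
    add_comm (‖o.2.2‖ ^ 2)]

/-- The generator of the Andersen thermostat in weak form, symmetrised in the two momenta. -/
lemma adjointGen_genAT (hm : 0 < m) (hρ : Integrable ρ) {φ : cotangent ρ} {K : ℝ}
    (hK : ∀ o, |increment ρ φ o| ≤ K) : adjointGen (genAT m γ) ρ φ =
      ∫ o, γ / 2 * (jumpRate m ρ o - jumpRate m ρ (swapMomenta d o)) * increment ρ φ o := by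
  have hD := (continuous_increment φ).aestronglyMeasurable (μ := volume)
  have hb : ∀ᵐ o : Vec d × Vec d × Vec d, ‖increment ρ φ o‖ ≤ K := Filter.Eventually.of_forall hK
  have i1 : Integrable fun o => jumpRate m ρ o * increment ρ φ o :=
    (integrable_jumpRate hm hρ).mul_bdd hD hb
  have i2 : Integrable fun o => jumpRate m ρ (swapMomenta d o) * increment ρ φ o :=
    (integrable_jumpRate_swap hm hρ).mul_bdd hD hb
  have h1 : adjointGen (genAT m γ) ρ φ = γ * ∫ o, jumpRate m ρ o * increment ρ φ o := by
    rw [integral_momenta i1, ← integral_const_mul]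
    refine integral_congr_ae (Filter.Eventually.of_forall fun x => ?_)
    simp only [genAT]
    rw [mul_assoc, ← integral_mul_const]
    congr 1
    refine integral_congr_ae (Filter.Eventually.of_forall fun p' => ?_)
    simp only [jumpRate, increment_apply]
    ring
  have h2 : ∫ o, jumpRate m ρ (swapMomenta d o) * increment ρ φ o =
      -∫ o, jumpRate m ρ o * increment ρ φ o := by
    rw [← integral_neg, ← measurePreserving_swapMomenta.integral_comp'
      (g := fun o => -(jumpRate m ρ o * increment ρ φ o))]
    refine integral_congr_ae (Filter.Eventually.of_forall fun o => ?_)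
    simp only [increment_swapMomenta]
    ring
  simp only [mul_assoc, sub_mul]
  rw [integral_const_mul, integral_sub i1 i2, h2, h1]
  ring

namespace IsRegularState

variable (h : IsRegularState V Φ ρ) (hΦ : ContDiff ℝ 1 Φ) (hV : ContDiff ℝ 1 V)

include h

/-- Along the force, the symmetrised rates are those of the actual jumps. -/
lemma collisionRate_mul_exp (hm : 0 < m) (o : Vec d × Vec d × Vec d) :
    collisionRate m γ ρ o * Real.exp (increment ρ (h.forceCovector hΦ hV m) o) =
      γ * jumpRate m ρ o := by
  obtain ⟨q, p, p'⟩ := o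
  have hinc : increment ρ (h.forceCovector hΦ hV m) (q, p, p') =
      -(1 / 2) * (Real.log (ρ (q, p')) + ‖p'‖ ^ 2 / (2 * m) -
        (Real.log (ρ (q, p)) + ‖p‖ ^ 2 / (2 * m))) := by
    rw [increment_apply]
    simp only [forceCovector, entropyCovector, dEntropy, dEnergy, Submodule.coe_neg,
      Submodule.coe_smul, Pi.neg_apply, Pi.smul_apply, smul_eq_mul]
    ring
  have hsqrt : Real.sqrt (ρ (q, p') * ρ (q, p)) =
      Real.exp ((Real.log (ρ (q, p')) + Real.log (ρ (q, p))) / 2) := by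
    rw [Real.exp_half, Real.exp_add, Real.exp_log (h.pos _), Real.exp_log (h.pos _)]
  have hlog : ρ (q, p) = Real.exp (Real.log (ρ (q, p))) := (Real.exp_log (h.pos _)).symm
  simp only [collisionRate, jumpRate, maxwell]
  rw [hinc, hsqrt]
  nth_rewrite 3 [hlog]
  rw [mul_assoc, mul_assoc, mul_left_comm (Real.exp _) (_ ^ _), mul_assoc, ← Real.exp_add,
    ← Real.exp_add, ← Real.exp_add]
  congr 3
  field_simp
  ring

lemma collisionRate_mul_exp_neg (hm : 0 < m) (o : Vec d × Vec d × Vec d) :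
    collisionRate m γ ρ o * Real.exp (-increment ρ (h.forceCovector hΦ hV m) o) =
      γ * jumpRate m ρ (swapMomenta d o) := by
  rw [← h.collisionRate_mul_exp hΦ hV hm, increment_swapMomenta, collisionRate_swapMomenta]

lemma collisionRate_mul_sinh (hm : 0 < m) (o : Vec d × Vec d × Vec d) :
    collisionRate m γ ρ o * Real.sinh (increment ρ (h.forceCovector hΦ hV m) o) =
      γ / 2 * (jumpRate m ρ o - jumpRate m ρ (swapMomenta d o)) := by
  have h1 := h.collisionRate_mul_exp (γ := γ) hΦ hV hm o
  have h2 := h.collisionRate_mul_exp_neg (γ := γ) hΦ hV hm o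
  rw [Real.sinh_eq]
  linear_combination (1 / 2) * h1 - (1 / 2) * h2

lemma collisionRate_mul_cosh (hm : 0 < m) (o : Vec d × Vec d × Vec d) :
    collisionRate m γ ρ o * Real.cosh (increment ρ (h.forceCovector hΦ hV m) o) =
      γ / 2 * (jumpRate m ρ o + jumpRate m ρ (swapMomenta d o)) := by
  have h1 := h.collisionRate_mul_exp (γ := γ) hΦ hV hm o
  have h2 := h.collisionRate_mul_exp_neg (γ := γ) hΦ hV hm o
  rw [Real.cosh_eq]
  linear_combination (1 / 2) * h1 + (1 / 2) * h2

lemma integrable_cosh_force (hm : 0 < m) (hγ : 0 < γ) :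
    Integrable (fun o => Real.cosh (increment ρ (h.forceCovector hΦ hV m) o))
      (collisionMeasure m γ ρ) := by
  rw [integrable_collisionMeasure_iff h.contDiff.continuous (collisionRate_pos hm hγ h.pos)]
  simp only [h.collisionRate_mul_cosh hΦ hV hm]
  exact ((integrable_jumpRate hm h.integrable).add
    (integrable_jumpRate_swap hm h.integrable)).const_mul _

lemma isFiniteMeasure_collisionMeasure (hΦ : ContDiff ℝ 1 Φ) (hV : ContDiff ℝ 1 V)
    (hm : 0 < m) (hγ : 0 < γ) : IsFiniteMeasure (collisionMeasure m γ ρ) := by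
  have h1 : Integrable (fun _ => (1 : ℝ)) (collisionMeasure m γ ρ) :=
    (h.integrable_cosh_force hΦ hV hm hγ).mono' aestronglyMeasurable_const
      (Filter.Eventually.of_forall fun o => by rw [norm_one]; exact Real.one_le_cosh _)
  exact (integrable_const_iff_isFiniteMeasure one_ne_zero).1 h1

lemma integrable_sinh_force (hm : 0 < m) (hγ : 0 < γ) :
    Integrable (fun o => Real.sinh (increment ρ (h.forceCovector hΦ hV m) o))
      (collisionMeasure m γ ρ) := by
  refine (h.integrable_cosh_force hΦ hV hm hγ).mono'
    (Real.measurable_sinh.comp (measurable_increment _)).aestronglyMeasurable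
    (Filter.Eventually.of_forall fun o => ?_)
  rw [Real.norm_eq_abs, Real.abs_sinh]
  rw [← Real.cosh_abs]
  exact (Real.sinh_lt_cosh _).le

/-- The Andersen thermostat in weak form: its flux is `sinh` of the increments of the force. -/
lemma adjointGen_eq_integral_sinh (hm : 0 < m) (hγ : 0 < γ) {φ : cotangent ρ} {K : ℝ}
    (hK : ∀ o, |increment ρ φ o| ≤ K) : adjointGen (genAT m γ) ρ φ =
      ∫ o, Real.sinh (increment ρ (h.forceCovector hΦ hV m) o) * increment ρ φ o
        ∂(collisionMeasure m γ ρ) := by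
  rw [adjointGen_genAT hm h.integrable hK,
    integral_collisionMeasure h.contDiff.continuous (collisionRate_pos hm hγ h.pos)]
  simp only [← mul_assoc, h.collisionRate_mul_sinh hΦ hV hm]

end IsRegularState

end Force

/-! ### The Andersen thermostat -/

section Andersen

/-- The graph of `cosh` lies above its tangents. -/
lemma cosh_add_sinh_mul_sub_le (a b : ℝ) :
    Real.cosh a + Real.sinh a * (b - a) ≤ Real.cosh b := by
  have h1 := mul_le_mul_of_nonneg_left (Real.add_one_le_exp (b - a)) (Real.exp_pos a).le
  have h2 := mul_le_mul_of_nonneg_left (Real.add_one_le_exp (-b - -a)) (Real.exp_pos (-a)).le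
  rw [← Real.exp_add, add_sub_cancel] at h1 h2
  rw [Real.cosh_eq, Real.cosh_eq, Real.sinh_eq]
  linarith

lemma sinh_mul_nonneg {a b : ℝ} (h1 : 0 ≤ a → 0 ≤ b) (h2 : a ≤ 0 → b ≤ 0) :
    0 ≤ Real.sinh a * b := by
  rcases le_total 0 a with h | h
  · exact mul_nonneg (Real.sinh_nonneg_iff.2 h) (h1 h)
  · exact mul_nonneg_of_nonpos_of_nonpos (Real.sinh_nonpos_iff.2 h) (h2 h)

variable {d : ℕ} {V Φ : Vec d → ℝ} {ρ : Phase d → ℝ} {m γ : ℝ}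

lemma abs_increment_le {ξ : cotangent ρ} {K : ℝ} (hK : ∀ x, |(ξ : Phase d → ℝ) x| ≤ K)
    (o : Vec d × Vec d × Vec d) : |increment ρ ξ o| ≤ 2 * K := by
  rw [increment_apply]
  refine (abs_sub _ _).trans ?_
  linarith [hK (o.1, o.2.2), hK (o.1, o.2.1)]

lemma abs_increment_trunc_le (n : ℕ) (ξ : cotangent ρ) (o : Vec d × Vec d × Vec d) :
    |increment ρ (cotangentTrunc n ξ) o| ≤ |increment ρ ξ o| :=
  abs_trunc_sub_le n _ _

lemma tendsto_increment_trunc (ξ : cotangent ρ) (o : Vec d × Vec d × Vec d) :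
    Filter.Tendsto (fun n => increment ρ (cotangentTrunc n ξ) o) Filter.atTop
      (nhds (increment ρ ξ o)) :=
  (tendsto_trunc _).sub (tendsto_trunc _)

lemma cotangentTrunc_mem_boundedCore (n : ℕ) (ξ : cotangent ρ) :
    cotangentTrunc n ξ ∈ boundedCore (increment ρ) :=
  ⟨_, abs_increment_le fun _ => abs_trunc_le n _⟩

namespace IsRegularState

variable (h : IsRegularState V Φ ρ)

include h

lemma isProbabilityMeasure_law : IsProbabilityMeasure (law ρ) := by
  refine ⟨?_⟩
  rw [law, withDensity_apply _ MeasurableSet.univ, Measure.restrict_univ,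
    ← ofReal_integral_eq_lintegral_ofReal h.integrable
      (Filter.Eventually.of_forall fun x => (h.pos x).le), h.integral_eq_one, ENNReal.ofReal_one]

/-- Truncations approximate every cotangent vector of finite dissipation. -/
lemma isUniformModular_collision (hΦ : ContDiff ℝ 1 Φ) (hV : ContDiff ℝ 1 V) (hm : 0 < m)
    (hγ : 0 < γ) : IsUniformModular (tangent ρ)
      (coshModular (collisionMeasure m γ ρ) (increment ρ)) (boundedCore (increment ρ)) := by
  have := h.isFiniteMeasure_collisionMeasure hΦ hV hm hγ
  have := isFiniteMeasure_law h.integrable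
  refine isUniformModular_coshModular measurable_increment fun v ξ hξ ε hε => ?_
  obtain ⟨n, hn⟩ := (Metric.tendsto_atTop.1 (tendsto_tangent_trunc v ξ) ε hε).imp
    fun n hn => hn n le_rfl
  refine ⟨cotangentTrunc n ξ, cotangentTrunc_mem_boundedCore n ξ, hn.le, ?_⟩
  rw [toReal_coshModular measurable_increment, toReal_coshModular measurable_increment]
  refine (integral_mono (integrable_cosh_of_mem_boundedCore measurable_increment
    (cotangentTrunc_mem_boundedCore n ξ))
    ((coshModular_ne_top_iff measurable_increment ξ).1 hξ) fun o => ?_).trans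
    (le_add_of_nonneg_right hε.le)
  exact sub_le_sub_right (Real.cosh_le_cosh.2 (abs_increment_trunc_le n ξ o)) 1

/-- The potential is the supremum of its affine minorants. These are the tangents at `ξ` in the
Young inequality, with the flux `sinh (ξ(q, p') - ξ(q, p))` cut off outside of a ball, so that it
defines a tangent vector. -/
lemma isSymmDissipationPair_collision (hΦ : ContDiff ℝ 1 Φ) (hV : ContDiff ℝ 1 V) (hm : 0 < m)
    (hγ : 0 < γ) : IsSymmDissipationPair (tangent ρ)
      (legendre (tangent ρ) (coshModular (collisionMeasure m γ ρ) (increment ρ)))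
      (coshModular (collisionMeasure m γ ρ) (increment ρ)) := by
  have := h.isFiniteMeasure_collisionMeasure hΦ hV hm hγ
  have hρ := h.contDiff.continuous
  refine (h.isUniformModular_collision hΦ hV hm hγ).isSymmDissipationPair
    (lineC1_coshModular measurable_increment) fun ξ r hr => ?_
  set μ := collisionMeasure m γ ρ with hμ
  set a := collisionRate m γ ρ with ha
  have ha0 : ∀ o, 0 < a o := collisionRate_pos hm hγ h.pos
  have hac : Continuous a := continuous_collisionRate hρ
  have hcc : ∀ ζ : cotangent ρ, Continuous fun o => Real.cosh (increment ρ ζ o) - 1 := fun ζ =>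
    (Real.continuous_cosh.comp (continuous_increment ζ)).sub continuous_const
  have hsc : Continuous fun o => Real.sinh (increment ρ ξ o) :=
    Real.continuous_sinh.comp (continuous_increment ξ)
  -- a large ball already carries more than `r`
  obtain ⟨n, hn⟩ : ∃ n : ℕ, (r : ℝ≥0∞) <
      ∫⁻ o in Metric.closedBall 0 (n : ℝ), ENNReal.ofReal (Real.cosh (increment ρ ξ o) - 1) ∂μ := by
    rw [coshModular, ← setLIntegral_univ, ← Metric.iUnion_closedBall_nat 0,
      setLIntegral_iUnion_of_directed _ (Monotone.directed_le fun i j hij =>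
        Metric.closedBall_subset_closedBall (by exact_mod_cast hij)), lt_iSup_iff] at hr
    exact hr
  set B : Set (Vec d × Vec d × Vec d) := Metric.closedBall 0 (n : ℝ) with hB
  have hBm : MeasurableSet B := Metric.isClosed_closedBall.measurableSet
  have hint : ∀ {f : Vec d × Vec d × Vec d → ℝ}, Continuous f → IntegrableOn f B := fun hf =>
    hf.continuousOn.integrableOn_compact (isCompact_closedBall _ _)
  have hcosh0 : ∀ (ζ : cotangent ρ) o, 0 ≤ a o * (Real.cosh (increment ρ ζ o) - 1) := fun ζ o =>
    mul_nonneg (ha0 o).le (sub_nonneg.2 (Real.one_le_cosh _))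
  have i2 : ∀ ζ : cotangent ρ, IntegrableOn
      (fun o => a o * (Real.cosh (increment ρ ζ o) - 1)) B := fun ζ => hint (hac.mul (hcc ζ))
  have hr' : (r : ℝ) ≤ ∫ o in B, a o * (Real.cosh (increment ρ ξ o) - 1) := by
    rw [hμ, collisionMeasure, setLIntegral_withDensity_eq_setLIntegral_mul _
      hac.measurable.ennreal_ofReal (hcc ξ).measurable.ennreal_ofReal hBm] at hn
    rw [← ENNReal.ofReal_le_ofReal_iff (integral_nonneg fun o => hcosh0 ξ o),
      ofReal_integral_eq_lintegral_ofReal (i2 ξ)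
        (Filter.Eventually.of_forall fun o => hcosh0 ξ o), ENNReal.ofReal_coe_nnreal]
    refine hn.le.trans_eq (lintegral_congr fun o => ?_)
    exact (ENNReal.ofReal_mul (ha0 o).le).symm
  obtain ⟨v, hv⟩ := exists_tangent_of_flux hρ h.pos h.isProbabilityMeasure_law
    (θ := fun o => a o * Real.sinh (increment ρ ξ o)) (hac.mul hsc) (Nat.cast_nonneg n)
  have i1 : ∀ ζ : cotangent ρ, IntegrableOn
      (fun o => a o * Real.sinh (increment ρ ξ o) * increment ρ ζ o) B := fun ζ =>
    hint ((hac.mul hsc).mul (continuous_increment ζ))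
  refine ⟨v, ∫ o in B, (a o * Real.sinh (increment ρ ξ o) * increment ρ ξ o -
    a o * (Real.cosh (increment ρ ξ o) - 1)), fun ζ hζ => ?_, ?_⟩
  · have h1 : ∫ o in B, a o * (Real.cosh (increment ρ ζ o) - 1) ≤
        (coshModular μ (increment ρ) ζ).toReal := by
      have h2 := (coshModular_ne_top_iff measurable_increment ζ).1 hζ
      rw [hμ, integrable_collisionMeasure_iff hρ ha0] at h2
      rw [toReal_coshModular measurable_increment, hμ, integral_collisionMeasure hρ ha0]
      exact setIntegral_le_integral h2 (Filter.Eventually.of_forall (hcosh0 ζ))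
    rw [hv]
    have i3 : IntegrableOn (fun o => a o * Real.sinh (increment ρ ξ o) * increment ρ ξ o -
        a o * (Real.cosh (increment ρ ξ o) - 1)) B := (i1 ξ).sub (i2 ξ)
    refine le_trans ?_ (add_le_add_left h1 _)
    rw [← integral_add (i2 ζ) i3]
    refine setIntegral_mono (i1 ζ)
      ((i2 ζ).add i3) fun o => ?_
    have h3 := mul_le_mul_of_nonneg_left
      (cosh_add_sinh_mul_sub_le (increment ρ ξ o) (increment ρ ζ o)) (ha0 o).le
    simp only
    linarith
  · rw [hv, integral_sub (i1 ξ) (i2 ξ)]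
    linarith

section Flux

variable (hΦ : ContDiff ℝ 1 Φ) (hV : ContDiff ℝ 1 V) (hm : 0 < m) (hγ : 0 < γ) {v : tangent ρ}
  (hv : Represents v (adjointGen (genAT m γ) ρ))

include hm hγ hv

/-- The flux representation passes from test functions to bounded cotangent vectors, by
approximation. -/
lemma apply_eq_integral_of_bounded {ξ : cotangent ρ} {K : ℝ}
    (hK : ∀ x, |(ξ : Phase d → ℝ) x| ≤ K) : v.1 ξ =
      ∫ o, Real.sinh (increment ρ (h.forceCovector hΦ hV m) o) * increment ρ ξ o
        ∂(collisionMeasure m γ ρ) := by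
  have := isFiniteMeasure_law h.integrable
  obtain ⟨φ, hφ, hφK, hφx, hφv⟩ := exists_test_approx ξ hK
  refine tendsto_nhds_unique (hφv v) ?_
  simp only [hv _ (hφ _),
    h.adjointGen_eq_integral_sinh hΦ hV hm hγ (abs_increment_le (hφK _))]
  have hs := h.integrable_sinh_force hΦ hV hm hγ
  refine tendsto_integral_of_dominated_convergence _ (fun n => ?_)
    (hs.norm.mul_const (2 * (K + 1))) (fun n => Filter.Eventually.of_forall fun o => ?_)
    (Filter.Eventually.of_forall fun o => ?_)
  · exact hs.1.mul (continuous_increment _).aestronglyMeasurable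
  · rw [norm_mul]
    gcongr
    exact abs_increment_le (hφK n) o
  · exact ((hφx _).sub (hφx _)).const_mul _

/-- The flux of the Andersen thermostat represents its velocity on all cotangent vectors for which
the integral converges absolutely, by truncation: truncated increments are smaller than the original
ones. -/
lemma apply_eq_integral {ξ : cotangent ρ}
    (hξ : Integrable (fun o => Real.sinh (increment ρ (h.forceCovector hΦ hV m) o) *
      increment ρ ξ o) (collisionMeasure m γ ρ)) : v.1 ξ =
      ∫ o, Real.sinh (increment ρ (h.forceCovector hΦ hV m) o) * increment ρ ξ o
        ∂(collisionMeasure m γ ρ) := by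
  have := isFiniteMeasure_law h.integrable
  refine tendsto_nhds_unique (tendsto_tangent_trunc v ξ) ?_
  refine (Filter.tendsto_congr fun n => h.apply_eq_integral_of_bounded hΦ hV hm hγ hv
    fun x => abs_trunc_le n _).2 ?_
  refine tendsto_integral_of_dominated_convergence _ (fun n => ?_) hξ.norm
    (fun n => Filter.Eventually.of_forall fun o => ?_) (Filter.Eventually.of_forall fun o => ?_)
  · exact (h.integrable_sinh_force hΦ hV hm hγ).1.mul
      (continuous_increment _).aestronglyMeasurable
  · rw [norm_mul, norm_mul]
    gcongr
    exact abs_increment_trunc_le n ξ o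
  · exact (tendsto_increment_trunc ξ o).const_mul _

/-- The entropy production is finite: as the velocity is a tangent vector, the entropy production
of the truncated force stays bounded, and Fatou's lemma applies since truncation is monotone. -/
lemma integrable_sinh_mul_force :
    Integrable (fun o => Real.sinh (increment ρ (h.forceCovector hΦ hV m) o) *
      increment ρ (h.forceCovector hΦ hV m) o) (collisionMeasure m γ ρ) := by
  have := isFiniteMeasure_law h.integrable
  have := h.isFiniteMeasure_collisionMeasure hΦ hV hm hγ
  set η := h.forceCovector hΦ hV m
  have hs := h.integrable_sinh_force hΦ hV hm hγ
  set F : ℕ → Vec d × Vec d × Vec d → ℝ := fun n o =>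
    Real.sinh (increment ρ η o) * increment ρ (cotangentTrunc n η) o with hF
  have hFm : ∀ n, Continuous (F n) := fun n =>
    (Real.continuous_sinh.comp (continuous_increment η)).mul (continuous_increment _)
  have hF0 : ∀ n o, 0 ≤ F n o := by
    intro n o
    refine sinh_mul_nonneg (fun h0 => ?_) fun h0 => ?_
    · exact sub_nonneg.2 (monotone_trunc n (sub_nonneg.1 h0))
    · exact sub_nonpos.2 (monotone_trunc n (sub_nonpos.1 h0))
  have hFi : ∀ n, Integrable (F n) (collisionMeasure m γ ρ) := fun n =>
    hs.mul_bdd (continuous_increment _).aestronglyMeasurable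
      (Filter.Eventually.of_forall (cotangentTrunc_mem_boundedCore n η).choose_spec)
  have hFv : ∀ n, ∫⁻ o, ‖F n o‖ₑ ∂(collisionMeasure m γ ρ) =
      ENNReal.ofReal (v.1 (cotangentTrunc n η)) := by
    intro n
    rw [h.apply_eq_integral_of_bounded hΦ hV hm hγ hv (fun x => abs_trunc_le n _),
      ofReal_integral_eq_lintegral_ofReal (hFi n) (Filter.Eventually.of_forall (hF0 n))]
    exact lintegral_congr fun o => Real.enorm_of_nonneg (hF0 n o)
  have hFt : ∀ o, Filter.Tendsto (fun n => F n o) Filter.atTop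
      (nhds (Real.sinh (increment ρ η o) * increment ρ η o)) := fun o =>
    (tendsto_increment_trunc η o).const_mul _
  refine ⟨((Real.continuous_sinh.comp (continuous_increment η)).mul
    (continuous_increment η)).aestronglyMeasurable, ?_⟩
  have h1 : Filter.Tendsto (fun n => ∫⁻ o, ‖F n o‖ₑ ∂(collisionMeasure m γ ρ)) Filter.atTop
      (nhds (ENNReal.ofReal (v.1 η))) := by
    simp only [hFv]
    exact ENNReal.tendsto_ofReal (tendsto_tangent_trunc v η)
  have h2 := lintegral_liminf_le (μ := collisionMeasure m γ ρ) (u := Filter.atTop)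
    fun n => (hFm n).measurable.enorm
  rw [h1.liminf_eq] at h2
  refine lt_of_le_of_lt ?_ (h2.trans_lt ENNReal.ofReal_lt_top)
  exact (lintegral_congr fun o => ((hFt o).enorm.liminf_eq).symm).le

end Flux

end IsRegularState

/-- The velocity of the thermostat is the flux `sinh` of the increments of `-dS / 2`, that is, the
derivative of the potential there. Hence equality holds in the Young inequality at `-dS / 2`. -/
theorem isPreGeneric_andersen (hV : ContDiff ℝ 1 V) (hΦ : ContDiff ℝ 1 Φ)
    (hs : ∀ q, Φ (-q) = Φ q) (hm : 0 < m) (hγ : 0 < γ) :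
    IsPreGeneric (tangentialStates V Φ (dynamics m V Φ (genAT m γ))) (entropy m V Φ)
      (fun ρ => legendre (tangent ρ) (psiStarAT m γ ρ)) (psiStarAT m γ)
      (hamField m V Φ) (dynamics m V Φ (genAT m γ)) := by
  rintro ρ ⟨h, f, hf⟩
  have := h.isFiniteMeasure_collisionMeasure hΦ hV hm hγ
  refine ⟨h.entropyCovector hΦ hV m, h.hamTangent hΦ hV m, f,
    fun σ hσ _ => h.entropy_functionalDeriv hΦ hs hV m hσ, h.represents_hamTangent hΦ hV m,
    hf, ?_⟩
  beta_reduce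
  rw [psiStarAT_eq h.contDiff.continuous (collisionRate_pos hm hγ h.pos)]
  have hv : Represents (f - h.hamTangent hΦ hV m) (adjointGen (genAT m γ) ρ) := by
    intro φ hφ
    have h1 : (f - h.hamTangent hΦ hV m).1 φ = f.1 φ - (h.hamTangent hΦ hV m).1 φ := rfl
    rw [h1, hf φ hφ, h.represents_hamTangent hΦ hV m φ hφ, h.dynamics_eq hΦ hV,
      add_sub_cancel_left]
  set η := h.forceCovector hΦ hV m with hη
  have hcη : Integrable (fun o => Real.cosh (increment ρ η o) - 1) (collisionMeasure m γ ρ) :=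
    (h.integrable_cosh_force hΦ hV hm hγ).sub (integrable_const 1)
  have hsη := h.integrable_sinh_mul_force hΦ hV hm hγ hv
  refine (h.isUniformModular_collision hΦ hV hm hγ).isPreGenericAt (η := η)
    (h.isSymmDissipationPair_collision hΦ hV hm hγ) rfl (h.hamTangent_entropyCovector hΦ hV m)
    ((coshModular_ne_top_iff measurable_increment η).2 hcη) fun ξ hξ => ?_
  have hcξ := integrable_cosh_of_mem_boundedCore (μ := collisionMeasure m γ ρ)
    measurable_increment hξ
  obtain ⟨K, hK⟩ := hξ
  have hsξ : Integrable (fun o => Real.sinh (increment ρ η o) * increment ρ ξ o)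
      (collisionMeasure m γ ρ) :=
    (h.integrable_sinh_force hΦ hV hm hγ).mul_bdd (continuous_increment ξ).aestronglyMeasurable
      (Filter.Eventually.of_forall hK)
  rw [h.apply_eq_integral hΦ hV hm hγ hv hsξ, h.apply_eq_integral hΦ hV hm hγ hv hsη,
    toReal_coshModular measurable_increment, toReal_coshModular measurable_increment,
    ← integral_sub hsξ hcξ, ← integral_sub hsη hcη]
  refine integral_mono (hsξ.sub hcξ) (hsη.sub hcη) fun o => ?_
  have := cosh_add_sinh_mul_sub_le (increment ρ η o) (increment ρ ξ o)
  simp only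
  linarith

end Andersen

end PreGeneric

end

open PreGeneric
theorem theorem5p1 (d : ℕ) (hd : 0 < d) (V Φ : Vec d → ℝ)
    (hV : ContDiff ℝ 1 V) (hΦ : ContDiff ℝ 1 Φ) (hΦ_symm : ∀ q, Φ (-q) = Φ q)
    (m γ : ℝ) (hm : 0 < m) (hγ : 0 < γ) :
    -- the differentials of energy and entropy
    (∀ ρ : Phase d → ℝ, IsRegularState V Φ ρ →
      dEnergy m V Φ ρ ∈ cotangent ρ ∧ IsFunctionalDeriv (energy m V Φ) ρ (dEnergy m V Φ ρ) ∧
      dEntropy m V Φ ρ ∈ cotangent ρ ∧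
        IsFunctionalDeriv (entropy m V Φ) ρ (dEntropy m V Φ ρ)) ∧
    -- the Andersen thermostat
    IsPreGeneric (tangentialStates V Φ (dynamics m V Φ (genAT m γ))) (entropy m V Φ)
      (fun ρ => legendre (tangent ρ) (psiStarAT m γ ρ)) (psiStarAT m γ)
      (hamField m V Φ) (dynamics m V Φ (genAT m γ)) ∧
    -- the Vlasov-Fokker-Planck equation
    IsPreGeneric {ρ | IsRegularState V Φ ρ} (entropy m V Φ)
      (fun ρ => legendre (tangent ρ) (psiStarVFP γ ρ)) (psiStarVFP γ)
      (hamField m V Φ) (dynamics m V Φ (genVFP m γ)) := by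
  refine ⟨fun ρ h => ⟨h.dEnergy_mem hΦ hV m,
      fun σ hσ _ => h.energy_functionalDeriv hΦ hΦ_symm hV m hσ, h.dEntropy_mem hΦ hV m,
      fun σ hσ _ => h.entropy_functionalDeriv hΦ hΦ_symm hV m hσ⟩,
    isPreGeneric_andersen hV hΦ hΦ_symm hm hγ,
    isPreGeneric_vlasovFokkerPlanck hV hΦ hΦ_symm m hγ⟩
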